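/- Let $G$ be a (finite-dimensional, real) Lie group with Lie algebra $\mathfrak g$, and let $V\subseteq\mathfrak g$ be a polarization, i.e. a linear subspace. Assume that there are $X,Y\in V$ such that the set $\{\mathrm{Ad}_{\exp(tY)}X : t\in\mathbb R\}$ is unbounded in $\mathfrak g$. Then there exists a strongly convex norm $\|\cdot\|$ on $V$ for which there is branching of normal geodesics in $G$ for the sub-Finsler metric given by $(V,\|\cdot\|)$. Here the following terminology is used. * Let $\mathrm E(v)=\tfrac12\|v\|^2$ be the energy of the norm. The norm $\|\cdot\|$ is *strongly convex* if there is a Euclidean norm $N$ on $V$ such that $\mathrm E(tv+(1-t)u)\le t\,\mathrm E(v)+(1-t)\,\mathrm E(u)-t(1-t)N(u-v)^2$ for all $u,v\in V$ and $t\in[0,1]$. The *subdifferential* of $\mathrm E$ at $u\in V$ is $\partial_u\mathrm E=\{\eta\in V^*:\eta(v-u)\le \mathrm E(v)-\mathrm E(u)\ \text{for all } v\in V\}$. * An absolutely continuous curve $\gamma:[a,b]\to G$ is *horizontal* with *control* $u:[a,b]\to V$ if $\dot\gamma(t)=\mathrm dL_{\gamma(t)}u(t)$ for a.e. $t\in[a,b]$,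 where $L_g$ is the left translation by $g$. * The sub-Finsler (Carnot–Carathéodory) distance $d(g,h)\in[0,\infty]$ is the infimum of $\int_0^1\|u(t)\|\,\mathrm dt$ over all horizontal curves $\gamma:[0,1]\to G$ with control $u$, $\gamma(0)=g$ and $\gamma(1)=h$. * A curve $\gamma:[a,b]\to G$ is a *geodesic* if $d(\gamma(s),\gamma(t))=|s-t|$ for all $s,t\in[a,b]$. * A horizontal curve $\gamma:[a,b]\to G$ with control $u\in L^2([a,b],V)$ is *normal* if there is $\lambda\in\mathfrak g^*$ such that $\lambda\circ\mathrm{Ad}_{\gamma(t)}|_V\in\partial_{u(t)}\mathrm E$ for a.e. $t\in[a,b]$. A *normal geodesic* is a geodesic that is a normal curve. * There is *branching of normal geodesics* if there are an interval $[a,b]$, two different normal geodesics $\gamma_1,\gamma_2:[a,b]\to G$, and a subinterval $[c,d]\subseteq[a,b]$ with $c<d$ such that $\gamma_1=\gamma_2$ on $[c,d]$. -/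

import Mathlib

open Set MeasureTheory
open scoped Manifold ContDiff ENNReal

noncomputable section

namespace SubFinsler

/-! ### Norms, energy, strong convexity, subdifferentials -/

section Convex

variable {W : Type*} [AddCommGroup W] [Module ℝ W]

/-- A seminorm that vanishes only at the origin, i.e. a norm. -/
def IsNorm (p : Seminorm ℝ W) : Prop :=
  ∀ v : W, p v = 0 → v = 0

/-- The energy `v ↦ ‖v‖² / 2` of a norm. -/
def energy (p : Seminorm ℝ W) (v : W) : ℝ :=
  (p v) ^ 2 / 2

/-- Strong convexity of a function, with modulus the square `N (u - v) ^ 2 = B (u - v) (u - v)` of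
a Euclidean norm `N`, that is, the norm of an inner product `B`. -/
def IsStronglyConvex (f : W → ℝ) : Prop :=
  ∃ B : W →ₗ[ℝ] W →ₗ[ℝ] ℝ,
    (∀ u v, B u v = B v u) ∧ (∀ v, v ≠ 0 → 0 < B v v) ∧
    ∀ u v : W, ∀ t ∈ Icc (0 : ℝ) 1,
      f (t • v + (1 - t) • u) ≤ t * f v + (1 - t) * f u - t * (1 - t) * B (u - v) (u - v)

/-- The subdifferential of `f` at `u`. It is used on finite-dimensional spaces only, where all
linear forms are continuous. -/
def subdifferential (f : W → ℝ) (u : W) : Set (Module.Dual ℝ W) :=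
  {η | ∀ v, η (v - u) ≤ f v - f u}

end Convex

/-! ### Lie groups: the exponential map and the adjoint representation -/

variable {E : Type*} [NormedAddCommGroup E] [NormedSpace ℝ E]
  {G : Type*} [TopologicalSpace G] [ChartedSpace E G] [Group G]

/-- The adjoint map `Ad_g`, the differential at the identity of `h ↦ g h g⁻¹`. -/
def Ad (g : G) : GroupLieAlgebra 𝓘(ℝ, E) G →L[ℝ] GroupLieAlgebra 𝓘(ℝ, E) G :=
  mfderiv 𝓘(ℝ, E) 𝓘(ℝ, E) (fun h : G => g * h * g⁻¹) 1

/-- `γ` has velocity `dL_{γ t} Z` at time `t`, with `Z` in the Lie algebra. -/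
def HasLeftVelocityAt (γ : ℝ → G) (Z : GroupLieAlgebra 𝓘(ℝ, E) G) (t : ℝ) : Prop :=
  HasMFDerivAt 𝓘(ℝ, ℝ) 𝓘(ℝ, E) γ t
    ((1 : ℝ →L[ℝ] ℝ).smulRight (mulInvariantVectorField Z (γ t)))

theorem exists_oneParameter [FiniteDimensional ℝ E] [LieGroup 𝓘(ℝ, E) ∞ G] [T2Space G]
    (Y : GroupLieAlgebra 𝓘(ℝ, E) G) :
    ∃ γ : ℝ → G, γ 0 = 1 ∧ ∀ t, HasLeftVelocityAt γ Y t := by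
  have : CompleteSpace E := FiniteDimensional.complete ℝ E
  have h3 : minSmoothness ℝ 3 ≤ (∞ : WithTop ℕ∞) := by
    rw [minSmoothness_of_isRCLikeNormedField]
    exact WithTop.coe_le_coe.2 le_top
  have : LieGroup 𝓘(ℝ, E) (minSmoothness ℝ 3) G := LieGroup.of_le h3
  have : IsManifold 𝓘(ℝ, E) 1 G := IsManifold.of_le (n := ∞) (by simp)
  have hv : ContMDiff 𝓘(ℝ, E) (𝓘(ℝ, E)).tangent 1
      (fun x : G => (⟨x, mulInvariantVectorField Y x⟩ : TangentBundle 𝓘(ℝ, E) G)) :=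
    (contMDiff_mulInvariantVectorField Y).of_le (by simp)
  obtain ⟨γ, h0, hγ⟩ :=
    exists_isMIntegralCurveAt_of_contMDiffAt_boundaryless (t₀ := 0) (hv 1)
  obtain ⟨ε, hε, hγ⟩ := isMIntegralCurveAt_iff'.1 hγ
  rw [Real.ball_eq_Ioo, zero_sub, zero_add] at hγ
  refine exists_isMIntegralCurve_of_isMIntegralCurveOn hv hε (fun x => ?_) 1
  refine ⟨fun t => x * γ t, by simp [h0], fun t ht => ?_⟩
  have hmul : ∀ a b : G, MDifferentiableAt 𝓘(ℝ, E) 𝓘(ℝ, E) (fun y : G => a * y) b := fun a b =>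
    (contMDiff_mul_left (I := 𝓘(ℝ, E)) (n := ∞)).contMDiffAt.mdifferentiableAt (by simp)
  have h1 := ((hmul x (γ t)).hasMFDerivAt).comp_hasMFDerivWithinAt t (hγ t ht)
  have h2 : mulInvariantVectorField (I := 𝓘(ℝ, E)) Y (x * γ t)
      = mfderiv 𝓘(ℝ, E) 𝓘(ℝ, E) (fun y : G => x * y) (γ t)
          (mulInvariantVectorField Y (γ t)) := by
    have hc : (fun y : G => x * γ t * y) = (fun y : G => x * y) ∘ (fun y : G => γ t * y) := by
      funext y
      simp [mul_assoc]
    have h5 := mfderiv_comp (I := 𝓘(ℝ, E)) (I' := 𝓘(ℝ, E)) (I'' := 𝓘(ℝ, E)) (1 : G)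
      (hmul x (γ t * 1)) (hmul (γ t) 1)
    rw [← hc] at h5
    have h6 : ∀ z : G, z = γ t → ∀ w : E,
        (mfderiv 𝓘(ℝ, E) 𝓘(ℝ, E) (fun y : G => x * y) z : E → E) w
          = (mfderiv 𝓘(ℝ, E) 𝓘(ℝ, E) (fun y : G => x * y) (γ t) : E → E) w := by
      rintro z rfl w
      rfl
    exact (DFunLike.congr_fun h5 Y).trans (h6 _ (mul_one _) _)
  have h7 : (1 : ℝ →L[ℝ] ℝ).smulRight (mulInvariantVectorField (I := 𝓘(ℝ, E)) Y (x * γ t))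
      = (mfderiv 𝓘(ℝ, E) 𝓘(ℝ, E) (fun y : G => x * y) (γ t)).comp
        ((1 : ℝ →L[ℝ] ℝ).smulRight (mulInvariantVectorField Y (γ t))) := by
    rw [h2]
    apply ContinuousLinearMap.ext
    intro r
    exact (map_smul (mfderiv 𝓘(ℝ, E) 𝓘(ℝ, E) (fun y : G => x * y) (γ t)) r _).symm
  exact h7 ▸ h1

/-- The exponential map: `exp Y = γ 1`, with `γ` the integral curve through the identity of the
left-invariant vector field of `Y`. -/
def lieExp [FiniteDimensional ℝ E] [LieGroup 𝓘(ℝ, E) ∞ G] [T2Space G]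
    (Y : GroupLieAlgebra 𝓘(ℝ, E) G) : G :=
  (exists_oneParameter Y).choose 1

/-! ### Horizontal curves and the Carnot-Carathéodory distance -/

/-- Absolute continuity on `[a, b]` of a curve in a manifold: it is continuous and absolutely
continuous in charts. -/
def IsACCurve (γ : ℝ → G) (a b : ℝ) : Prop :=
  ContinuousOn γ (Icc a b) ∧
  ∀ (x : G) (c d : ℝ), a ≤ c → c ≤ d → d ≤ b → MapsTo γ (Icc c d) (chartAt E x).source →
    AbsolutelyContinuousOnInterval (fun t => chartAt E x (γ t)) c d

variable (V : Submodule ℝ (GroupLieAlgebra 𝓘(ℝ, E) G))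

/-- `γ` is a horizontal curve on `[a, b]` for the polarization `V`, with control `u`. (The control
is determined almost everywhere by `γ`, and it is automatically integrable.) -/
def IsHorizontal (γ : ℝ → G) (u : ℝ → V) (a b : ℝ) : Prop :=
  IsACCurve (E := E) γ a b ∧
  ∀ᵐ t ∂(volume.restrict (Icc a b)), HasLeftVelocityAt γ (u t : GroupLieAlgebra 𝓘(ℝ, E) G) t

variable {V}

/-- The Carnot-Carathéodory distance of a norm on `V`, with values in `[0, ∞]`. -/
def ccDist (p : Seminorm ℝ V) (g h : G) : ℝ≥0∞ :=
  ⨅ (γ : ℝ → G) (u : ℝ → V) (_ : IsHorizontal V γ u 0 1) (_ : γ 0 = g) (_ : γ 1 = h),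
    ∫⁻ t in Icc (0 : ℝ) 1, ENNReal.ofReal (p (u t))

/-- `γ` is a geodesic on `[a, b]`: an isometric embedding for the Carnot-Carathéodory distance. -/
def IsGeodesic (p : Seminorm ℝ V) (γ : ℝ → G) (a b : ℝ) : Prop :=
  ∀ s ∈ Icc a b, ∀ t ∈ Icc a b, ccDist p (γ s) (γ t) = ENNReal.ofReal |s - t|

/-- `γ` is a normal curve on `[a, b]`: it is horizontal, with a square-integrable control `u`, and
for some covector `lam` the normal inclusion `lam ∘ Ad_{γ t}|_V ∈ ∂_{u t} (energy p)` holds at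
almost every time `t`. -/
def IsNormalCurve (p : Seminorm ℝ V) (γ : ℝ → G) (a b : ℝ) : Prop :=
  ∃ u : ℝ → V, IsHorizontal V γ u a b ∧
    AEStronglyMeasurable u (volume.restrict (Icc a b)) ∧
    IntegrableOn (fun t => (p (u t)) ^ 2) (Icc a b) ∧
    ∃ lam : Module.Dual ℝ (GroupLieAlgebra 𝓘(ℝ, E) G),
      ∀ᵐ t ∂(volume.restrict (Icc a b)),
        (lam ∘ₗ (Ad (γ t)).toLinearMap) ∘ₗ V.subtype ∈ subdifferential (energy p) (u t)

/-- Branching of normal geodesics: two curves on some interval `[a, b]`, both of them normal curves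
and geodesics, are different but coincide on a nondegenerate subinterval `[c, d]`. -/
def BranchingOfNormalGeodesics (p : Seminorm ℝ V) : Prop :=
  ∃ (a b : ℝ) (γ₁ γ₂ : ℝ → G),
    (IsNormalCurve p γ₁ a b ∧ IsGeodesic p γ₁ a b) ∧
    (IsNormalCurve p γ₂ a b ∧ IsGeodesic p γ₂ a b) ∧
    (∃ c d : ℝ, a ≤ c ∧ c < d ∧ d ≤ b ∧ EqOn γ₁ γ₂ (Icc c d)) ∧
    ∃ t ∈ Icc a b, γ₁ t ≠ γ₂ t

end SubFinsler

end

/-! Write `[Y, X]` for `adE E G Y X`. If `[Y, X] = 0`, then `Ad_{exp(tY)} X = X` for all `t`. An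
unbounded orbit therefore forces `[Y, X] ≠ 0`, and this is all that the construction needs.

Choose a covector `lam` with `lam Y = 1` and, after replacing `X` by `-X` if necessary, `lam [Y, X]
> 0`. Adding a multiple of `Y` to `X` gives `Z` with `lam Z = 1/2` and the same bracket with `Y`.
The norm is built with a corner at the unit vector `Y` (`exists_norm_with_corner`): subgradients at
`Y` satisfy `η Z ≤ 1/2`, and every `η` with `η Y = 1`, `|η Z| ≤ 1/2` that is small in the remaining
directions is a subgradient.

Along `γ₁ t = exp(tY)` the value `lam (Ad Y)` stays equal to 1, while `lam (Ad Z)` increases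
strictly through 1/2 at `t = 0`. Hence the normal inclusion for `lam` with constant control `Y`
holds for small `t ≤ 0` and fails for small `t > 0` (`exists_norm_of_pos`). A second covector `α`,
with `α Y = 1` and `α Z = 0`, sits well inside the corner, so `γ₁` is normal on both sides of 0 with
covector `α`. By strong convexity, the normal equation for `lam` is an ODE with a Lipschitz
right-hand side. Its solution `γ₂` through the identity agrees with `γ₁` just before time 0 and
cannot agree with it just after.

It remains to see that short normal curves of unit speed are geodesics
(`exists_isNormalCurve_isGeodesic`). A competitor is compared with the curve through their quotient
in the group, and the covector minus a quadratic correction acts as a calibration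
(`exists_forall_ofReal_le_length`). Unit speed of `γ₂` follows from conservation of the Hamiltonian
(`speed_eq_of_normal`), which rests on `[u, u] = 0` (`adE_self`). -/

noncomputable section

namespace SubFinsler

open Filter Topology

/-! ### The chart at the identity and left velocities -/

section Chart

variable {E : Type*} [NormedAddCommGroup E]
  {G : Type*} [TopologicalSpace G] [ChartedSpace E G] [Group G]

variable (E G) in
/-- The preferred chart at the identity. -/
def idChart : OpenPartialHomeomorph G E := chartAt E (1 : G)

variable (E G) in
/-- The coordinate of the identity. -/
def idPt : E := idChart E G 1

lemma one_mem_idChart : (1 : G) ∈ (idChart E G).source := mem_chart_source E (1 : G)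

lemma idPt_mem_target : idPt E G ∈ (idChart E G).target :=
  (idChart E G).map_source one_mem_idChart

@[simp] lemma idChart_one : idChart E G 1 = idPt E G := rfl

@[simp] lemma idChart_symm_idPt : (idChart E G).symm (idPt E G) = 1 :=
  (idChart E G).left_inv one_mem_idChart

lemma continuousAt_idChart_symm : ContinuousAt (idChart E G).symm (idPt E G) :=
  (idChart E G).continuousAt_symm idPt_mem_target

lemma continuousAt_idChart {g : G} (hg : g ∈ (idChart E G).source) :
    ContinuousAt (idChart E G) g :=
  (idChart E G).continuousAt hg

lemma idChart_source_mem_nhds : (idChart E G).source ∈ 𝓝 (1 : G) :=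
  (idChart E G).open_source.mem_nhds one_mem_idChart

lemma idChart_target_mem_nhds : (idChart E G).target ∈ 𝓝 (idPt E G) :=
  (idChart E G).open_target.mem_nhds idPt_mem_target

variable [NormedSpace ℝ E] [LieGroup 𝓘(ℝ, E) ∞ G]

lemma contMDiffAt_idChart {g : G} (hg : g ∈ (idChart E G).source) :
    ContMDiffAt 𝓘(ℝ, E) 𝓘(ℝ, E) ∞ (idChart E G) g :=
  (contMDiffOn_chart (I := 𝓘(ℝ, E)) (x := (1 : G))).contMDiffAt
    ((idChart E G).open_source.mem_nhds hg)

lemma contMDiffAt_idChart_symm {x : E} (hx : x ∈ (idChart E G).target) :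
    ContMDiffAt 𝓘(ℝ, E) 𝓘(ℝ, E) ∞ (idChart E G).symm x :=
  (contMDiffOn_chart_symm (I := 𝓘(ℝ, E)) (x := (1 : G))).contMDiffAt
    ((idChart E G).open_target.mem_nhds hx)

/-- The tangent space at the identity is identified with `E` through this very chart, so elements of
the Lie algebra can be used as vectors of `E` without any conversion. -/
lemma hasMFDerivAt_idChart_one :
    HasMFDerivAt 𝓘(ℝ, E) 𝓘(ℝ, E) (idChart E G) (1 : G)
      (ContinuousLinearMap.id ℝ (TangentSpace 𝓘(ℝ, E) (1 : G))) := by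
  have h := mfderiv_extChartAt_self (I := 𝓘(ℝ, E)) (x := (1 : G))
  rw [← h]
  have h2 := (mdifferentiableAt_extChartAt (I := 𝓘(ℝ, E)) (mem_chart_source E (1 : G))).hasMFDerivAt
  simpa using! h2

lemma hasMFDerivAt_idChart_symm :
    HasMFDerivAt 𝓘(ℝ, E) 𝓘(ℝ, E) (idChart E G).symm (idPt E G)
      (ContinuousLinearMap.id ℝ E) := by
  have h1 := ((contMDiffAt_idChart_symm (G := G) (idPt_mem_target (E := E))).mdifferentiableAt
    (by simp)).hasMFDerivAt
  have h2 : HasMFDerivAt 𝓘(ℝ, E) 𝓘(ℝ, E) (idChart E G) ((idChart E G).symm (idPt E G))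
      (ContinuousLinearMap.id ℝ (TangentSpace 𝓘(ℝ, E) (1 : G))) := by
    rw [idChart_symm_idPt]; exact hasMFDerivAt_idChart_one
  have h3 := h2.comp _ h1
  have h4 : HasMFDerivAt 𝓘(ℝ, E) 𝓘(ℝ, E) (idChart E G ∘ (idChart E G).symm) (idPt E G)
      (ContinuousLinearMap.id ℝ E) :=
    (hasMFDerivAt_id (I := 𝓘(ℝ, E)) (idPt E G)).congr_of_eventuallyEq
      ((idChart E G).eventually_right_inverse idPt_mem_target)
  have h5 := hasMFDerivAt_unique h3 h4
  have h6 : mfderiv 𝓘(ℝ, E) 𝓘(ℝ, E) (idChart E G).symm (idPt E G) = ContinuousLinearMap.id ℝ E := by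
    rw [← h5]; rfl
  rw [← h6]; exact h1

lemma hasMFDerivAt_mul_left (g h : G) : HasMFDerivAt 𝓘(ℝ, E) 𝓘(ℝ, E) (fun y : G => g * y) h
    (mfderiv 𝓘(ℝ, E) 𝓘(ℝ, E) (fun y : G => g * y) h) :=
  ((contMDiff_mul_left (I := 𝓘(ℝ, E)) (n := ∞)).contMDiffAt.mdifferentiableAt
    (by simp)).hasMFDerivAt

/-- The velocity of a curve in a Lie group, read in the chart at the identity after a left
translation. -/
theorem hasLeftVelocityAt_iff {γ : ℝ → G} {Z : E} {t : ℝ} :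
    HasLeftVelocityAt (E := E) γ Z t ↔
      ContinuousAt γ t ∧ HasDerivAt (fun s => idChart E G ((γ t)⁻¹ * γ s)) Z t := by
  constructor
  · intro h
    refine ⟨h.continuousAt, ?_⟩
    have h1 : HasMFDerivAt 𝓘(ℝ, E) 𝓘(ℝ, E) (idChart E G) ((γ t)⁻¹ * γ t)
      (ContinuousLinearMap.id ℝ (TangentSpace 𝓘(ℝ, E) (1 : G))) := by
      rw [inv_mul_cancel]; exact hasMFDerivAt_idChart_one
    have h2 := hasMFDerivAt_mul_left (E := E) (γ t)⁻¹ (γ t)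
    have h3 := (h1.comp _ h2).comp _ h
    let D : E →L[ℝ] E := mfderiv 𝓘(ℝ, E) 𝓘(ℝ, E) (fun y : G => (γ t)⁻¹ * y) (γ t)
    let w : E := mulInvariantVectorField (I := 𝓘(ℝ, E)) Z (γ t)
    have h4 : HasFDerivAt (fun s => idChart E G ((γ t)⁻¹ * γ s))
        (D.comp ((1 : ℝ →L[ℝ] ℝ).smulRight w)) t :=
      hasMFDerivAt_iff_hasFDerivAt.1 h3
    replace h4 := h4.hasDerivAt
    have h5 : mfderiv 𝓘(ℝ, E) 𝓘(ℝ, E) (fun y : G => (γ t)⁻¹ * y) (γ t)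
      (mulInvariantVectorField (I := 𝓘(ℝ, E)) Z (γ t)) = Z := by
      have h6 : HasMFDerivAt 𝓘(ℝ, E) 𝓘(ℝ, E) (fun y : G => (γ t)⁻¹ * y) (γ t * 1)
        (mfderiv 𝓘(ℝ, E) 𝓘(ℝ, E) (fun y : G => (γ t)⁻¹ * y) (γ t)) := by
        rw [mul_one]; exact h2
      have h7 := h6.comp _ (hasMFDerivAt_mul_left (E := E) (γ t) 1)
      have h8 : (fun y : G => (γ t)⁻¹ * y) ∘ (fun y : G => γ t * y) = id := by
        ext y; simp
      rw [h8] at h7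
      have h9 := hasMFDerivAt_unique h7 (hasMFDerivAt_id (I := 𝓘(ℝ, E)) (1 : G))
      exact DFunLike.congr_fun h9 Z
    have h10 : D.comp ((1 : ℝ →L[ℝ] ℝ).smulRight w) 1 = Z := by
      simp only [ContinuousLinearMap.comp_apply, ContinuousLinearMap.smulRight_apply,
        one_apply_eq_self, one_smul]
      exact h5
    rwa [h10] at h4
  · rintro ⟨hc, h⟩
    have hev : γ =ᶠ[𝓝 t] (fun y : G => γ t * y) ∘ (idChart E G).symm ∘
        (fun s => idChart E G ((γ t)⁻¹ * γ s)) := by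
      have : Tendsto (fun s => (γ t)⁻¹ * γ s) (𝓝 t) (𝓝 1) := by
        have := (((contMDiff_mul_left (I := 𝓘(ℝ, E)) (n := ∞)
          (a := (γ t)⁻¹)).continuous.continuousAt).comp hc).tendsto
        simpa using! this
      filter_upwards [this.eventually (idChart_source_mem_nhds (E := E))] with s hs
      simp only [Function.comp_apply]
      rw [(idChart E G).left_inv hs]; simp
    have h1 := h.hasFDerivAt.hasMFDerivAt
    have h2 : HasMFDerivAt 𝓘(ℝ, E) 𝓘(ℝ, E) (idChart E G).symm (idChart E G ((γ t)⁻¹ * γ t))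
      (ContinuousLinearMap.id ℝ E) := by
      rw [inv_mul_cancel]; exact hasMFDerivAt_idChart_symm
    have h3 : HasMFDerivAt 𝓘(ℝ, E) 𝓘(ℝ, E) (fun y : G => γ t * y)
      ((idChart E G).symm (idChart E G ((γ t)⁻¹ * γ t)))
      (mfderiv 𝓘(ℝ, E) 𝓘(ℝ, E) (fun y : G => γ t * y) 1) := by
      rw [inv_mul_cancel, idChart_one, idChart_symm_idPt]
      exact hasMFDerivAt_mul_left (E := E) _ _
    have h4 := (h3.comp t (h2.comp t h1)).congr_of_eventuallyEq hev
    have h5 : ∀ D : E →L[ℝ] E, (1 : ℝ →L[ℝ] ℝ).smulRight (D Z) =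
        D.comp ((ContinuousLinearMap.id ℝ E).comp (ContinuousLinearMap.toSpanSingleton ℝ Z)) := by
      intro D
      ext
      simp
    unfold HasLeftVelocityAt mulInvariantVectorField
    have h6 := h5 (mfderiv 𝓘(ℝ, E) 𝓘(ℝ, E) (fun y : G => γ t * y) 1)
    exact h6 ▸ h4

end Chart

/-! ### Group operations and the adjoint representation in coordinates -/

section LocalGroup

variable {E : Type*} [NormedAddCommGroup E] [NormedSpace ℝ E]
  {G : Type*} [TopologicalSpace G] [ChartedSpace E G] [Group G] [LieGroup 𝓘(ℝ, E) ∞ G]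

lemma contMDiffAt_idChart_symm_comp {F : Type*} [NormedAddCommGroup F] [NormedSpace ℝ F]
    {f : F → E} {x : F} (hf : ContDiffAt ℝ ∞ f x) (hx : f x ∈ (idChart E G).target) :
    ContMDiffAt 𝓘(ℝ, F) 𝓘(ℝ, E) ∞ (fun p => (idChart E G).symm (f p)) x :=
  (contMDiffAt_idChart_symm hx).comp x hf.contMDiffAt

lemma contDiffAt_idChart_comp {F : Type*} [NormedAddCommGroup F] [NormedSpace ℝ F]
    {f : F → G} {x : F} (hf : ContMDiffAt 𝓘(ℝ, F) 𝓘(ℝ, E) ∞ f x)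
    (hx : f x ∈ (idChart E G).source) :
    ContDiffAt ℝ ∞ (fun p => idChart E G (f p)) x :=
  contMDiffAt_iff_contDiffAt.1 ((contMDiffAt_idChart hx).comp x hf)

lemma contDiffAt_mul_left_chart {g : G} {y : E} (hy : y ∈ (idChart E G).target)
    (h : g * (idChart E G).symm y ∈ (idChart E G).source) :
    ContDiffAt ℝ ∞ (fun y => idChart E G (g * (idChart E G).symm y)) y :=
  contDiffAt_idChart_comp (contMDiffAt_const.mul
    (contMDiffAt_idChart_symm_comp contDiffAt_id hy)) h

lemma contDiffAt_mul_chart :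
    ContDiffAt ℝ ∞ (fun p : E × E => idChart E G ((idChart E G).symm p.1 * (idChart E G).symm p.2))
      (idPt E G, idPt E G) :=
  contDiffAt_idChart_comp
    ((contMDiffAt_idChart_symm_comp contDiffAt_fst idPt_mem_target).mul
      (contMDiffAt_idChart_symm_comp contDiffAt_snd idPt_mem_target))
    (by simpa using! one_mem_idChart (E := E) (G := G))

lemma contDiffAt_div_chart :
    ContDiffAt ℝ ∞
      (fun p : E × E => idChart E G ((idChart E G).symm p.1 * ((idChart E G).symm p.2)⁻¹))
      (idPt E G, idPt E G) :=
  contDiffAt_idChart_comp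
    ((contMDiffAt_idChart_symm_comp contDiffAt_fst idPt_mem_target).mul
      (contMDiffAt_idChart_symm_comp contDiffAt_snd idPt_mem_target).inv)
    (by simpa using! one_mem_idChart (E := E) (G := G))

lemma contDiffAt_conj_chart :
    ContDiffAt ℝ ∞
      (fun p : E × E => idChart E G ((idChart E G).symm p.1 * (idChart E G).symm p.2 *
        ((idChart E G).symm p.1)⁻¹))
      (idPt E G, idPt E G) :=
  contDiffAt_idChart_comp
    (((contMDiffAt_idChart_symm_comp contDiffAt_fst idPt_mem_target).mul
      (contMDiffAt_idChart_symm_comp contDiffAt_snd idPt_mem_target)).mul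
      (contMDiffAt_idChart_symm_comp contDiffAt_fst idPt_mem_target).inv)
    (by simpa using! one_mem_idChart (E := E) (G := G))

variable (E) in
/-- The adjoint map `Ad g`, as an endomorphism of the model space. -/
def AdE (g : G) : E →L[ℝ] E := Ad (E := E) g

lemma hasFDerivAt_conj (g : G) :
    HasFDerivAt (fun y => idChart E G (g * (idChart E G).symm y * g⁻¹)) (AdE E g) (idPt E G) := by
  have h1 : MDifferentiableAt 𝓘(ℝ, E) 𝓘(ℝ, E) (fun h : G => g * h * g⁻¹) 1 :=
    ((contMDiffAt_const.mul contMDiffAt_id).mul contMDiffAt_const :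
      ContMDiffAt 𝓘(ℝ, E) 𝓘(ℝ, E) ∞ (fun h : G => g * h * g⁻¹) 1).mdifferentiableAt (by simp)
  have h2 : HasMFDerivAt 𝓘(ℝ, E) 𝓘(ℝ, E) (fun h : G => g * h * g⁻¹)
      ((idChart E G).symm (idPt E G)) (Ad (E := E) g) := by
    rw [idChart_symm_idPt]; exact h1.hasMFDerivAt
  have h3 : HasMFDerivAt 𝓘(ℝ, E) 𝓘(ℝ, E) (idChart E G)
      (g * (idChart E G).symm (idPt E G) * g⁻¹)
      (ContinuousLinearMap.id ℝ (TangentSpace 𝓘(ℝ, E) (1 : G))) := by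
    rw [idChart_symm_idPt, mul_one, mul_inv_cancel]; exact hasMFDerivAt_idChart_one
  exact hasMFDerivAt_iff_hasFDerivAt.1
    (h3.comp (idPt E G) (h2.comp (idPt E G) hasMFDerivAt_idChart_symm))

lemma AdE_eq_fderiv (g : G) :
    AdE E g = fderiv ℝ (fun y => idChart E G (g * (idChart E G).symm y * g⁻¹)) (idPt E G) :=
  (hasFDerivAt_conj g).fderiv.symm

@[simp] lemma AdE_one : AdE E (1 : G) = ContinuousLinearMap.id ℝ E := by
  refine (hasFDerivAt_conj (E := E) (1 : G)).unique ?_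
  refine (hasFDerivAt_id (idPt E G)).congr_of_eventuallyEq ?_
  filter_upwards [idChart_target_mem_nhds (E := E) (G := G)] with y hy
  simp [(idChart E G).right_inv hy]

lemma tendsto_conj_symm (g : G) :
    Tendsto (fun y => g * (idChart E G).symm y * g⁻¹) (𝓝 (idPt E G)) (𝓝 1) := by
  have := topologicalGroup_of_lieGroup 𝓘(ℝ, E) ∞ (G := G)
  have h : ContinuousAt (fun y => g * (idChart E G).symm y * g⁻¹) (idPt E G) :=
    (continuousAt_const.mul continuousAt_idChart_symm).mul continuousAt_const
  simpa using! h.tendsto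

lemma AdE_mul (g h : G) : AdE E (g * h) = (AdE E g).comp (AdE E h) := by
  refine (hasFDerivAt_conj (E := E) (g * h)).unique ?_
  have h1 : HasFDerivAt (fun y => idChart E G (g * (idChart E G).symm y * g⁻¹)) (AdE E g)
      (idChart E G (h * (idChart E G).symm (idPt E G) * h⁻¹)) := by
    simpa using! hasFDerivAt_conj (E := E) g
  refine (h1.comp (idPt E G) (hasFDerivAt_conj (E := E) h)).congr_of_eventuallyEq ?_
  filter_upwards [(tendsto_conj_symm (E := E) h).eventually
    (idChart_source_mem_nhds (E := E))] with y hy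
  simp only [Function.comp_apply]
  rw [(idChart E G).left_inv hy]
  congr 1
  group

/-- The adjoint map is the partial derivative of the smooth map `(x, y) ↦ x y x⁻¹` in its second
variable at the identity, hence depends smoothly on `x`. -/
lemma contDiffAt_AdE :
    ContDiffAt ℝ ∞ (fun x => AdE E ((idChart E G).symm x)) (idPt E G) := by
  simp only [AdE_eq_fderiv]
  exact ContDiffAt.fderiv (f := fun x y => idChart E G ((idChart E G).symm x *
    (idChart E G).symm y * ((idChart E G).symm x)⁻¹)) (g := fun _ => idPt E G)
    (contDiffAt_conj_chart (E := E) (G := G)) contDiffAt_const le_rfl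

variable (E G) in
/-- The differential of the adjoint representation at the identity. -/
def adE : E →L[ℝ] E →L[ℝ] E := fderiv ℝ (fun x => AdE E ((idChart E G).symm x)) (idPt E G)

lemma hasFDerivAt_AdE :
    HasFDerivAt (fun x => AdE E ((idChart E G).symm x)) (adE E G) (idPt E G) :=
  (contDiffAt_AdE.differentiableAt (by simp)).hasFDerivAt

/-- A map `k` of two variables with `k (x, o) = o`, `k (o, y) = y` and `k (x, x) = x` has
alternating mixed second derivative at `(o, o)`. -/
lemma mixed_fderiv_self_eq_zero {k : E × E → E} {o : E} (hk : ContDiffAt ℝ ∞ k (o, o))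
    (h1 : ∀ᶠ x in 𝓝 o, k (x, o) = o) (h2 : ∀ᶠ y in 𝓝 o, k (o, y) = y)
    (h3 : ∀ᶠ x in 𝓝 o, k (x, x) = x) (u : E) :
    fderiv ℝ (fun x => fderiv ℝ (fun y => k (x, y)) o) o u u = 0 := by
  have hd : ∀ᶠ q in 𝓝 (o, o), DifferentiableAt ℝ k q :=
    (hk.of_le (m := 1) (by simp)).eventually (by simp) |>.mono fun q hq =>
      hq.differentiableAt (by simp)
  have hD : DifferentiableAt ℝ (fderiv ℝ k) (o, o) :=
    (hk.fderiv_right (m := ∞) le_rfl).differentiableAt (by simp)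
  set D2 := fderiv ℝ (fderiv ℝ k) (o, o) with hD2
  have hD' : HasFDerivAt (fderiv ℝ k) D2 (o, o) := hD.hasFDerivAt
  have hsymm : ∀ v w, D2 v w = D2 w v := by
    have := hk.isSymmSndFDerivAt (by
      rw [minSmoothness_of_isRCLikeNormedField]
      exact WithTop.coe_le_coe.2 le_top)
    exact fun v w => this v w
  -- second derivative along a linear parametrization of an affine subspace
  have key : ∀ (L : E →L[ℝ] E × E) (c : E × E) (T : E →L[ℝ] E), c + L o = (o, o) →
      (∀ᶠ x in 𝓝 o, fderiv ℝ k (c + L x) ∘L L = T) → ∀ v w, D2 (L v) (L w) = 0 := by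
    intro L c T hc hT v w
    have ha : HasFDerivAt (fun x => c + L x) L o := L.hasFDerivAt.const_add c
    have hb : HasFDerivAt (fun x => fderiv ℝ k (c + L x)) (D2.comp L) o := by
      rw [← hc] at hD'
      exact hD'.comp o ha
    have hc' : HasFDerivAt (fun x => fderiv ℝ k (c + L x) (L w)) ((D2.comp L).flip (L w)) o :=
      ((ContinuousLinearMap.apply ℝ E (L w)).hasFDerivAt).comp o hb
    have hd' : HasFDerivAt (fun x => fderiv ℝ k (c + L x) (L w)) (0 : E →L[ℝ] E) o := by
      refine (hasFDerivAt_const (T w) o).congr_of_eventuallyEq ?_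
      filter_upwards [hT] with x hx
      rw [← hx]; rfl
    have := hc'.unique hd'
    simpa using DFunLike.congr_fun this v
  have key2 : ∀ (L : E →L[ℝ] E × E) (c : E × E) (f : E → E) (T : E →L[ℝ] E), c + L o = (o, o) →
      (∀ᶠ x in 𝓝 o, k (c + L x) = f x) → (∀ x, HasFDerivAt f T x) → ∀ v w, D2 (L v) (L w) = 0 := by
    intro L c f T hc hkf hf
    refine key L c T hc ?_
    have hcont : Tendsto (fun x => c + L x) (𝓝 o) (𝓝 (o, o)) := by
      have : ContinuousAt (fun x => c + L x) o := by fun_prop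
      rw [← hc]; exact this.tendsto
    filter_upwards [hkf.eventually_nhds, hcont.eventually hd] with x hx hx'
    have ha : HasFDerivAt (fun x => k (c + L x)) (fderiv ℝ k (c + L x) ∘L L) x :=
      hx'.hasFDerivAt.comp x (L.hasFDerivAt.const_add c)
    exact ha.unique ((hf x).congr_of_eventuallyEq hx)
  -- On both axes and on the diagonal `k` is affine, so its second derivative vanishes at `(u, 0)`,
  -- `(0, u)` and `(u, u)`. Polarization then kills the mixed term.
  have e1 := key2 (ContinuousLinearMap.inl ℝ E E) (0, o) (fun _ => o) 0 (by simp)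
    (by simpa using h1) (fun x => hasFDerivAt_const _ _) u u
  have e2 := key2 (ContinuousLinearMap.inr ℝ E E) (o, 0) id (ContinuousLinearMap.id ℝ E) (by simp)
    (by simpa using h2) (fun x => hasFDerivAt_id _) u u
  have e3 := key2 ((ContinuousLinearMap.id ℝ E).prod (ContinuousLinearMap.id ℝ E)) 0 id
    (ContinuousLinearMap.id ℝ E) (by simp)
    (by simpa using h3) (fun x => hasFDerivAt_id _) u u
  simp only [ContinuousLinearMap.inl_apply, ContinuousLinearMap.inr_apply,
    ContinuousLinearMap.prod_apply, ContinuousLinearMap.id_apply] at e1 e2 e3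
  have e4 : D2 (u, 0) (0, u) = 0 := by
    have hsplit : ((u, u) : E × E) = (u, 0) + (0, u) := by simp
    rw [hsplit] at e3
    simp only [map_add, add_apply] at e3
    rw [e1, e2, hsymm (0, u) (u, 0)] at e3
    have : (2 : ℝ) • D2 (u, 0) (0, u) = 0 := by rw [two_smul]; simpa using e3
    exact (smul_eq_zero.1 this).resolve_left (by norm_num)
  have hmix : HasFDerivAt (fun x => fderiv ℝ (fun y => k (x, y)) o)
      (((ContinuousLinearMap.compL ℝ E (E × E) E).flip (ContinuousLinearMap.inr ℝ E E)).comp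
        (D2.comp (ContinuousLinearMap.inl ℝ E E))) o := by
    have ha : HasFDerivAt (fun x : E => (x, o)) (ContinuousLinearMap.inl ℝ E E) o :=
      (hasFDerivAt_id o).prodMk (hasFDerivAt_const o o)
    have hb : HasFDerivAt (fun x => fderiv ℝ k (x, o))
        (D2.comp (ContinuousLinearMap.inl ℝ E E)) o :=
      HasFDerivAt.comp (g := fderiv ℝ k) (f := fun x : E => (x, o)) o hD' ha
    have hc := (((ContinuousLinearMap.compL ℝ E (E × E) E).flip
      (ContinuousLinearMap.inr ℝ E E)).hasFDerivAt).comp o hb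
    refine hc.congr_of_eventuallyEq ?_
    have hcont : Tendsto (fun x : E => (x, o)) (𝓝 o) (𝓝 (o, o)) := ha.continuousAt.tendsto
    filter_upwards [hcont.eventually hd] with x hx
    exact (hx.hasFDerivAt.comp o
      ((hasFDerivAt_const x o).prodMk (hasFDerivAt_id o))).fderiv
  rw [hmix.fderiv]
  simpa using e4

-- Conjugation fixes the identity, is trivial when the conjugating element is the identity, and maps
-- `x` to itself under conjugation by `x`. These three facts give `[u, u] = 0` directly from the
-- coordinate expression.
@[simp] lemma adE_self (u : E) : adE E G u u = 0 := by
  have h := mixed_fderiv_self_eq_zero (contDiffAt_conj_chart (E := E) (G := G)) ?_ ?_ ?_ u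
  · simpa only [adE, AdE_eq_fderiv] using h
  · exact Eventually.of_forall fun x => by simp
  · filter_upwards [idChart_target_mem_nhds (E := E) (G := G)] with y hy
    simp [(idChart E G).right_inv hy]
  · filter_upwards [idChart_target_mem_nhds (E := E) (G := G)] with y hy
    simp [(idChart E G).right_inv hy]

end LocalGroup

lemma tendsto_inv_mul_curve {G : Type*} [TopologicalSpace G] [Group G] [IsTopologicalGroup G]
    {γ : ℝ → G} {t : ℝ} (h : ContinuousAt γ t) :
    Tendsto (fun s => (γ t)⁻¹ * γ s) (𝓝 t) (𝓝 1) := by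
  have h : ContinuousAt (fun s => (γ t)⁻¹ * γ s) t := continuousAt_const.mul h
  simpa using! h.tendsto

/-! ### Calculus of left velocities: charts, quotients, adjoint maps -/

section Velocity

variable {E : Type*} [NormedAddCommGroup E] [NormedSpace ℝ E]
  {G : Type*} [TopologicalSpace G] [ChartedSpace E G] [Group G] [LieGroup 𝓘(ℝ, E) ∞ G]

variable (E) in
/-- The differential at the identity of the left translation by `g`, in the chart at the
identity. -/
def leftJac (g : G) : E →L[ℝ] E :=
  fderiv ℝ (fun y => idChart E G (g * (idChart E G).symm y)) (idPt E G)

lemma hasFDerivAt_leftJac {g : G} (hg : g ∈ (idChart E G).source) :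
    HasFDerivAt (fun y => idChart E G (g * (idChart E G).symm y)) (leftJac E g) (idPt E G) :=
  ((contDiffAt_mul_left_chart idPt_mem_target (by simpa using hg)).differentiableAt
    (by simp)).hasFDerivAt

@[simp] lemma leftJac_one : leftJac E (1 : G) = ContinuousLinearMap.id ℝ E := by
  refine (hasFDerivAt_leftJac (E := E) (one_mem_idChart (G := G))).unique ?_
  refine (hasFDerivAt_id (idPt E G)).congr_of_eventuallyEq ?_
  filter_upwards [idChart_target_mem_nhds (E := E) (G := G)] with y hy
  simp [(idChart E G).right_inv hy]

lemma contDiffAt_leftJac :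
    ContDiffAt ℝ ∞ (fun x => leftJac E ((idChart E G).symm x)) (idPt E G) :=
  ContDiffAt.fderiv (f := fun x y => idChart E G ((idChart E G).symm x *
    (idChart E G).symm y)) (g := fun _ => idPt E G)
    (contDiffAt_mul_chart (E := E) (G := G)) contDiffAt_const le_rfl

lemma HasLeftVelocityAt.continuousAt' {γ : ℝ → G} {Z : E} {t : ℝ}
    (h : HasLeftVelocityAt (E := E) γ Z t) : ContinuousAt γ t :=
  (hasLeftVelocityAt_iff.1 h).1

lemma HasLeftVelocityAt.hasDerivAt_idChart {γ : ℝ → G} {Z : E} {t : ℝ}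
    (h : HasLeftVelocityAt (E := E) γ Z t) (ht : γ t ∈ (idChart E G).source) :
    HasDerivAt (fun s => idChart E G (γ s)) (leftJac E (γ t) Z) t := by
  have := topologicalGroup_of_lieGroup 𝓘(ℝ, E) ∞ (G := G)
  obtain ⟨hc, hd⟩ := hasLeftVelocityAt_iff.1 h
  have h1 : HasFDerivAt (fun y => idChart E G (γ t * (idChart E G).symm y)) (leftJac E (γ t))
      (idChart E G ((γ t)⁻¹ * γ t)) := by
    simpa using! hasFDerivAt_leftJac ht
  refine (h1.comp_hasDerivAt t hd).congr_of_eventuallyEq ?_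
  filter_upwards [(tendsto_inv_mul_curve hc).eventually
    (idChart_source_mem_nhds (E := E))] with s hs
  simp [(idChart E G).left_inv hs]

/-- Translation by `g⁻¹` undoes translation by `g`. The left inverse recovers the left velocity of a
curve from the derivative of its coordinates. -/
lemma exists_leftInverse_leftJac {g : G} (hg : g ∈ (idChart E G).source) :
    ∃ L : E →L[ℝ] E, L.comp (leftJac E g) = ContinuousLinearMap.id ℝ E ∧
      HasFDerivAt (fun y => idChart E G (g⁻¹ * (idChart E G).symm y)) L (idChart E G g) := by
  have h1 : g⁻¹ * (idChart E G).symm (idChart E G g) = 1 := by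
    rw [(idChart E G).left_inv hg]; simp
  have h2 := ((contDiffAt_mul_left_chart (g := g⁻¹) ((idChart E G).map_source hg)
    (by rw [h1]; exact one_mem_idChart)).differentiableAt (by simp)).hasFDerivAt
  refine ⟨_, ?_, h2⟩
  have h3 : HasFDerivAt (fun y => idChart E G (g⁻¹ * (idChart E G).symm y))
    (fderiv ℝ (fun y => idChart E G (g⁻¹ * (idChart E G).symm y)) (idChart E G g))
    (idChart E G (g * (idChart E G).symm (idPt E G))) := by simpa using! h2
  have h4 := h3.comp (idPt E G) (hasFDerivAt_leftJac hg)
  refine h4.unique ((hasFDerivAt_id (idPt E G)).congr_of_eventuallyEq ?_)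
  have := topologicalGroup_of_lieGroup 𝓘(ℝ, E) ∞ (G := G)
  have h5 : ContinuousAt (fun y => g * (idChart E G).symm y) (idPt E G) :=
    continuousAt_const.mul continuousAt_idChart_symm
  have h6 : (idChart E G).source ∈ 𝓝 (g * (idChart E G).symm (idPt E G)) := by
    simpa using (idChart E G).open_source.mem_nhds hg
  filter_upwards [idChart_target_mem_nhds (E := E) (G := G), h5.eventually h6] with y hy hy'
  simp only [Function.comp_apply, id]
  rw [(idChart E G).left_inv hy', inv_mul_cancel_left, (idChart E G).right_inv hy]

lemma hasLeftVelocityAt_of_hasDerivAt_idChart {γ : ℝ → G} {Z : E} {t : ℝ}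
    (hc : ContinuousAt γ t) (ht : γ t ∈ (idChart E G).source)
    (h : HasDerivAt (fun s => idChart E G (γ s)) (leftJac E (γ t) Z) t) :
    HasLeftVelocityAt (E := E) γ Z t := by
  refine hasLeftVelocityAt_iff.2 ⟨hc, ?_⟩
  obtain ⟨L, hL, hd⟩ := exists_leftInverse_leftJac ht
  have h1 := hd.comp_hasDerivAt t h
  have h2 : L (leftJac E (γ t) Z) = Z := DFunLike.congr_fun hL Z
  rw [h2] at h1
  refine h1.congr_of_eventuallyEq ?_
  filter_upwards [hc.eventually ((idChart E G).open_source.mem_nhds ht)] with s hs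
  simp [(idChart E G).left_inv hs]

lemma HasLeftVelocityAt.comp {γ : ℝ → G} {Z : E} {τ : ℝ → ℝ} {τ' s : ℝ}
    (h : HasLeftVelocityAt (E := E) γ Z (τ s)) (hτ : HasDerivAt τ τ' s) :
    HasLeftVelocityAt (E := E) (fun s => γ (τ s)) (τ' • Z) s := by
  obtain ⟨hc, hd⟩ := hasLeftVelocityAt_iff.1 h
  exact hasLeftVelocityAt_iff.2 ⟨hc.comp hτ.continuousAt, HasDerivAt.scomp s hd hτ⟩

/-- A linear map on `E × E` is determined by its restrictions to the first axis, where the quotient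
is the identity map, and to the diagonal, where it is constant. -/
lemma hasFDerivAt_div_chart :
    HasFDerivAt
      (fun p : E × E => idChart E G ((idChart E G).symm p.1 * ((idChart E G).symm p.2)⁻¹))
      (ContinuousLinearMap.fst ℝ E E - ContinuousLinearMap.snd ℝ E E) (idPt E G, idPt E G) := by
  have h := (contDiffAt_div_chart (E := E) (G := G)).differentiableAt (by simp) |>.hasFDerivAt
  set D := fderiv ℝ (fun p : E × E => idChart E G ((idChart E G).symm p.1 *
    ((idChart E G).symm p.2)⁻¹)) (idPt E G, idPt E G)
  have h1 : D.comp (ContinuousLinearMap.inl ℝ E E) = ContinuousLinearMap.id ℝ E := by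
    have h2 := HasFDerivAt.comp (idPt E G) (f := fun x : E => (x, idPt E G)) h
      ((hasFDerivAt_id (idPt E G)).prodMk (hasFDerivAt_const _ _))
    refine h2.unique ((hasFDerivAt_id (idPt E G)).congr_of_eventuallyEq ?_)
    filter_upwards [idChart_target_mem_nhds (E := E) (G := G)] with y hy
    simp [(idChart E G).right_inv hy]
  have h3 : D.comp ((ContinuousLinearMap.id ℝ E).prod (ContinuousLinearMap.id ℝ E)) = 0 := by
    have h2 := HasFDerivAt.comp (idPt E G) (f := fun x : E => (x, x)) h
      ((hasFDerivAt_id (idPt E G)).prodMk (hasFDerivAt_id _))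
    refine h2.unique ((hasFDerivAt_const (idPt E G) (idPt E G)).congr_of_eventuallyEq ?_)
    exact Eventually.of_forall fun x => by simp
  have h4 : D = ContinuousLinearMap.fst ℝ E E - ContinuousLinearMap.snd ℝ E E := by
    ext v
    · simpa using DFunLike.congr_fun h1 v
    · have h5 := DFunLike.congr_fun h3 v
      have h6 := DFunLike.congr_fun h1 v
      simp only [ContinuousLinearMap.comp_apply, ContinuousLinearMap.prod_apply,
        ContinuousLinearMap.id_apply, zero_apply,
        ContinuousLinearMap.inl_apply] at h5 h6
      have h7 : ((v, v) : E × E) = (v, 0) + (0, v) := by simp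
      rw [h7, map_add, h6] at h5
      simpa using (neg_eq_of_add_eq_zero_right h5).symm
  rw [← h4]; exact h

/-- The velocity of a quotient of two curves. -/
lemma HasLeftVelocityAt.mul_inv {α β : ℝ → G} {a b : E} {t : ℝ}
    (hα : HasLeftVelocityAt (E := E) α a t) (hβ : HasLeftVelocityAt (E := E) β b t) :
    HasLeftVelocityAt (E := E) (fun s => α s * (β s)⁻¹) (AdE E (β t) (a - b)) t := by
  have := topologicalGroup_of_lieGroup 𝓘(ℝ, E) ∞ (G := G)
  obtain ⟨hαc, hαd⟩ := hasLeftVelocityAt_iff.1 hα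
  obtain ⟨hβc, hβd⟩ := hasLeftVelocityAt_iff.1 hβ
  refine hasLeftVelocityAt_iff.2 ⟨hαc.mul hβc.inv, ?_⟩
  -- The computation rests on `(α_t β_t⁻¹)⁻¹ (α_s β_s⁻¹) = β_t (α_t⁻¹ α_s) (β_t⁻¹ β_s)⁻¹ β_t⁻¹`: a
  -- quotient of increments, conjugated by `β_t`.
  have h1 : HasFDerivAt
      (fun p : E × E => idChart E G ((idChart E G).symm p.1 * ((idChart E G).symm p.2)⁻¹))
      (ContinuousLinearMap.fst ℝ E E - ContinuousLinearMap.snd ℝ E E)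
      (idChart E G ((α t)⁻¹ * α t), idChart E G ((β t)⁻¹ * β t)) := by
    simpa using! hasFDerivAt_div_chart (E := E) (G := G)
  have h2 := HasFDerivAt.comp_hasDerivAt
    (f := fun s => (idChart E G ((α t)⁻¹ * α s), idChart E G ((β t)⁻¹ * β s))) t h1
    (hαd.prodMk hβd)
  have h3 : HasFDerivAt (fun y => idChart E G (β t * (idChart E G).symm y * (β t)⁻¹))
      (AdE E (β t)) (idChart E G ((idChart E G).symm (idChart E G ((α t)⁻¹ * α t)) *
        ((idChart E G).symm (idChart E G ((β t)⁻¹ * β t)))⁻¹)) := by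
    simpa using! hasFDerivAt_conj (E := E) (β t)
  have h4 := h3.comp_hasDerivAt t h2
  refine h4.congr_of_eventuallyEq ?_
  have h5 : Tendsto (fun s => ((α t)⁻¹ * α s) * ((β t)⁻¹ * β s)⁻¹) (𝓝 t) (𝓝 1) := by
    simpa using (tendsto_inv_mul_curve hαc).mul (tendsto_inv_mul_curve hβc).inv
  filter_upwards [(tendsto_inv_mul_curve hαc).eventually
    (idChart_source_mem_nhds (E := E)), (tendsto_inv_mul_curve hβc).eventually
    (idChart_source_mem_nhds (E := E)), h5.eventually (idChart_source_mem_nhds (E := E))]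
    with s hs1 hs2 hs3
  simp only [Function.comp_apply]
  rw [(idChart E G).left_inv hs1, (idChart E G).left_inv hs2, (idChart E G).left_inv hs3]
  congr 1
  group

/-- The derivative of the adjoint representation along a curve. -/
lemma HasLeftVelocityAt.hasDerivAt_AdE {γ : ℝ → G} {Z : E} {t : ℝ}
    (h : HasLeftVelocityAt (E := E) γ Z t) :
    HasDerivAt (fun s => AdE E (γ s)) ((AdE E (γ t)).comp (adE E G Z)) t := by
  have := topologicalGroup_of_lieGroup 𝓘(ℝ, E) ∞ (G := G)
  obtain ⟨hc, hd⟩ := hasLeftVelocityAt_iff.1 h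
  have h1 : HasFDerivAt (fun x => AdE E ((idChart E G).symm x)) (adE E G)
      (idChart E G ((γ t)⁻¹ * γ t)) := by
    simpa using! hasFDerivAt_AdE (E := E) (G := G)
  have h2 := h1.comp_hasDerivAt t hd
  have h3 := (ContinuousLinearMap.compL ℝ E E E (AdE E (γ t))).hasFDerivAt.comp_hasDerivAt t h2
  refine h3.congr_of_eventuallyEq ?_
  filter_upwards [(tendsto_inv_mul_curve hc).eventually
    (idChart_source_mem_nhds (E := E))] with s hs
  simp only [Function.comp_apply, ContinuousLinearMap.compL_apply]
  rw [(idChart E G).left_inv hs, ← AdE_mul, mul_inv_cancel_left]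

end Velocity

/-! ### Subgradients of strongly convex energies, and a norm with a corner -/

section ConvexNorm

variable {W : Type*} [AddCommGroup W] [Module ℝ W]

lemma energy_nonneg (p : Seminorm ℝ W) (v : W) : 0 ≤ energy p v := by
  unfold energy; positivity

@[simp] lemma energy_zero (p : Seminorm ℝ W) : energy p 0 = 0 := by simp [energy]

/-- The quadratic mean of two seminorms. -/
def quadMean (N q : Seminorm ℝ W) : Seminorm ℝ W :=
  Seminorm.of (fun v => √((N v ^ 2 + q v ^ 2) / 2))
    (by
      intro x y
      have hN := map_add_le_add N x y
      have hq := map_add_le_add q x y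
      have h1 := Real.sq_sqrt (show 0 ≤ (N x ^ 2 + q x ^ 2) / 2 by positivity)
      have h2 := Real.sq_sqrt (show 0 ≤ (N y ^ 2 + q y ^ 2) / 2 by positivity)
      have h3 := Real.sqrt_nonneg ((N x ^ 2 + q x ^ 2) / 2)
      have h4 := Real.sqrt_nonneg ((N y ^ 2 + q y ^ 2) / 2)
      set a := √((N x ^ 2 + q x ^ 2) / 2)
      set b := √((N y ^ 2 + q y ^ 2) / 2)
      refine Real.sqrt_le_iff.2 ⟨by positivity, ?_⟩
      have h5 : N (x + y) ^ 2 ≤ (N x + N y) ^ 2 :=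
        pow_le_pow_left₀ (apply_nonneg _ _) hN 2
      have h6 : q (x + y) ^ 2 ≤ (q x + q y) ^ 2 :=
        pow_le_pow_left₀ (apply_nonneg _ _) hq 2
      -- Cauchy–Schwarz in the plane for `(N x, q x)` and `(N y, q y)`.
      have h7 : N x * N y + q x * q y ≤ 2 * (a * b) := by
        refine abs_le_of_sq_le_sq' ?_ (by positivity) |>.2
        have : (2 * (a * b)) ^ 2 = (N x ^ 2 + q x ^ 2) * (N y ^ 2 + q y ^ 2) := by
          calc (2 * (a * b)) ^ 2 = 4 * (a ^ 2 * b ^ 2) := by ring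
            _ = _ := by rw [h1, h2]; ring
        rw [this]
        nlinarith [sq_nonneg (N x * q y - N y * q x)]
      nlinarith)
    (by
      intro r x
      rw [map_smul_eq_mul, map_smul_eq_mul, ← Real.sqrt_sq (norm_nonneg r),
        ← Real.sqrt_mul (sq_nonneg _)]
      congr 1
      rw [Real.sqrt_sq (norm_nonneg r)]
      ring)

lemma quadMean_sq (N q : Seminorm ℝ W) (v : W) :
    quadMean N q v ^ 2 = (N v ^ 2 + q v ^ 2) / 2 :=
  Real.sq_sqrt (by positivity)

lemma energy_quadMean (N q : Seminorm ℝ W) (v : W) :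
    energy (quadMean N q) v = (N v ^ 2 + q v ^ 2) / 4 := by
  rw [energy, quadMean_sq]; ring

/-- The quadratic improvement of the subgradient inequality for strongly convex functions. -/
lemma subgradient_add_le {f : W → ℝ} {B : W → ℝ}
    (hf : ∀ u v : W, ∀ t ∈ Icc (0 : ℝ) 1,
      f (t • v + (1 - t) • u) ≤ t * f v + (1 - t) * f u - t * (1 - t) * B (u - v))
    {u v : W} {η : Module.Dual ℝ W} (hη : η ∈ subdifferential f u) :
    f u + η (v - u) + B (u - v) ≤ f v := by
  -- Combine strong convexity on the chord with the subgradient inequality at its point of parameter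
  -- `t`, and divide by `t`. The claim is the limit `t → 0⁺`.
  have h : ∀ t ∈ Ioo (0 : ℝ) 1, f u + η (v - u) + (1 - t) * B (u - v) ≤ f v := by
    intro t ht
    have h1 := hf u v t ⟨ht.1.le, ht.2.le⟩
    have h2 := hη (t • v + (1 - t) • u)
    have h3 : t • v + (1 - t) • u - u = t • (v - u) := by
      rw [sub_smul, one_smul, smul_sub]; abel
    rw [h3, map_smul, smul_eq_mul] at h2
    have h4 : t * (f u + η (v - u) + (1 - t) * B (u - v)) ≤ t * f v := by linarith
    exact le_of_mul_le_mul_left h4 ht.1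
  have h5 : Tendsto (fun t : ℝ => f u + η (v - u) + (1 - t) * B (u - v)) (𝓝[>] 0)
      (𝓝 (f u + η (v - u) + (1 - 0) * B (u - v))) := by
    refine Tendsto.mono_left (Continuous.tendsto ?_ 0) nhdsWithin_le_nhds
    fun_prop
  have h6 := le_of_tendsto h5 (eventually_of_mem (Ioo_mem_nhdsGT one_pos) h)
  linarith

variable {E : Type*} [NormedAddCommGroup E] [NormedSpace ℝ E]

lemma continuous_seminorm_comp {F : Type*} [NormedAddCommGroup F] [NormedSpace ℝ F]
    [FiniteDimensional ℝ F] (p : Seminorm ℝ F) : Continuous p := by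
  have h := p.convexOn.continuousOn isOpen_univ
  exact continuousOn_univ.1 h

/-- Subdifferentials of coercive energies cover the dual space. -/
theorem exists_mem_subdifferential [FiniteDimensional ℝ E] {ι : W →ₗ[ℝ] E} (hι : Function.Injective ι)
    {p : Seminorm ℝ W} {c : ℝ} (hc : 0 < c) (hp : ∀ v, c * ‖ι v‖ ^ 2 ≤ energy p v)
    (η : Module.Dual ℝ W) : ∃ u, η ∈ subdifferential (energy p) u := by
  -- `W` carries no topology, so `E - η` is minimized on the range of `ι`, a finite-dimensional
  -- subspace of `E`. A minimizer is exactly a point at which `η` is a subgradient.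
  let j := LinearEquiv.ofInjective ι hι
  let S := LinearMap.range ι
  let η' : S →L[ℝ] ℝ := (η ∘ₗ j.symm.toLinearMap).toContinuousLinearMap
  let p' : Seminorm ℝ S := p.comp j.symm.toLinearMap
  have hp' : Continuous p' := continuous_seminorm_comp p'
  have hcont : Continuous fun s : S => p' s ^ 2 / 2 - η' s := by fun_prop
  have hlow : ∀ s : S, c * ‖s‖ ^ 2 - ‖η'‖ * ‖s‖ ≤ p' s ^ 2 / 2 - η' s := by
    intro s
    have h1 := hp (j.symm s)
    have h2 : ι (j.symm s) = s := congrArg Subtype.val (j.apply_symm_apply s)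
    rw [h2] at h1
    have h3 := (le_abs_self _).trans (η'.le_opNorm s)
    have h4 : p' s ^ 2 / 2 = energy p (j.symm s) := rfl
    rw [h4]
    have h5 : ‖(s : E)‖ = ‖s‖ := rfl
    rw [h5] at h1
    linarith
  have hcoer : Tendsto (fun s : S => p' s ^ 2 / 2 - η' s) (cocompact S) atTop := by
    refine tendsto_atTop_mono hlow ?_
    have h1 : Tendsto (fun r : ℝ => c * r ^ 2 - ‖η'‖ * r) atTop atTop := by
      have : (fun r : ℝ => c * r ^ 2 - ‖η'‖ * r) = fun r => r * (c * r - ‖η'‖) := by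
        ext r; ring
      rw [this]
      refine tendsto_id.atTop_mul_atTop₀ ?_
      exact tendsto_atTop_add_const_right _ _ (tendsto_id.const_mul_atTop hc)
    exact h1.comp (tendsto_norm_cocompact_atTop (E := S))
  obtain ⟨s, hs⟩ := hcont.exists_forall_le hcoer
  refine ⟨j.symm s, fun v => ?_⟩
  have h1 := hs (j v)
  have h2 : p' (j v) = p v := congrArg p (j.symm_apply_apply v)
  have h3 : η' (j v) = η v := congrArg η (j.symm_apply_apply v)
  have h4 : p' s ^ 2 / 2 = energy p (j.symm s) := rfl
  have h5 : η' s = η (j.symm s) := rfl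
  rw [h2, h3, h4, h5] at h1
  rw [map_sub]
  change energy p (j.symm s) - _ ≤ energy p v - _ at h1
  linarith

/-- The quadratic mean of a seminorm with a Euclidean norm has strongly convex energy. -/
lemma energy_quadMean_convex {H : Type*} [NormedAddCommGroup H] [InnerProductSpace ℝ H]
    (N : Seminorm ℝ W) (Λ : W →ₗ[ℝ] H) (u v : W) {t : ℝ} (ht : t ∈ Icc (0 : ℝ) 1) :
    energy (quadMean N ((normSeminorm ℝ H).comp Λ)) (t • v + (1 - t) • u) ≤
      t * energy (quadMean N ((normSeminorm ℝ H).comp Λ)) v +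
        (1 - t) * energy (quadMean N ((normSeminorm ℝ H).comp Λ)) u -
          t * (1 - t) * (‖Λ (u - v)‖ ^ 2 / 4) := by
  have hq : ∀ v, (normSeminorm ℝ H).comp Λ v = ‖Λ v‖ := fun v => rfl
  have ht' : 0 ≤ 1 - t := by linarith [ht.2]
  rw [energy_quadMean, energy_quadMean, energy_quadMean]
  have h1 : N (t • v + (1 - t) • u) ≤ t * N v + (1 - t) * N u := by
    refine (map_add_le_add N _ _).trans ?_
    rw [map_smul_eq_mul, map_smul_eq_mul, Real.norm_of_nonneg ht.1, Real.norm_of_nonneg ht']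
  have h2 : N (t • v + (1 - t) • u) ^ 2 ≤ t * N v ^ 2 + (1 - t) * N u ^ 2 := by
    refine (pow_le_pow_left₀ (apply_nonneg _ _) h1 2).trans ?_
    nlinarith [mul_nonneg (mul_nonneg ht.1 ht') (sq_nonneg (N v - N u))]
  have h3 : ‖Λ (t • v + (1 - t) • u)‖ ^ 2 =
      t * ‖Λ v‖ ^ 2 + (1 - t) * ‖Λ u‖ ^ 2 - t * (1 - t) * ‖Λ (u - v)‖ ^ 2 := by
    simp only [map_add, map_smul, map_sub]
    rw [norm_add_sq_real, norm_sub_sq_real, norm_smul, norm_smul, inner_smul_left,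
      inner_smul_right, Real.norm_of_nonneg ht.1, Real.norm_of_nonneg ht', real_inner_comm]
    simp
    ring
  rw [hq, hq, hq, h3]
  linarith

lemma isStronglyConvex_quadMean {H : Type*} [NormedAddCommGroup H] [InnerProductSpace ℝ H]
    (N : Seminorm ℝ W) {Λ : W →ₗ[ℝ] H} (hΛ : Function.Injective Λ) :
    IsStronglyConvex (energy (quadMean N ((normSeminorm ℝ H).comp Λ))) := by
  refine ⟨(1 / 4 : ℝ) • ((innerₗ H).compl₁₂ Λ Λ), ?_, ?_, ?_⟩
  · intro u v; simp [real_inner_comm]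
  · intro v hv
    have : Λ v ≠ 0 := fun h => hv (hΛ (by rw [h, map_zero]))
    have h2 : 0 < ‖Λ v‖ ^ 2 := by positivity
    simpa using h2
  · intro u v t ht
    refine (energy_quadMean_convex N Λ u v ht).trans (le_of_eq ?_)
    simp only [LinearMap.smul_apply, LinearMap.compl₁₂_apply, innerₗ_apply_apply,
      real_inner_self_eq_norm_sq, smul_eq_mul]
    ring

/-- The norm is the quadratic mean of `N = |α| + |β| + ‖ι P‖`, where `P` is the projection onto `ker
α ∩ ker β`, and the Euclidean norm `q = ‖Λ ·‖`. The first creates the corner, the second strong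
convexity. At `Y + ε Z` the energy is `((1 + |ε|)² + 1 + ε²) / 4`, with one-sided slopes `±1/2` at
`ε = 0`, which is the origin of the bound 1/2 on `η Z`. -/
theorem exists_norm_with_corner_of_quadratic {H F : Type*} [NormedAddCommGroup H]
    [InnerProductSpace ℝ H] [NormedAddCommGroup F] {ι : W →ₗ[ℝ] E} (hι : Function.Injective ι)
    {α β : Module.Dual ℝ W} {Y Z : W} (hαY : α Y = 1) (hαZ : α Z = 0) (hβY : β Y = 0)
    (hβZ : β Z = 1) {T : E → F} (hT0 : T 0 = 0) {C : ℝ} (hT : ∀ x, ‖x‖ ≤ C * ‖T x‖)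
    {Λ : W →ₗ[ℝ] H}
    (hΛ : ∀ v, ‖Λ v‖ ^ 2 = α v ^ 2 + β v ^ 2 + ‖T (ι (v - α v • Y - β v • Z))‖ ^ 2) :
    ∃ p : Seminorm ℝ W, IsNorm p ∧ IsStronglyConvex (energy p) ∧
      (∃ c > 0, ∀ u v : W, ∀ η ∈ subdifferential (energy p) u,
        energy p u + η (v - u) + c * ‖ι (v - u)‖ ^ 2 ≤ energy p v) ∧
      p Y = 1 ∧
      (∀ η : Module.Dual ℝ W, η Y = 1 → |η Z| ≤ 1 / 2 →
        (∀ w, α w = 0 → β w = 0 → |η w| ≤ 1 / 2 * ‖ι w‖) → η ∈ subdifferential (energy p) Y) ∧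
      (∀ η ∈ subdifferential (energy p) Y, η Z ≤ 1 / 2) := by
  let P : W →ₗ[ℝ] W := LinearMap.id - α.smulRight Y - β.smulRight Z
  have hP : ∀ v, P v = v - α v • Y - β v • Z := fun v => by simp [P]
  have hαP : ∀ v, α (P v) = 0 := fun v => by simp [hP, hαY, hαZ]
  have hβP : ∀ v, β (P v) = 0 := fun v => by simp [hP, hβY, hβZ]
  have hPY : P Y = 0 := by simp [hP, hαY, hβY]
  have hPZ : P Z = 0 := by simp [hP, hαZ, hβZ]
  let N : Seminorm ℝ W := (normSeminorm ℝ ℝ).comp α + (normSeminorm ℝ ℝ).comp β +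
    (normSeminorm ℝ E).comp (ι ∘ₗ P)
  have hN : ∀ v, N v = |α v| + |β v| + ‖ι (P v)‖ := fun v => rfl
  let q : Seminorm ℝ W := (normSeminorm ℝ _).comp Λ
  have hq : ∀ v, q v = ‖Λ v‖ := fun v => rfl
  have hqs : ∀ v, q v ^ 2 = α v ^ 2 + β v ^ 2 + ‖T (ι (P v))‖ ^ 2 := by
    intro v; rw [hq, hΛ, hP]
  have hE : ∀ v, energy (quadMean N q) v =
      ((|α v| + |β v| + ‖ι (P v)‖) ^ 2 + (α v ^ 2 + β v ^ 2 + ‖T (ι (P v))‖ ^ 2)) / 4 := by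
    intro v; rw [energy_quadMean, hN, hqs]
  have hdec : ∀ v, v = α v • Y + β v • Z + P v := fun v => by rw [hP]; abel
  -- The modulus of convexity is `q² / 4`. This comparison turns it into a multiple of the square of
  -- the ambient norm, and also shows that `q` is definite.
  obtain ⟨K, hK0, hK⟩ : ∃ K > 0, ∀ v, ‖ι v‖ ^ 2 ≤ K * q v ^ 2 := by
    refine ⟨3 * (‖ι Y‖ ^ 2 + ‖ι Z‖ ^ 2 + |C| ^ 2 + 1), by positivity,
      fun v => ?_⟩
    have h1 : ‖ι v‖ ≤ |α v| * ‖ι Y‖ + |β v| * ‖ι Z‖ + ‖ι (P v)‖ := by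
      conv_lhs => rw [hdec v]
      simp only [map_add, map_smul]
      refine (norm_add₃_le).trans ?_
      simp [norm_smul]
    have h2 : ‖ι (P v)‖ ≤ |C| * ‖T (ι (P v))‖ := by
      exact (hT _).trans (mul_le_mul_of_nonneg_right (le_abs_self C) (norm_nonneg _))
    have h3 := pow_le_pow_left₀ (norm_nonneg _) (h1.trans (add_le_add_right h2 _)) 2
    refine h3.trans ?_
    rw [hqs]
    set a := |α v|
    set b := |β v|
    have ha : α v ^ 2 = a ^ 2 := (sq_abs _).symm
    have hb : β v ^ 2 = b ^ 2 := (sq_abs _).symm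
    rw [ha, hb]
    set x := ‖ι Y‖
    set y := ‖ι Z‖
    set z := |C|
    set w := ‖T (ι (P v))‖
    have e1 : (a * x + b * y + z * w) ^ 2 ≤
        3 * ((a * x) ^ 2 + (b * y) ^ 2 + (z * w) ^ 2) := by
      nlinarith [sq_nonneg (a * x - b * y), sq_nonneg (a * x - z * w), sq_nonneg (b * y - z * w)]
    refine e1.trans ?_
    have e2 : 0 ≤ (a * y) ^ 2 + (a * z) ^ 2 + a ^ 2 + (b * x) ^ 2 + (b * z) ^ 2 + b ^ 2
        + (w * x) ^ 2 + (w * y) ^ 2 + w ^ 2 := by positivity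
    nlinarith
  have hq0 : ∀ v, q v = 0 → v = 0 := by
    intro v hv
    have h1 := hK v
    rw [hv] at h1
    have h2 : ‖ι v‖ = 0 := by
      have : ‖ι v‖ ^ 2 = 0 := le_antisymm (by simpa using h1) (sq_nonneg _)
      exact pow_eq_zero_iff (two_ne_zero) |>.1 this
    exact hι (by simpa using h2)
  refine ⟨quadMean N q, ?_, ?_, ?_, ?_, ?_, ?_⟩
  · intro v hv
    refine hq0 v ?_
    have h1 := quadMean_sq N q v
    rw [hv] at h1
    have h2 : q v ^ 2 = 0 := by nlinarith [sq_nonneg (N v), sq_nonneg (q v)]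
    exact pow_eq_zero_iff (two_ne_zero) |>.1 h2
  · refine isStronglyConvex_quadMean N fun x y hxy => ?_
    refine sub_eq_zero.1 (hq0 _ ?_)
    rw [hq, map_sub, hxy, sub_self, norm_zero]
  · refine ⟨1 / (4 * K), by positivity, fun u v η hη => ?_⟩
    have h1 := subgradient_add_le (B := fun w => q w ^ 2 / 4)
      (fun u v t ht => energy_quadMean_convex N Λ u v ht) (v := v) hη
    have h2 := hK (v - u)
    have h3 : q (u - v) = q (v - u) := map_sub_rev q u v
    rw [h3] at h1
    have h4 : 1 / (4 * K) * ‖ι (v - u)‖ ^ 2 ≤ q (v - u) ^ 2 / 4 := by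
      rw [div_mul_eq_mul_div, one_mul, div_le_div_iff₀ (by positivity) (by norm_num)]
      nlinarith
    linarith
  · have h1 := quadMean_sq N q Y
    rw [hN, hqs, hαY, hβY, hPY, map_zero, hT0] at h1
    norm_num at h1
    rcases h1 with h1 | h1
    · exact h1
    · have := apply_nonneg (quadMean N q) Y
      linarith
  · intro η hY hZ hW v
    have h0 : energy (quadMean N q) Y = 1 / 2 := by
      rw [hE, hαY, hβY, hPY, map_zero, hT0]; norm_num
    rw [h0, hE v, map_sub, hY]
    have h1 : η v = α v + β v * η Z + η (P v) := by
      conv_lhs => rw [hdec v]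
      simp [hY]
    have h2 := hW (P v) (hαP v) (hβP v)
    have h3 : β v * η Z ≤ |β v| * (1 / 2) := by
      refine (le_abs_self _).trans ?_
      rw [abs_mul]
      exact mul_le_mul_of_nonneg_left hZ (abs_nonneg _)
    have h4 := (le_abs_self _).trans h2
    have h5 := le_abs_self (α v)
    rw [h1]
    -- With `s = |α v| + |β v| + ‖ι (P v)‖`, the tangent-line bounds `s² ≥ 2 s - 1` and `α² ≥ 2 α -
    -- 1` suffice, together with `|α| ≥ α`.
    nlinarith [sq_nonneg (|α v| + |β v| + ‖ι (P v)‖ - 1), sq_nonneg (α v - 1), sq_nonneg (β v),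
      sq_nonneg ‖T (ι (P v))‖]
  · intro η hη
    refine le_of_forall_pos_le_add fun ε hε => ?_
    have h1 := hη (Y + ε • Z)
    rw [hE, hE] at h1
    simp only [map_add, map_smul, hαY, hβY, hPY, hαZ, hβZ, hPZ, add_sub_cancel_left, smul_eq_mul,
      map_zero, norm_zero, mul_zero, mul_one, add_zero, zero_add, smul_zero, abs_one, abs_zero] at h1
    rw [abs_of_pos hε, hT0, norm_zero] at h1
    have h2 : ε * η Z ≤ ε * (1 / 2 + ε) := by nlinarith
    exact le_of_mul_le_mul_left h2 hε

/-- A strongly convex norm with a corner at `Y`. -/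
theorem exists_norm_with_corner [FiniteDimensional ℝ E] {ι : W →ₗ[ℝ] E}
    (hι : Function.Injective ι)
    {α β : Module.Dual ℝ W} {Y Z : W} (hαY : α Y = 1) (hαZ : α Z = 0) (hβY : β Y = 0)
    (hβZ : β Z = 1) :
    ∃ p : Seminorm ℝ W, IsNorm p ∧ IsStronglyConvex (energy p) ∧
      (∃ c > 0, ∀ u v : W, ∀ η ∈ subdifferential (energy p) u,
        energy p u + η (v - u) + c * ‖ι (v - u)‖ ^ 2 ≤ energy p v) ∧
      p Y = 1 ∧
      (∀ η : Module.Dual ℝ W, η Y = 1 → |η Z| ≤ 1 / 2 →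
        (∀ w, α w = 0 → β w = 0 → |η w| ≤ 1 / 2 * ‖ι w‖) → η ∈ subdifferential (energy p) Y) ∧
      (∀ η ∈ subdifferential (energy p) Y, η Z ≤ 1 / 2) := by
  -- The norm of `E` need not come from an inner product, so the quadratic part uses an equivalent
  -- Euclidean norm.
  let T := toEuclidean (E := E)
  let Λ : W →ₗ[ℝ] WithLp 2 (ℝ × WithLp 2 (ℝ × EuclideanSpace ℝ (Fin (Module.finrank ℝ E)))) :=
    (WithLp.linearEquiv 2 ℝ _).symm.toLinearMap ∘ₗ α.prod
      ((WithLp.linearEquiv 2 ℝ _).symm.toLinearMap ∘ₗ β.prod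
        (T.toLinearMap ∘ₗ ι ∘ₗ (LinearMap.id - α.smulRight Y - β.smulRight Z)))
  refine exists_norm_with_corner_of_quadratic hι hαY hαZ hβY hβZ (T := T) (map_zero T)
    (C := ‖T.symm.toContinuousLinearMap‖) (fun x => ?_) (Λ := Λ) (fun v => ?_)
  · simpa using T.symm.toContinuousLinearMap.le_opNorm (T x)
  · rw [WithLp.prod_norm_sq_eq_of_L2, WithLp.prod_norm_sq_eq_of_L2]
    simp [Λ]
    ring

end ConvexNorm

/-! ### Absolutely continuous curves and length estimates -/

section AbsolutelyContinuous

variable {a b : ℝ}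

lemma _root_.AbsolutelyContinuousOnInterval.lipschitzOnWith_comp {X Y : Type*} [PseudoMetricSpace X]
    [PseudoMetricSpace Y] {f : ℝ → X} {g : X → Y} {s : Set X} {K : NNReal}
    (hf : AbsolutelyContinuousOnInterval f a b) (hg : LipschitzOnWith K g s)
    (hs : MapsTo f (uIcc a b) s) : AbsolutelyContinuousOnInterval (fun t => g (f t)) a b := by
  rw [absolutelyContinuousOnInterval_iff] at hf ⊢
  intro ε hε
  obtain ⟨δ, hδ, h⟩ := hf (ε / (K + 1)) (by positivity)
  refine ⟨δ, hδ, fun I hI hlt => ?_⟩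
  have h1 := h I hI hlt
  have h2 : ∑ i ∈ Finset.range I.1, dist (g (f (I.2 i).1)) (g (f (I.2 i).2)) ≤
      K * ∑ i ∈ Finset.range I.1, dist (f (I.2 i).1) (f (I.2 i).2) := by
    rw [Finset.mul_sum]
    refine Finset.sum_le_sum fun i hi => ?_
    exact hg.dist_le_mul _ (hs (hI.1 i hi).1) _ (hs (hI.1 i hi).2)
  refine h2.trans_lt ?_
  have h3 : (0 : ℝ) ≤ ∑ i ∈ Finset.range I.1, dist (f (I.2 i).1) (f (I.2 i).2) :=
    Finset.sum_nonneg fun _ _ => dist_nonneg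
  rw [lt_div_iff₀ (by positivity)] at h1
  nlinarith [K.coe_nonneg]

lemma _root_.AbsolutelyContinuousOnInterval.prodMk {X Y : Type*} [PseudoMetricSpace X]
    [PseudoMetricSpace Y] {f : ℝ → X} {g : ℝ → Y}
    (hf : AbsolutelyContinuousOnInterval f a b) (hg : AbsolutelyContinuousOnInterval g a b) :
    AbsolutelyContinuousOnInterval (fun t => (f t, g t)) a b := by
  apply squeeze_zero (fun t ↦ ?_) (fun t ↦ ?_) (by simpa using Tendsto.add hf hg)
  · exact Finset.sum_nonneg (fun i hi ↦ by positivity)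
  · rw [← Finset.sum_add_distrib]
    refine Finset.sum_le_sum fun i _ => ?_
    rw [Prod.dist_eq]
    exact max_le_add_of_nonneg dist_nonneg dist_nonneg

lemma _root_.AbsolutelyContinuousOnInterval.le_of_ae_deriv_nonpos {f : ℝ → ℝ} (hab : a ≤ b)
    (hf : AbsolutelyContinuousOnInterval f a b)
    (h : ∀ᵐ t ∂(volume.restrict (Icc a b)), deriv f t ≤ 0) : f b ≤ f a := by
  have h1 := hf.integral_deriv_eq_sub
  have h2 : ∫ t in a..b, deriv f t ≤ 0 := by
    rw [intervalIntegral.integral_of_le hab]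
    refine integral_nonpos_of_ae ?_
    exact ae_restrict_of_ae_restrict_of_subset Ioc_subset_Icc_self h
  linarith

/-- A norming functional reduces the bound to the fundamental theorem of calculus for real
functions. The majorant `ρ` takes values in `[0, ∞]` and need not be measurable, so the bound
applies to a control before anything is known about its measurability. -/
lemma _root_.AbsolutelyContinuousOnInterval.enorm_sub_le {E : Type*} [NormedAddCommGroup E]
    [NormedSpace ℝ E] {f : ℝ → E} (hab : a ≤ b)
    (hf : AbsolutelyContinuousOnInterval f a b) {f' : ℝ → E} {ρ : ℝ → ℝ≥0∞}
    (h : ∀ᵐ t ∂(volume.restrict (Icc a b)), HasDerivAt f (f' t) t ∧ ‖f' t‖ₑ ≤ ρ t) :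
    ENNReal.ofReal ‖f b - f a‖ ≤ ∫⁻ t in Icc a b, ρ t := by
  obtain ⟨g, hg, hgx⟩ := exists_dual_vector'' ℝ (f b - f a)
  have hgac : AbsolutelyContinuousOnInterval (fun t => g (f t)) a b :=
    hf.lipschitzOnWith_comp (g.lipschitz.lipschitzOnWith (s := univ)) (mapsTo_univ _ _)
  have h1 := hgac.integral_deriv_eq_sub
  have h2 : ‖f b - f a‖ = ∫ t in a..b, deriv (fun t => g (f t)) t := by
    rw [h1, ← map_sub]; exact hgx.symm
  rw [h2, intervalIntegral.integral_of_le hab]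
  have h3 : ∫ t in Ioc a b, deriv (fun t => g (f t)) t ≤
      ∫ t in Ioc a b, ‖deriv (fun t => g (f t)) t‖ := by
    exact (Real.le_norm_self _).trans (norm_integral_le_integral_norm _)
  have hint : IntegrableOn (deriv fun t => g (f t)) (Ioc a b) :=
    (intervalIntegrable_iff_integrableOn_Ioc_of_le hab).1 hgac.intervalIntegrable_deriv
  refine (ENNReal.ofReal_le_ofReal h3).trans ?_
  rw [ofReal_integral_norm_eq_lintegral_enorm hint]
  have h4 : ∫⁻ t in Ioc a b, ‖deriv (fun t => g (f t)) t‖ₑ ≤ ∫⁻ t in Ioc a b, ρ t := by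
    refine lintegral_mono_ae ?_
    filter_upwards [ae_restrict_of_ae_restrict_of_subset Ioc_subset_Icc_self h] with t ht
    have h5 : HasDerivAt (fun t => g (f t)) (g (f' t)) t := g.hasFDerivAt.comp_hasDerivAt t ht.1
    rw [h5.deriv]
    refine le_trans ?_ ht.2
    rw [← ofReal_norm, ← ofReal_norm]
    refine ENNReal.ofReal_le_ofReal ?_
    refine (g.le_opNorm _).trans ?_
    exact mul_le_of_le_one_left (norm_nonneg _) hg
  exact h4.trans (lintegral_mono_set Ioc_subset_Icc_self)

end AbsolutelyContinuous

/-! ### Short horizontal curves stay in the chart -/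

section Confinement

variable {E : Type*} [NormedAddCommGroup E]
  {G : Type*} [TopologicalSpace G] [ChartedSpace E G] [Group G]

variable (E G) in
/-- Points of the group whose coordinates are in the closed ball of radius `R`. -/
def chartBall (R : ℝ) : Set G :=
  {g | g ∈ (idChart E G).source ∧ ‖idChart E G g - idPt E G‖ ≤ R}

lemma chartBall_mono {R R' : ℝ} (h : R ≤ R') : chartBall E G R ⊆ chartBall E G R' :=
  fun _ hg => ⟨hg.1, hg.2.trans h⟩

lemma chartBall_mem_nhds {R : ℝ} {g : G} (hg : g ∈ (idChart E G).source)
    (h : ‖idChart E G g - idPt E G‖ < R) : chartBall E G R ∈ 𝓝 g := by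
  have h1 : ContinuousAt (fun g => ‖idChart E G g - idPt E G‖) g :=
    ((continuousAt_idChart hg).sub continuousAt_const).norm
  filter_upwards [(idChart E G).open_source.mem_nhds hg, h1.eventually (gt_mem_nhds h)]
    with g' h1 h2
  exact ⟨h1, h2.le⟩

variable [NormedSpace ℝ E]

/-- The set is the image of a compact ball under the inverse chart, hence closed since `G` is
Hausdorff. This prevents a curve from leaving the chart domain while its coordinates stay in the
ball. -/
lemma isClosed_chartBall [FiniteDimensional ℝ E] [T2Space G] {R : ℝ}
    (hR : Metric.closedBall (idPt E G) R ⊆ (idChart E G).target) : IsClosed (chartBall E G R) := by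
  have h1 : chartBall E G R = (idChart E G).symm '' Metric.closedBall (idPt E G) R := by
    ext g
    constructor
    · rintro ⟨h1, h2⟩
      exact ⟨idChart E G g, by simpa [dist_eq_norm] using h2, (idChart E G).left_inv h1⟩
    · rintro ⟨x, hx, rfl⟩
      refine ⟨(idChart E G).map_target (hR hx), ?_⟩
      rw [(idChart E G).right_inv (hR hx)]
      simpa [dist_eq_norm] using hx
  rw [h1]
  exact ((isCompact_closedBall _ _).image_of_continuousOn
    ((idChart E G).continuousOn_symm.mono hR)).isClosed

/-- The inclusion of a polarization into the model space. -/
def toModel (V : Submodule ℝ (GroupLieAlgebra 𝓘(ℝ, E) G)) : V →ₗ[ℝ] E := V.subtype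

lemma toModel_injective (V : Submodule ℝ (GroupLieAlgebra 𝓘(ℝ, E) G)) :
    Function.Injective (toModel V) := V.injective_subtype

variable {V : Submodule ℝ (GroupLieAlgebra 𝓘(ℝ, E) G)}

lemma IsHorizontal.ae_hasLeftVelocityAt {σ : ℝ → G} {v : ℝ → V} {a b : ℝ}
    (h : IsHorizontal V σ v a b) : ∀ᵐ t ∂(volume.restrict (Icc a b)),
      HasLeftVelocityAt (E := E) σ (toModel V (v t)) t := h.2

variable [LieGroup 𝓘(ℝ, E) ∞ G]

/-- A short horizontal curve stays in the domain of the chart at the identity. -/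
theorem IsHorizontal.mem_chartBall [FiniteDimensional ℝ E] [T2Space G] {R K ℓ : ℝ} (hR0 : 0 < R)
    (hR : Metric.closedBall (idPt E G) R ⊆ (idChart E G).target) {p : Seminorm ℝ V}
    (hK : ∀ g ∈ chartBall E G R, ∀ v, ‖leftJac E g (toModel V v)‖ ≤ K * p v) (hK0 : 0 ≤ K)
    {σ : ℝ → G} {v : ℝ → V} (h : IsHorizontal V σ v 0 1) (h0 : σ 0 ∈ chartBall E G (R / 4))
    (hlen : ∫⁻ t in Icc (0 : ℝ) 1, ENNReal.ofReal (p (v t)) ≤ ENNReal.ofReal ℓ) (hℓ0 : 0 ≤ ℓ)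
    (hℓ : K * ℓ ≤ R / 8) : ∀ t ∈ Icc (0 : ℝ) 1, σ t ∈ chartBall E G (R / 2) := by
  let S : Set ℝ := {t | ∀ r ∈ Icc 0 t, σ r ∈ chartBall E G (R / 2)}
  have hcl : IsClosed (chartBall E G (R / 2)) :=
    isClosed_chartBall ((Metric.closedBall_subset_closedBall (by linarith)).trans hR)
  -- As long as the curve is in the ball of radius `R / 2`, it is in fact in the ball of radius `R /
  -- 4 + R / 8 = 3 R / 8`. This slack makes the set of good times extend to the right in the
  -- continuity argument below.
  have hbound : ∀ t ∈ Icc (0 : ℝ) 1, t ∈ S → ‖idChart E G (σ t) - idPt E G‖ ≤ 3 / 8 * R := by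
    intro t ht hS
    have hac : AbsolutelyContinuousOnInterval (fun r => idChart E G (σ r)) 0 t :=
      h.1.2 1 0 t le_rfl ht.1 ht.2 fun r hr => (hS r hr).1
    have h1 := hac.enorm_sub_le ht.1 (f' := fun r => leftJac E (σ r) (toModel V (v r)))
      (ρ := fun r => ENNReal.ofReal K * ENNReal.ofReal (p (v r))) ?_
    · rw [lintegral_const_mul' _ _ ENNReal.ofReal_ne_top] at h1
      have h2 : ∫⁻ r in Icc 0 t, ENNReal.ofReal (p (v r)) ≤ ENNReal.ofReal ℓ :=
        (lintegral_mono_set (Icc_subset_Icc_right ht.2)).trans hlen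
      have h3 := h1.trans (mul_le_mul_right h2 _)
      rw [← ENNReal.ofReal_mul hK0, ENNReal.ofReal_le_ofReal_iff (by positivity)] at h3
      have h4 := norm_sub_le_norm_sub_add_norm_sub (idChart E G (σ t)) (idChart E G (σ 0))
        (idPt E G)
      have h5 := h0.2
      linarith
    · have h6 := ae_restrict_of_ae_restrict_of_subset (Icc_subset_Icc_right ht.2)
        h.ae_hasLeftVelocityAt
      filter_upwards [h6, ae_restrict_mem measurableSet_Icc] with r hr hrt
      refine ⟨hr.hasDerivAt_idChart (hS r hrt).1, ?_⟩
      rw [← ENNReal.ofReal_mul hK0, ← ofReal_norm]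
      exact ENNReal.ofReal_le_ofReal (hK _ (chartBall_mono (by linarith) (hS r hrt)) _)
  have hsub : Icc (0 : ℝ) 1 ⊆ S ∩ Icc 0 1 := by
    refine IsClosed.Icc_subset_of_forall_exists_gt ?_ ?_ ?_
    · have hS : S ∩ Icc 0 1 ∩ Icc 0 1 = S ∩ Icc 0 1 := by
        rw [inter_assoc, inter_self]
      rw [hS]
      refine isClosed_of_closure_subset fun t ht => ?_
      have ht1 : t ∈ Icc (0 : ℝ) 1 :=
        closure_minimal inter_subset_right isClosed_Icc ht
      refine ⟨fun r hr => ?_, ht1⟩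
      rcases hr.2.lt_or_eq with hrt | rfl
      · obtain ⟨t', ht', hd⟩ := mem_closure_iff_nhds.1 ht (Ioi r) (Ioi_mem_nhds hrt)
        exact hd.1 r ⟨hr.1, le_of_lt ht'⟩
      · have hcont : ContinuousWithinAt σ (S ∩ Icc 0 1) r :=
          (h.1.1 r ht1).mono inter_subset_right
        have := hcont.mem_closure_image ht
        refine hcl.closure_subset_iff.2 ?_ this
        rintro _ ⟨t', ht', rfl⟩
        exact ht'.1 t' ⟨ht'.2.1, le_rfl⟩
    · refine ⟨fun r hr => ?_, by simp⟩
      have : r = 0 := le_antisymm hr.2 hr.1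
      rw [this]
      exact chartBall_mono (by linarith) h0
    · rintro t ⟨⟨htS, ht⟩, ht1⟩ y hy
      have h1 := hbound t ht htS
      have h2 : chartBall E G (R / 2) ∈ 𝓝 (σ t) :=
        chartBall_mem_nhds (htS t ⟨ht.1, le_rfl⟩).1 (by linarith)
      have h3 : ∀ᶠ r in 𝓝[Icc 0 1] t, σ r ∈ chartBall E G (R / 2) := (h.1.1 t ht) h2
      obtain ⟨δ, hδ, h4⟩ := Metric.mem_nhdsWithin_iff.1 h3
      have hy' : t < y := hy
      let t' := min (min (t + δ / 2) y) 1
      have ht't : t < t' := lt_min (lt_min (by linarith) hy') ht1.2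
      have ht'δ : t' ≤ t + δ / 2 := (min_le_left _ _).trans (min_le_left _ _)
      have ht'1 : t' ≤ 1 := min_le_right _ _
      have ht'y : t' ≤ y := (min_le_left _ _).trans (min_le_right _ _)
      refine ⟨t', ⟨fun r hr => ?_, ht.1.trans ht't.le, ht'1⟩, ht't, ht'y⟩
      rcases le_or_gt r t with hrt | hrt
      · exact htS r ⟨hr.1, hrt⟩
      · refine h4 ⟨?_, hr.1, hr.2.trans ht'1⟩
        rw [Metric.mem_ball, Real.dist_eq, abs_of_pos (by linarith)]
        linarith [hr.2]
  exact fun t ht => (hsub ht).1 t ⟨ht.1, le_rfl⟩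

end Confinement

lemma _root_.AbsolutelyContinuousOnInterval.congr {X : Type*} [PseudoMetricSpace X] {f g : ℝ → X}
    {a b : ℝ} (hf : AbsolutelyContinuousOnInterval f a b) (h : EqOn f g (uIcc a b)) :
    AbsolutelyContinuousOnInterval g a b := by
  rw [absolutelyContinuousOnInterval_iff] at hf ⊢
  intro ε hε
  obtain ⟨δ, hδ, hf⟩ := hf ε hε
  refine ⟨δ, hδ, fun I hI hlt => ?_⟩
  convert hf I hI hlt using 1
  refine Finset.sum_congr rfl fun i hi => ?_
  rw [h (hI.1 i hi).1, h (hI.1 i hi).2]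

/-! ### Uniform estimates near the identity -/

section Radius

variable {E : Type*} [NormedAddCommGroup E] [NormedSpace ℝ E]
  {G : Type*} [TopologicalSpace G] [ChartedSpace E G] [Group G] [LieGroup 𝓘(ℝ, E) ∞ G]

/-- Near the identity, the left translations and the adjoint maps are close to the identity. -/
lemma exists_chart_radius {κ : ℝ} (hκ : 0 < κ) : ∃ R > 0, ∃ C : ℝ, 0 ≤ C ∧
    Metric.closedBall (idPt E G) R ⊆ (idChart E G).target ∧
    ContinuousOn (fun g : G => leftJac E g) (chartBall E G R) ∧
    ∀ g ∈ chartBall E G R,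
      ‖leftJac E g - ContinuousLinearMap.id ℝ E‖ ≤ C * ‖idChart E G g - idPt E G‖ ∧
      ‖leftJac E g - ContinuousLinearMap.id ℝ E‖ ≤ κ ∧
      ‖AdE E g - ContinuousLinearMap.id ℝ E‖ ≤ κ := by
  have hJ := (contDiffAt_leftJac (E := E) (G := G)).of_le (m := 1) (by simp)
  obtain ⟨C, s, hs, hC⟩ := hJ.exists_lipschitzOnWith
  have h1 : ∀ᶠ x in 𝓝 (idPt E G),
      ContinuousAt (fun x => leftJac E ((idChart E G).symm x)) x :=
    (hJ.eventually (by simp)).mono fun x hx => hx.continuousAt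
  have h2 : ∀ᶠ x in 𝓝 (idPt E G),
      ‖leftJac E ((idChart E G).symm x) - ContinuousLinearMap.id ℝ E‖ < κ := by
    have : ContinuousAt (fun x => ‖leftJac E ((idChart E G).symm x) -
      ContinuousLinearMap.id ℝ E‖) (idPt E G) := (hJ.continuousAt.sub continuousAt_const).norm
    refine this.eventually (gt_mem_nhds ?_)
    simpa using hκ
  have h3 : ∀ᶠ x in 𝓝 (idPt E G),
      ‖AdE E ((idChart E G).symm x) - ContinuousLinearMap.id ℝ E‖ < κ := by
    have : ContinuousAt (fun x => ‖AdE E ((idChart E G).symm x) -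
      ContinuousLinearMap.id ℝ E‖) (idPt E G) :=
      (contDiffAt_AdE.continuousAt.sub continuousAt_const).norm
    refine this.eventually (gt_mem_nhds ?_)
    simpa using hκ
  obtain ⟨R, hR, hb⟩ := Metric.nhds_basis_closedBall.mem_iff.1
    (inter_mem (inter_mem (inter_mem hs h1) (inter_mem h2 h3)) (idChart_target_mem_nhds (E := E)))
  have hmem : ∀ g ∈ chartBall E G R, idChart E G g ∈ Metric.closedBall (idPt E G) R :=
    fun g hg => by simpa [dist_eq_norm] using hg.2
  refine ⟨R, hR, C, C.coe_nonneg, fun x hx => (hb hx).2, fun g hg => ?_, fun g hg => ?_⟩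
  · have hc : ContinuousAt (fun x => leftJac E ((idChart E G).symm x)) (idChart E G g) :=
      (hb (hmem g hg)).1.1.2
    refine ContinuousAt.continuousWithinAt ?_
    refine (ContinuousAt.comp hc (continuousAt_idChart hg.1)).congr ?_
    filter_upwards [(idChart E G).open_source.mem_nhds hg.1] with g' hg'
    simp [(idChart E G).left_inv hg']
  · have hx := hb (hmem g hg)
    have h4 := hC.dist_le_mul _ hx.1.1.1 _ (mem_of_mem_nhds hs)
    have h5 : ‖leftJac E ((idChart E G).symm (idChart E G g)) - ContinuousLinearMap.id ℝ E‖ < κ :=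
      hx.1.2.1
    have h6 : ‖AdE E ((idChart E G).symm (idChart E G g)) - ContinuousLinearMap.id ℝ E‖ < κ :=
      hx.1.2.2
    rw [(idChart E G).left_inv hg.1] at h4 h5 h6
    rw [dist_eq_norm, dist_eq_norm, idChart_symm_idPt, leftJac_one] at h4
    exact ⟨h4, h5.le, h6.le⟩

/-- Near the identity, division is Lipschitz in coordinates. -/
lemma exists_div_radius {R₁ : ℝ} (hR₁ : 0 < R₁) : ∃ R > 0, ∃ K : NNReal,
    LipschitzOnWith K
      (fun q : E × E => idChart E G ((idChart E G).symm q.1 * ((idChart E G).symm q.2)⁻¹))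
      (Metric.closedBall (idPt E G) R ×ˢ Metric.closedBall (idPt E G) R) ∧
    ∀ g ∈ chartBall E G R, ∀ h ∈ chartBall E G R, g * h⁻¹ ∈ chartBall E G R₁ := by
  have := topologicalGroup_of_lieGroup 𝓘(ℝ, E) ∞ (G := G)
  obtain ⟨K, s, hs, hK⟩ := ((contDiffAt_div_chart (E := E) (G := G)).of_le (m := 1)
    (by simp)).exists_lipschitzOnWith
  have h1 : ContinuousAt
      (fun q : E × E => (idChart E G).symm q.1 * ((idChart E G).symm q.2)⁻¹)
      (idPt E G, idPt E G) :=
    (ContinuousAt.comp (f := Prod.fst) (x := (idPt E G, idPt E G))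
      continuousAt_idChart_symm continuousAt_fst).mul
      (ContinuousAt.comp (f := Prod.snd) (x := (idPt E G, idPt E G))
        continuousAt_idChart_symm continuousAt_snd).inv
  have h2 : chartBall E G R₁ ∈ 𝓝 ((idChart E G).symm (idPt E G) *
      ((idChart E G).symm (idPt E G))⁻¹) := by
    rw [mul_inv_cancel]
    exact chartBall_mem_nhds one_mem_idChart (by simpa using hR₁)
  have h3 := inter_mem hs (h1 h2)
  rw [nhds_prod_eq] at h3
  obtain ⟨R, hR, hb⟩ := (Metric.nhds_basis_closedBall.prod_self).mem_iff.1 h3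
  refine ⟨R, hR, K, hK.mono fun q hq => (hb hq).1, fun g hg h hh => ?_⟩
  have hg' : idChart E G g ∈ Metric.closedBall (idPt E G) R := by
    simpa [dist_eq_norm] using hg.2
  have hh' : idChart E G h ∈ Metric.closedBall (idPt E G) R := by
    simpa [dist_eq_norm] using hh.2
  have h4 : (idChart E G).symm (idChart E G g) * ((idChart E G).symm (idChart E G h))⁻¹ ∈
      chartBall E G R₁ := (hb (mk_mem_prod hg' hh')).2
  rwa [(idChart E G).left_inv hg.1, (idChart E G).left_inv hh.1] at h4

variable {V : Submodule ℝ (GroupLieAlgebra 𝓘(ℝ, E) G)}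

/-- The speed of a horizontal curve in the domain of the chart at the identity is measurable. -/
lemma IsHorizontal.aestronglyMeasurable_speed [FiniteDimensional ℝ E] {R : ℝ}
    (hcont : ContinuousOn (fun g : G => leftJac E g) (chartBall E G R))
    (hJ : ∀ g ∈ chartBall E G R, ‖leftJac E g - ContinuousLinearMap.id ℝ E‖ < 1)
    (p : Seminorm ℝ V) {σ : ℝ → G} {v : ℝ → V} {a b : ℝ} (h : IsHorizontal V σ v a b)
    (hσ : ∀ t ∈ Icc a b, σ t ∈ chartBall E G R) :
    AEStronglyMeasurable (fun t => p (v t)) (volume.restrict (Icc a b)) := by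
  have : CompleteSpace E := FiniteDimensional.complete ℝ E
  -- The control is an arbitrary function, so its measurability is recovered from the curve: it is
  -- the inverse of `leftJac` applied to the derivative of the coordinates. The retraction `r`
  -- extends `p` to a continuous seminorm on `E`.
  obtain ⟨r, hr⟩ := (toModel V).exists_leftInverse_of_injective
    (LinearMap.ker_eq_bot.2 (toModel_injective V))
  have hr' : ∀ w, r (toModel V w) = w := fun w => LinearMap.congr_fun hr w
  have hp : Continuous (p.comp r) := continuous_seminorm_comp _
  have hu : ∀ t ∈ Icc a b, IsUnit (leftJac E (σ t)) := by
    intro t ht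
    have h1 : ‖(1 : E →L[ℝ] E) - leftJac E (σ t)‖ < 1 := by
      rw [norm_sub_rev]; exact hJ _ (hσ t ht)
    have h2 := (Units.oneSub _ h1).isUnit
    simpa using h2
  have hinv : ContinuousOn (fun t => Ring.inverse (leftJac E (σ t))) (Icc a b) := by
    intro t ht
    have h1 : ContinuousWithinAt (fun t => leftJac E (σ t)) (Icc a b) t :=
      (hcont.comp h.1.1 hσ) t ht
    have h2 : ContinuousAt Ring.inverse (leftJac E (σ t)) :=
      NormedRing.inverse_continuousAt (hu t ht).unit
    exact ContinuousAt.comp_continuousWithinAt (f := fun t => leftJac E (σ t)) h2 h1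
  have hm1 : AEStronglyMeasurable (fun t => Ring.inverse (leftJac E (σ t)))
      (volume.restrict (Icc a b)) := hinv.aestronglyMeasurable measurableSet_Icc
  have hm2 : AEStronglyMeasurable (deriv fun t => idChart E G (σ t))
      (volume.restrict (Icc a b)) := aestronglyMeasurable_deriv _ _
  have hm3 : AEStronglyMeasurable (fun t => Ring.inverse (leftJac E (σ t))
      (deriv (fun t => idChart E G (σ t)) t)) (volume.restrict (Icc a b)) :=
    isBoundedBilinearMap_apply.continuous.comp_aestronglyMeasurable (hm1.prodMk hm2)
  refine (hp.comp_aestronglyMeasurable hm3).congr ?_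
  filter_upwards [h.ae_hasLeftVelocityAt, ae_restrict_mem measurableSet_Icc] with t ht hmem
  have h1 := (ht.hasDerivAt_idChart (hσ t hmem).1).deriv
  rw [h1]
  have h2 : Ring.inverse (leftJac E (σ t)) * leftJac E (σ t) = 1 :=
    Ring.inverse_mul_cancel _ (hu t hmem)
  have h3 : Ring.inverse (leftJac E (σ t)) (leftJac E (σ t) (toModel V (v t))) =
    toModel V (v t) := DFunLike.congr_fun h2 (toModel V (v t))
  rw [h3, Seminorm.comp_apply, hr']

end Radius

/-- The pointwise inequality behind the calibration argument. -/
lemma calibration_ineq {ρ b y c C₁ C₂ M x₁ x₂ x₃ : ℝ} (hc : 0 < c) (hρ : 0 ≤ ρ)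
    (h1 : ρ * x₁ ≤ -(c * b ^ 2)) (h0 : ρ = 0 → b = 0 ∧ x₁ = 0)
    (h2 : x₂ ≤ C₁ * y * b) (h3 : x₃ ≤ C₂ * y * b) (hM : (C₁ + C₂) ^ 2 ≤ 4 * c * M) :
    x₁ + x₂ - M * (ρ * y ^ 2) + x₃ ≤ 0 := by
  rcases hρ.eq_or_lt with h | h
  · obtain ⟨rfl, rfl⟩ := h0 h.symm
    rw [← h]
    linarith
  · have h4 : ρ * (x₁ + x₂ - M * (ρ * y ^ 2) + x₃) ≤ ρ * 0 := by
      have h5 := mul_le_mul_of_nonneg_left (add_le_add h2 h3) hρ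
      have h6 := mul_le_mul_of_nonneg_left hM (sq_nonneg (ρ * y))
      -- Multiplied by `4 c ρ`, the left side of the claim is at most `-(2 c b - (C₁ + C₂) ρ y)²`,
      -- because of the discriminant condition `hM`.
      have h7 : 4 * c * (ρ * (x₁ + x₂ - M * (ρ * y ^ 2) + x₃)) ≤ 4 * c * 0 := by
        have h8 : ρ * (x₁ + x₂ - M * (ρ * y ^ 2) + x₃) ≤
            -(c * b ^ 2) + ρ * ((C₁ + C₂) * y * b) - M * (ρ * y) ^ 2 := by nlinarith
        have h9 := mul_le_mul_of_nonneg_left h8 (show 0 ≤ 4 * c by positivity)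
        nlinarith [sq_nonneg (2 * c * b - (C₁ + C₂) * (ρ * y))]
      have := le_of_mul_le_mul_left h7 (by positivity)
      simpa using this
    exact le_of_mul_le_mul_left h4 h

/-! ### Calibration: short normal curves minimize length -/

section LowerBound

variable {E : Type*} [NormedAddCommGroup E] [NormedSpace ℝ E]
  {G : Type*} [TopologicalSpace G] [ChartedSpace E G] [Group G]
  {V : Submodule ℝ (GroupLieAlgebra 𝓘(ℝ, E) G)}

/-- Quadratically improved subgradient inequality for the energy of `p`. -/
def HasStrongSubgradients (p : Seminorm ℝ V) (c : ℝ) : Prop :=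
  ∀ u v : V, ∀ η ∈ subdifferential (energy p) u,
    energy p u + η (v - u) + c * ‖toModel V (v - u)‖ ^ 2 ≤ energy p v

/-- The covector `lam ∘ Ad_g`, restricted to the polarization. -/
def covector (V : Submodule ℝ (GroupLieAlgebra 𝓘(ℝ, E) G)) (lam : E →L[ℝ] ℝ) (g : G) :
    Module.Dual ℝ V :=
  (lam.comp (AdE E g)).toLinearMap ∘ₗ toModel V

lemma covector_apply (lam : E →L[ℝ] ℝ) (g : G) (v : V) :
    covector V lam g v = lam (AdE E g (toModel V v)) := rfl

namespace HasStrongSubgradients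

variable {p : Seminorm ℝ V} {c : ℝ}

lemma le_energy (h : HasStrongSubgradients p c) (v : V) : c * ‖toModel V v‖ ^ 2 ≤ energy p v := by
  have h0 : (0 : Module.Dual ℝ V) ∈ subdifferential (energy p) 0 := by
    intro w
    simpa using energy_nonneg p w
  simpa using h 0 v 0 h0

lemma exists_norm_le (h : HasStrongSubgradients p c) (hc : 0 < c) :
    ∃ K > 0, ∀ v : V, ‖toModel V v‖ ≤ K * p v := by
  refine ⟨√(1 / (2 * c)), by positivity, fun v => ?_⟩
  have h1 := h.le_energy v
  refine abs_le_of_sq_le_sq' ?_ (by positivity) |>.2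
  rw [mul_pow, Real.sq_sqrt (by positivity)]
  unfold energy at h1
  rw [div_mul_eq_mul_div, one_mul, le_div_iff₀ (by positivity)]
  linarith

lemma half_le (h : HasStrongSubgradients p c) (hc : 0 < c) {u : V} (hu : p u = 1)
    {η : Module.Dual ℝ V} (hη : η ∈ subdifferential (energy p) u) : 1 / 2 ≤ η u := by
  have h1 := h u 0 η hη
  have h2 : energy p u = 1 / 2 := by simp [energy, hu]
  rw [h2, energy_zero] at h1
  simp only [zero_sub, map_neg, norm_neg] at h1
  have : 0 ≤ c * ‖toModel V u‖ ^ 2 := by positivity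
  linarith

/-- A subgradient at a unit vector, compared with an arbitrary vector of length `p v`. -/
lemma mul_apply_sub_le (h : HasStrongSubgradients p c) {u v : V} (hu : p u = 1)
    {η : Module.Dual ℝ V} (hη : η ∈ subdifferential (energy p) u) :
    p v * η (v - p v • u) ≤ -(c * ‖toModel V (v - p v • u)‖ ^ 2) := by
  rcases (apply_nonneg p v).eq_or_lt with hv | hv
  · rw [← hv]
    have h1 := h.le_energy v
    rw [energy, ← hv] at h1
    simpa using h1
  · have h1 := h u ((p v)⁻¹ • v) η hη
    have h2 : p ((p v)⁻¹ • v) = 1 := by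
      rw [map_smul_eq_mul, norm_inv, Real.norm_of_nonneg hv.le, inv_mul_cancel₀ hv.ne']
    have h3 : energy p u = 1 / 2 := by simp [energy, hu]
    have h4 : energy p ((p v)⁻¹ • v) = 1 / 2 := by simp only [energy, h2]; norm_num
    have h5 : v - p v • u = p v • ((p v)⁻¹ • v - u) := by
      rw [smul_sub, smul_smul, mul_inv_cancel₀ hv.ne', one_smul]
    rw [h3, h4] at h1
    rw [h5, map_smul, map_smul, norm_smul, Real.norm_of_nonneg hv.le, smul_eq_mul]
    set w := (p v)⁻¹ • v - u
    nlinarith [mul_pos hv hv]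

end HasStrongSubgradients

variable [LieGroup 𝓘(ℝ, E) ∞ G]

set_option maxHeartbeats 1600000 in
/-- A short normal curve of unit speed is not longer than any horizontal curve with the same
end points. -/
theorem exists_forall_ofReal_le_length [FiniteDimensional ℝ E] [T2Space G] {p : Seminorm ℝ V}
    {c : ℝ} (hc : 0 < c) (hp : HasStrongSubgradients p c) {γ : ℝ → G} {u : ℝ → V} {ε₀ : ℝ}
    (hε₀ : 0 < ε₀) (hγ0 : γ 0 = 1)
    (hγ : ∀ t ∈ Ioo (-ε₀) ε₀, HasLeftVelocityAt (E := E) γ (toModel V (u t)) t)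
    (hu : ∀ t ∈ Ioo (-ε₀) ε₀, p (u t) = 1) (lam : E →L[ℝ] ℝ)
    (hlam : ∀ t ∈ Ioo (-ε₀) ε₀, covector V lam (γ t) ∈ subdifferential (energy p) (u t)) :
    ∃ ε > 0, ε < ε₀ ∧ ∀ s t, -ε ≤ s → s < t → t ≤ ε → ∀ (σ : ℝ → G) (v : ℝ → V),
      IsHorizontal V σ v 0 1 → σ 0 = γ s → σ 1 = γ t →
        ENNReal.ofReal (t - s) ≤ ∫⁻ r in Icc (0 : ℝ) 1, ENNReal.ofReal (p (v r)) := by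
  obtain ⟨K, hK0, hK⟩ := hp.exists_norm_le hc
  set nl := ‖lam‖ with hnl
  have hnl0 : 0 ≤ nl := norm_nonneg _
  -- With this `κ`, replacing translations and adjoint maps near the identity by the identity costs
  -- at most 1/4 of the slope 1/2 provided by `half_le`.
  let κ : ℝ := min (1 / 2) (1 / (16 * (nl * K + 1)))
  have hκ0 : 0 < κ := by positivity
  have hκ1 : κ ≤ 1 / 2 := min_le_left _ _
  have hκ2 : 4 * κ * (nl * K) ≤ 1 / 4 := by
    have : κ ≤ 1 / (16 * (nl * K + 1)) := min_le_right _ _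
    rw [le_div_iff₀ (by positivity)] at this
    linarith
  obtain ⟨R₁, hR₁, C₀, hC₀, hR₁t, hcont, hR₁b⟩ := exists_chart_radius (E := E) (G := G) hκ0
  obtain ⟨R₂, hR₂, KΨ, hΨ, hdiv⟩ := exists_div_radius (E := E) (G := G) hR₁
  let R := min R₁ R₂
  have hR : 0 < R := lt_min hR₁ hR₂
  have hRR₁ : R ≤ R₁ := min_le_left _ _
  have hRR₂ : R ≤ R₂ := min_le_right _ _
  let T := toEuclidean (E := E)
  set nT := ‖T.toContinuousLinearMap‖ with hnT
  set nT' := ‖T.symm.toContinuousLinearMap‖ with hnT'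
  have hT : ∀ x, ‖T x‖ ≤ nT * ‖x‖ := fun x => T.toContinuousLinearMap.le_opNorm x
  have hT' : ∀ x, ‖x‖ ≤ nT' * ‖T x‖ := fun x => by
    simpa using T.symm.toContinuousLinearMap.le_opNorm (T x)
  have hnT0 : 0 ≤ nT := norm_nonneg _
  have hnT'0 : 0 ≤ nT' := norm_nonneg _
  -- `C₁` controls the nonlinearity of the group law and `C₂` the derivative of the quadratic
  -- correction. `M` makes the discriminant in `calibration_ineq` nonpositive. It is fixed before
  -- `ε`, which is then chosen with `2 ε M ≤ 1`.
  let C₁ := 2 * nl * C₀ * nT'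
  let C₂ := 8 * nT
  let M := (C₁ + C₂) ^ 2 / (4 * c) + 1
  have hM0 : 0 < M := by positivity
  have hM : (C₁ + C₂) ^ 2 ≤ 4 * c * M := by
    have : 4 * c * M = (C₁ + C₂) ^ 2 + 4 * c := by
      simp only [M]; field_simp
    rw [this]; linarith
  have hJ2 : ∀ g ∈ chartBall E G R₁, ‖leftJac E g‖ ≤ 2 := by
    intro g hg
    have h1 := (hR₁b g hg).2.1
    have h2 := norm_le_norm_sub_add (leftJac E g) (ContinuousLinearMap.id ℝ E)
    have h3 := ContinuousLinearMap.norm_id_le (𝕜 := ℝ) (E := E)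
    linarith
  have hA2 : ∀ g ∈ chartBall E G R₁, ‖AdE E g‖ ≤ 2 := by
    intro g hg
    have h1 := (hR₁b g hg).2.2
    have h2 := norm_le_norm_sub_add (AdE E g) (ContinuousLinearMap.id ℝ E)
    have h3 := ContinuousLinearMap.norm_id_le (𝕜 := ℝ) (E := E)
    linarith
  have hJK : ∀ g ∈ chartBall E G R₁, ∀ w : V, ‖leftJac E g (toModel V w)‖ ≤ 2 * K * p w := by
    intro g hg w
    refine ((leftJac E g).le_opNorm _).trans ?_
    rw [mul_assoc]
    exact mul_le_mul (hJ2 g hg) (hK w) (norm_nonneg _) (by norm_num)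
  have hγc : ∀ t ∈ Ioo (-ε₀) ε₀, ContinuousAt γ t := fun t ht => (hγ t ht).continuousAt'
  obtain ⟨ε₁, hε₁, hγR⟩ : ∃ ε₁ > 0, ∀ t, |t| < ε₁ → γ t ∈ chartBall E G (R / 4) := by
    have h1 : chartBall E G (R / 4) ∈ 𝓝 (γ 0) := by
      rw [hγ0]; exact chartBall_mem_nhds one_mem_idChart (by simpa using hR)
    obtain ⟨ε₁, hε₁, h2⟩ := Metric.mem_nhds_iff.1 (hγc 0 ⟨by linarith, hε₀⟩ h1)
    exact ⟨ε₁, hε₁, fun t ht => h2 (by simpa using ht)⟩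
  let ε := min (min (ε₁ / 2) (ε₀ / 2))
    (min (1 / (2 * M)) (min (R / (32 * K)) (1 / (512 * K ^ 2 * (nT ^ 2 + 1)))))
  have hε : 0 < ε := by positivity
  have hεε₁ : ε ≤ ε₁ / 2 := (min_le_left _ _).trans (min_le_left _ _)
  have hεε₀ : ε ≤ ε₀ / 2 := (min_le_left _ _).trans (min_le_right _ _)
  have hεM : 2 * ε * M ≤ 1 := by
    have : ε ≤ 1 / (2 * M) := (min_le_right _ _).trans (min_le_left _ _)
    rw [le_div_iff₀ (by positivity)] at this
    linarith
  have hεR : 2 * K * (2 * ε) ≤ R / 8 := by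
    have : ε ≤ R / (32 * K) :=
      (min_le_right _ _).trans ((min_le_right _ _).trans (min_le_left _ _))
    rw [le_div_iff₀ (by positivity)] at this
    linarith
  have hεT : 256 * K ^ 2 * nT ^ 2 * (2 * ε) ≤ 1 := by
    have : ε ≤ 1 / (512 * K ^ 2 * (nT ^ 2 + 1)) :=
      (min_le_right _ _).trans ((min_le_right _ _).trans (min_le_right _ _))
    rw [le_div_iff₀ (by positivity)] at this
    nlinarith [mul_nonneg hε.le (sq_nonneg K)]
  have hIoo : ∀ {t}, t ∈ Icc (-ε) ε → t ∈ Ioo (-ε₀) ε₀ := fun {t} ht =>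
    ⟨by linarith [ht.1], by linarith [ht.2]⟩
  have hγR' : ∀ t ∈ Icc (-ε) ε, γ t ∈ chartBall E G (R / 4) := fun t ht =>
    hγR t (abs_lt.2 ⟨by linarith [ht.1], by linarith [ht.2]⟩)
  refine ⟨ε, hε, by linarith, fun s t hs hst ht σ v hσ hσ0 hσ1 => ?_⟩
  -- A strictly shorter competitor gives a parameter `τ` with `τ 1 < t`. The calibration `Φ` below
  -- would be both nonpositive and positive at the end point.
  by_contra! hlt
  have hsε : s ∈ Icc (-ε) ε := ⟨hs, by linarith⟩
  have htε : t ∈ Icc (-ε) ε := ⟨by linarith, ht⟩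
  have hσR : ∀ r ∈ Icc (0 : ℝ) 1, σ r ∈ chartBall E G (R / 2) := by
    refine hσ.mem_chartBall (R := R) (K := 2 * K) (ℓ := 2 * ε) (p := p) hR
      ((Metric.closedBall_subset_closedBall hRR₁).trans hR₁t)
      (fun g hg w => hJK g (chartBall_mono hRR₁ hg) w) (by positivity)
      (by rw [hσ0]; exact hγR' s hsε) (hlt.le.trans (ENNReal.ofReal_le_ofReal (by linarith)))
      (by positivity) hεR
  -- the arc length parameter
  have hmeas : AEStronglyMeasurable (fun r => p (v r)) (volume.restrict (Icc 0 1)) :=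
    hσ.aestronglyMeasurable_speed hcont
      (fun g hg => (hR₁b g hg).2.1.trans_lt (by linarith)) p
      (fun r hr => chartBall_mono (by linarith) (hσR r hr))
  have hint : IntegrableOn (fun r => p (v r)) (Icc 0 1) := by
    refine ⟨hmeas, ?_⟩
    rw [hasFiniteIntegral_iff_ofReal (Eventually.of_forall fun r => apply_nonneg p (v r))]
    exact hlt.trans ENNReal.ofReal_lt_top
  have hii : IntervalIntegrable (fun r => p (v r)) volume 0 1 :=
    (intervalIntegrable_iff_integrableOn_Icc_of_le zero_le_one).2 hint
  let τ : ℝ → ℝ := fun r => s + ∫ x in (0 : ℝ)..r, p (v x)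
  have hτ0 : τ 0 = s := by simp [τ]
  have hii' : ∀ a ∈ Icc (0 : ℝ) 1, ∀ b ∈ Icc (0 : ℝ) 1,
      IntervalIntegrable (fun r => p (v r)) volume a b := fun a ha b hb =>
    hii.mono_set (by rw [uIcc_of_le zero_le_one]; exact uIcc_subset_Icc ha hb)
  have hτmono : ∀ a ∈ Icc (0 : ℝ) 1, ∀ b ∈ Icc (0 : ℝ) 1, a ≤ b → τ a ≤ τ b := by
    intro a ha b hb hab
    have h1 := intervalIntegral.integral_add_adjacent_intervals
      (hii' 0 ⟨le_rfl, zero_le_one⟩ a ha) (hii' a ha b hb)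
    have h2 : 0 ≤ ∫ x in a..b, p (v x) :=
      intervalIntegral.integral_nonneg hab fun x _ => apply_nonneg p _
    simp only [τ]
    linarith
  have hτ1 : τ 1 < t := by
    have h1 : ∫ x in (0 : ℝ)..1, p (v x) =
        (∫⁻ r in Icc (0 : ℝ) 1, ENNReal.ofReal (p (v r))).toReal := by
      rw [intervalIntegral.integral_of_le zero_le_one, ← integral_Icc_eq_integral_Ioc,
        integral_eq_lintegral_of_nonneg_ae (Eventually.of_forall fun r => apply_nonneg p (v r))
          hmeas]
    have h2 : (∫⁻ r in Icc (0 : ℝ) 1, ENNReal.ofReal (p (v r))).toReal < t - s :=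
      (ENNReal.toReal_lt_of_lt_ofReal hlt)
    simp only [τ]
    linarith
  have h01 : (0 : ℝ) ∈ Icc (0 : ℝ) 1 := ⟨le_rfl, zero_le_one⟩
  have h11 : (1 : ℝ) ∈ Icc (0 : ℝ) 1 := ⟨zero_le_one, le_rfl⟩
  have hτs : ∀ r ∈ Icc (0 : ℝ) 1, s ≤ τ r := fun r hr => hτ0 ▸ hτmono 0 h01 r hr hr.1
  have hτt : ∀ r ∈ Icc (0 : ℝ) 1, τ r < t := fun r hr => (hτmono r hr 1 h11 hr.2).trans_lt hτ1
  have hτε : ∀ r ∈ Icc (0 : ℝ) 1, τ r ∈ Icc (-ε) ε := fun r hr =>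
    ⟨hs.trans (hτs r hr), (hτt r hr).le.trans ht⟩
  have hτac : AbsolutelyContinuousOnInterval τ 0 1 := by
    have h1 := hii.absolutelyContinuousOnInterval_intervalIntegral (c := 0) (by simp)
    have h2 : AbsolutelyContinuousOnInterval (fun _ : ℝ => s) 0 1 :=
      ((LipschitzWith.const s).lipschitzOnWith (s := uIcc (0 : ℝ) 1)).absolutelyContinuousOnInterval
    exact h2.add h1
  have hτd : ∀ᵐ r ∂(volume.restrict (Icc (0 : ℝ) 1)), HasDerivAt τ (p (v r)) r := by
    rw [ae_restrict_iff' measurableSet_Icc]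
    filter_upwards [hii.ae_hasDerivAt_integral] with r hr hmem
    exact (hr (by rwa [uIcc_of_le zero_le_one]) 0 (by simp)).const_add s
  -- the quotient of the two curves
  let ζ : ℝ → G := fun r => σ r * (γ (τ r))⁻¹
  let z : ℝ → E := fun r => idChart E G (ζ r)
  have hζ : ∀ r ∈ Icc (0 : ℝ) 1, ζ r ∈ chartBall E G R₁ := fun r hr =>
    hdiv _ (chartBall_mono (by linarith) (hσR r hr)) _
      (chartBall_mono (by linarith) (hγR' _ (hτε r hr)))
  have hzac : AbsolutelyContinuousOnInterval z 0 1 := by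
    have h1 : AbsolutelyContinuousOnInterval (fun r => idChart E G (σ r)) 0 1 :=
      hσ.1.2 1 0 1 le_rfl zero_le_one le_rfl fun r hr => (hσR r hr).1
    have hlip : LipschitzOnWith (2 * K).toNNReal (fun q => idChart E G (γ q)) (Icc (-ε) ε) := by
      refine (convex_Icc _ _).lipschitzOnWith_of_nnnorm_hasDerivWithin_le
        (f' := fun q => leftJac E (γ q) (toModel V (u q))) (fun q hq => ?_) (fun q hq => ?_)
      · exact ((hγ q (hIoo hq)).hasDerivAt_idChart (hγR' q hq).1).hasDerivWithinAt
      · have h3 := hJK (γ q) (chartBall_mono (by linarith) (hγR' q hq)) (u q)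
        rw [hu q (hIoo hq), mul_one] at h3
        rw [← NNReal.coe_le_coe, coe_nnnorm, Real.coe_toNNReal _ (by positivity)]
        exact h3
    have h2 : AbsolutelyContinuousOnInterval (fun r => idChart E G (γ (τ r))) 0 1 :=
      hτac.lipschitzOnWith_comp (g := fun q => idChart E G (γ q)) hlip
        (by rw [uIcc_of_le zero_le_one]; exact hτε)
    have h3 := (h1.prodMk h2).lipschitzOnWith_comp hΨ (by
      rw [uIcc_of_le zero_le_one]
      intro r hr
      have h4 := (hσR r hr).2
      have h5 := (hγR' _ (hτε r hr)).2
      constructor <;> rw [Metric.mem_closedBall, dist_eq_norm]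
      · exact h4.trans (by linarith)
      · exact h5.trans (by linarith))
    refine h3.congr ?_
    rw [uIcc_of_le zero_le_one]
    intro r hr
    simp only [z, ζ]
    rw [(idChart E G).left_inv (hσR r hr).1, (idChart E G).left_inv (hγR' _ (hτε r hr)).1]
  -- The curve `γ ∘ τ` runs at the speed `p (v r)` of the competitor, so `δ` compares two controls
  -- of equal norm. The quotient `ζ` has left velocity `Ad_{γ (τ r)} (δ r)`.
  let δ : ℝ → V := fun r => v r - p (v r) • u (τ r)
  let z' : ℝ → E := fun r => leftJac E (ζ r) (AdE E (γ (τ r)) (toModel V (δ r)))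
  have hzd : ∀ᵐ r ∂(volume.restrict (Icc (0 : ℝ) 1)), HasDerivAt z (z' r) r := by
    filter_upwards [hτd, hσ.ae_hasLeftVelocityAt, ae_restrict_mem measurableSet_Icc]
      with r h1 h2 hr
    have h3 := (hγ _ (hIoo (hτε r hr))).comp h1
    have h4 := (h2.mul_inv h3).hasDerivAt_idChart (hζ r hr).1
    simpa only [z, z', δ, map_sub, map_smul] using h4
  -- the calibration
  let Φ : ℝ → ℝ := fun r => lam (z r - idPt E G) - M * ((τ r - s) * ‖T (z r - idPt E G)‖ ^ 2)
  have hΦac : AbsolutelyContinuousOnInterval Φ 0 1 := by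
    have hl : ∀ f : E → ℝ, (∃ K : NNReal, LipschitzWith K f) →
        AbsolutelyContinuousOnInterval (fun r => f (z r - idPt E G)) 0 1 := by
      rintro f ⟨K, hf⟩
      have h2 : AbsolutelyContinuousOnInterval (fun _ : ℝ => idPt E G) 0 1 :=
        ((LipschitzWith.const _).lipschitzOnWith
          (s := uIcc (0 : ℝ) 1)).absolutelyContinuousOnInterval
      exact (hzac.sub h2).lipschitzOnWith_comp (hf.lipschitzOnWith (s := univ)) (mapsTo_univ _ _)
    have h1 := hl lam ⟨_, lam.lipschitz⟩
    have h2 := hl (fun x => ‖T x‖) ⟨_, lipschitzWith_one_norm.comp T.toContinuousLinearMap.lipschitz⟩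
    have h3 : AbsolutelyContinuousOnInterval (fun r => τ r - s) 0 1 := by
      have h4 : AbsolutelyContinuousOnInterval (fun _ : ℝ => s) 0 1 :=
        ((LipschitzWith.const s).lipschitzOnWith
          (s := uIcc (0 : ℝ) 1)).absolutelyContinuousOnInterval
      exact hτac.sub h4
    have h4 := h1.sub ((h3.mul (h2.mul h2)).const_mul M)
    refine h4.congr fun r _ => ?_
    simp only [Φ, Pi.sub_apply, Pi.mul_apply, sq]
  -- The main term `lam (Ad δ)` is at most `-c ‖δ‖² / p (v r)` by strong convexity. The errors are
  -- products of `‖T y‖` and `‖δ‖`, where `y` is the displacement of `ζ`. The term `-M p (v r) ‖T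
  -- y‖²` from the growth of `τ` absorbs them, by completing the square.
  have hΦd : ∀ᵐ r ∂(volume.restrict (Icc (0 : ℝ) 1)), deriv Φ r ≤ 0 := by
    filter_upwards [hτd, hzd, ae_restrict_mem measurableSet_Icc] with r h1 h2 hr
    have h3 : HasDerivAt (fun r => z r - idPt E G) (z' r) r := h2.sub_const _
    have h4 : HasDerivAt (fun r => T (z r - idPt E G)) (T (z' r)) r :=
      T.toContinuousLinearMap.hasFDerivAt.comp_hasDerivAt r h3
    have h5 : HasDerivAt (fun r => lam (z r - idPt E G)) (lam (z' r)) r :=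
      lam.hasFDerivAt.comp_hasDerivAt r h3
    have h6 := h5.sub (((h1.sub_const s).mul h4.norm_sq).const_mul M)
    have h7 : deriv Φ r = _ := h6.deriv
    rw [h7]
    set y := z r - idPt E G with hy
    set ρ := p (v r) with hρ
    have hρ0 : 0 ≤ ρ := apply_nonneg _ _
    have hτI := hIoo (hτε r hr)
    have hAd := hA2 (γ (τ r)) (chartBall_mono (by linarith) (hγR' _ (hτε r hr)))
    set b := ‖toModel V (δ r)‖ with hb
    have hb0 : 0 ≤ b := norm_nonneg _
    have hw : ‖AdE E (γ (τ r)) (toModel V (δ r))‖ ≤ 2 * b :=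
      (ContinuousLinearMap.le_opNorm _ _).trans (mul_le_mul_of_nonneg_right hAd hb0)
    set w := AdE E (γ (τ r)) (toModel V (δ r)) with hwdef
    have hz' : z' r = leftJac E (ζ r) w := rfl
    have hsplit : lam (z' r) = lam w +
        lam ((leftJac E (ζ r) - ContinuousLinearMap.id ℝ E) w) := by
      rw [← map_add, hz']; simp
    have hx1 : ρ * lam w ≤ -(c * b ^ 2) := hp.mul_apply_sub_le (hu _ hτI) (hlam _ hτI)
    have hx0 : ρ = 0 → b = 0 ∧ lam w = 0 := by
      intro h
      have h8 := hK (v r)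
      have h9 : p (v r) = 0 := h
      rw [h9, mul_zero] at h8
      have h10 : toModel V (v r) = 0 := norm_le_zero_iff.1 h8
      have h11 : toModel V (δ r) = 0 := by simp only [δ, h9, zero_smul, sub_zero, h10]
      exact ⟨by rw [hb, h11, norm_zero], by rw [hwdef, h11, map_zero, map_zero]⟩
    have hx2 : lam ((leftJac E (ζ r) - ContinuousLinearMap.id ℝ E) w) ≤ C₁ * ‖T y‖ * b := by
      refine (Real.le_norm_self _).trans ?_
      have h8 : ‖(leftJac E (ζ r) - ContinuousLinearMap.id ℝ E) w‖ ≤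
          (C₀ * (nT' * ‖T y‖)) * (2 * b) := by
        refine (ContinuousLinearMap.le_opNorm _ _).trans ?_
        refine mul_le_mul ?_ hw (norm_nonneg _) (by positivity)
        exact (hR₁b _ (hζ r hr)).1.trans (mul_le_mul_of_nonneg_left (hT' _) hC₀)
      refine (lam.le_opNorm _).trans ((mul_le_mul_of_nonneg_left h8 (norm_nonneg _)).trans ?_)
      refine le_of_eq ?_
      simp only [C₁, hnl]
      ring
    have hτs0 : 0 ≤ τ r - s := by linarith [hτs r hr]
    have hMτ : M * (τ r - s) ≤ 1 := by
      have : τ r - s ≤ 2 * ε := by linarith [hτt r hr]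
      nlinarith
    have hx3 : -(M * ((τ r - s) * (2 * inner ℝ (T y) (T (z' r))))) ≤ C₂ * ‖T y‖ * b := by
      have h8 : ‖z' r‖ ≤ 2 * (2 * b) := by
        rw [hz']
        exact (ContinuousLinearMap.le_opNorm _ _).trans
          (mul_le_mul (hJ2 _ (hζ r hr)) hw (norm_nonneg _) (by norm_num))
      have h9 : -(inner ℝ (T y) (T (z' r))) ≤ ‖T y‖ * (nT * (2 * (2 * b))) := by
        refine (neg_le_abs _).trans ((abs_real_inner_le_norm _ _).trans ?_)
        exact mul_le_mul_of_nonneg_left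
          ((hT _).trans (mul_le_mul_of_nonneg_left h8 hnT0)) (norm_nonneg _)
      have h10 : 0 ≤ M * (τ r - s) := by positivity
      have h11 : 0 ≤ ‖T y‖ * (nT * (2 * (2 * b))) := by positivity
      have h12 := mul_le_mul_of_nonneg_left h9 h10
      have h13 := mul_le_mul_of_nonneg_right hMτ h11
      simp only [C₂]
      linarith
    have := calibration_ineq hc hρ0 hx1 hx0 hx2 hx3 hM
    rw [hsplit]
    linarith
  have hΦ := hΦac.le_of_ae_deriv_nonpos zero_le_one hΦd
  have hΦ0 : Φ 0 = 0 := by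
    have : z 0 = idPt E G := by simp [z, ζ, hσ0, hτ0]
    simp [Φ, this]
  rw [hΦ0] at hΦ
  -- the end point
  set τ₁ := τ 1 with hτ₁
  let f : ℝ → E := fun q => idChart E G (γ q * (γ τ₁)⁻¹)
  have hτ₁ε : τ₁ ∈ Icc (-ε) ε := hτε 1 h11
  have hsub : ∀ q ∈ Icc τ₁ t, q ∈ Icc (-ε) ε := fun q hq =>
    ⟨hτ₁ε.1.trans hq.1, hq.2.trans ht⟩
  have hball : ∀ q ∈ Icc (-ε) ε, γ q ∈ chartBall E G R₁ := fun q hq =>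
    chartBall_mono (by linarith) (hγR' q hq)
  have hfball : ∀ q ∈ Icc τ₁ t, γ q * (γ τ₁)⁻¹ ∈ chartBall E G R₁ := fun q hq =>
    hdiv _ (chartBall_mono (by linarith) (hγR' q (hsub q hq))) _
      (chartBall_mono (by linarith) (hγR' _ hτ₁ε))
  let f' : ℝ → E := fun q => leftJac E (γ q * (γ τ₁)⁻¹) (AdE E (γ τ₁) (toModel V (u q)))
  have hfd : ∀ q ∈ Icc τ₁ t, HasDerivAt f (f' q) q := by
    intro q hq
    have h1 : HasLeftVelocityAt (E := E) (fun _ : ℝ => γ τ₁) (0 : E) q :=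
      hasLeftVelocityAt_iff.2 ⟨continuousAt_const, hasDerivAt_const _ _⟩
    have h2 := ((hγ q (hIoo (hsub q hq))).mul_inv h1).hasDerivAt_idChart (hfball q hq).1
    simpa only [sub_zero] using h2
  have hun : ∀ q ∈ Icc τ₁ t, ‖toModel V (u q)‖ ≤ K := by
    intro q hq
    have h1 := hK (u q)
    rwa [hu q (hIoo (hsub q hq)), mul_one] at h1
  have hfn : ∀ q ∈ Icc τ₁ t, ‖f' q‖ ≤ 4 * K := by
    intro q hq
    have h1 : ‖AdE E (γ τ₁) (toModel V (u q))‖ ≤ 2 * K :=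
      (ContinuousLinearMap.le_opNorm _ _).trans
        (mul_le_mul (hA2 _ (hball _ hτ₁ε)) (hun q hq) (norm_nonneg _) (by norm_num))
    have h2 : ‖f' q‖ ≤ 2 * (2 * K) :=
      (ContinuousLinearMap.le_opNorm _ _).trans
        (mul_le_mul (hJ2 _ (hfball q hq)) h1 (norm_nonneg _) (by norm_num))
    linarith
  -- The end point of the quotient is `γ t (γ τ₁)⁻¹`, obtained by running the normal curve for the
  -- time saved, `t - τ₁`. Along that arc `lam` grows at rate at least `1/2 - 1/4`.
  have hfl : ∀ q ∈ Icc τ₁ t, 1 / 4 ≤ lam (f' q) := by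
    intro q hq
    have hqI := hIoo (hsub q hq)
    have h1 : 1 / 2 ≤ lam (AdE E (γ q) (toModel V (u q))) :=
      hp.half_le hc (hu q hqI) (hlam q hqI)
    set x := toModel V (u q)
    have h2 : f' q - AdE E (γ q) x =
        (leftJac E (γ q * (γ τ₁)⁻¹) - ContinuousLinearMap.id ℝ E) (AdE E (γ τ₁) x) +
        ((AdE E (γ τ₁) - ContinuousLinearMap.id ℝ E) x) -
        ((AdE E (γ q) - ContinuousLinearMap.id ℝ E) x) := by
      simp only [f', sub_apply, ContinuousLinearMap.id_apply]
      abel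
    have hx : ‖x‖ ≤ K := hun q hq
    have e1 : ‖(leftJac E (γ q * (γ τ₁)⁻¹) - ContinuousLinearMap.id ℝ E) (AdE E (γ τ₁) x)‖ ≤
        κ * (2 * K) :=
      (ContinuousLinearMap.le_opNorm _ _).trans (mul_le_mul (hR₁b _ (hfball q hq)).2.1
        ((ContinuousLinearMap.le_opNorm _ _).trans
          (mul_le_mul (hA2 _ (hball _ hτ₁ε)) hx (norm_nonneg _) (by norm_num)))
        (norm_nonneg _) hκ0.le)
    have e2 : ‖(AdE E (γ τ₁) - ContinuousLinearMap.id ℝ E) x‖ ≤ κ * K :=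
      (ContinuousLinearMap.le_opNorm _ _).trans (mul_le_mul (hR₁b _ (hball _ hτ₁ε)).2.2
        hx (norm_nonneg _) hκ0.le)
    have e3 : ‖(AdE E (γ q) - ContinuousLinearMap.id ℝ E) x‖ ≤ κ * K :=
      (ContinuousLinearMap.le_opNorm _ _).trans (mul_le_mul (hR₁b _ (hball _ (hsub q hq))).2.2
        hx (norm_nonneg _) hκ0.le)
    have e4 : ‖f' q - AdE E (γ q) x‖ ≤ 4 * κ * K := by
      rw [h2]
      refine (norm_sub_le _ _).trans ?_
      have := norm_add_le
        ((leftJac E (γ q * (γ τ₁)⁻¹) - ContinuousLinearMap.id ℝ E) (AdE E (γ τ₁) x))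
        ((AdE E (γ τ₁) - ContinuousLinearMap.id ℝ E) x)
      linarith
    have e5 : |lam (f' q - AdE E (γ q) x)| ≤ nl * (4 * κ * K) :=
      (lam.le_opNorm _).trans (mul_le_mul_of_nonneg_left e4 hnl0)
    have e6 := (abs_le.1 e5).1
    rw [map_sub] at e6
    nlinarith
  have hf0 : f τ₁ = idPt E G := by simp [f]
  have hft : f t = z 1 := by simp only [f, z, ζ, hσ1, hτ₁]
  have hlow : 1 / 4 * (t - τ₁) ≤ lam (z 1 - idPt E G) := by
    have h1 : ∀ q ∈ Icc τ₁ t, HasDerivAt (fun q => lam (f q)) (lam (f' q)) q := fun q hq =>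
      lam.hasFDerivAt.comp_hasDerivAt q (hfd q hq)
    have h2 := (convex_Icc τ₁ t).mul_sub_le_image_sub_of_le_deriv (f := fun q => lam (f q))
      (fun q hq => (h1 q hq).continuousAt.continuousWithinAt)
      (fun q hq => (h1 q (interior_subset hq)).differentiableAt.differentiableWithinAt)
      (C := 1 / 4) (fun q hq => by
        rw [(h1 q (interior_subset hq)).deriv]; exact hfl q (interior_subset hq))
      τ₁ (left_mem_Icc.2 hτ1.le) t (right_mem_Icc.2 hτ1.le) hτ1.le
    rw [← hft, ← hf0, map_sub]
    exact h2
  have hup : ‖z 1 - idPt E G‖ ≤ 4 * K * (t - τ₁) := by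
    have h1 := norm_image_sub_le_of_norm_deriv_le_segment' (f := f) (f' := f') (C := 4 * K)
      (fun q hq => (hfd q hq).hasDerivWithinAt) (fun q hq => hfn q (Ico_subset_Icc_self hq))
      t (right_mem_Icc.2 hτ1.le)
    rwa [hft, hf0] at h1
  have hq1 : ‖T (z 1 - idPt E G)‖ ^ 2 ≤ (nT * (4 * K * (t - τ₁))) ^ 2 :=
    pow_le_pow_left₀ (norm_nonneg _) ((hT _).trans (mul_le_mul_of_nonneg_left hup hnT0)) 2
  have hd0 : 0 < t - τ₁ := by linarith
  have hτs1 : 0 ≤ τ₁ - s := by linarith [hτs 1 h11]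
  have hMτ1 : M * (τ₁ - s) ≤ 1 := by
    have : τ₁ - s ≤ 2 * ε := by linarith
    nlinarith
  -- The correction is quadratic in `t - τ₁`, so for small `ε` it cannot offset the linear gain `(t
  -- - τ₁) / 4`.
  have hq2 : M * ((τ₁ - s) * ‖T (z 1 - idPt E G)‖ ^ 2) ≤ 1 / 16 * (t - τ₁) := by
    have h1 : M * ((τ₁ - s) * ‖T (z 1 - idPt E G)‖ ^ 2) ≤ ‖T (z 1 - idPt E G)‖ ^ 2 := by
      rw [← mul_assoc]
      exact mul_le_of_le_one_left (sq_nonneg _) hMτ1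
    refine h1.trans (hq1.trans ?_)
    have h2 : t - τ₁ ≤ 2 * ε := by linarith [hτs 1 h11]
    have h3 : 256 * K ^ 2 * nT ^ 2 * (t - τ₁) ≤ 1 :=
      (mul_le_mul_of_nonneg_left h2 (by positivity)).trans hεT
    have h4 := mul_le_mul_of_nonneg_right h3 hd0.le
    nlinarith
  have hΦ1 : Φ 1 = lam (z 1 - idPt E G) - M * ((τ₁ - s) * ‖T (z 1 - idPt E G)‖ ^ 2) := rfl
  rw [hΦ1] at hΦ
  linarith

end LowerBound

/-! ### From the length bound to normal geodesics -/

section NormalGeodesic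

variable {E : Type*} [NormedAddCommGroup E] [NormedSpace ℝ E]
  {G : Type*} [TopologicalSpace G] [ChartedSpace E G] [Group G] [LieGroup 𝓘(ℝ, E) ∞ G]

lemma HasLeftVelocityAt.mul_left {γ : ℝ → G} {Z : E} {t : ℝ}
    (h : HasLeftVelocityAt (E := E) γ Z t) (g : G) :
    HasLeftVelocityAt (E := E) (fun s => g * γ s) Z t := by
  have := topologicalGroup_of_lieGroup 𝓘(ℝ, E) ∞ (G := G)
  obtain ⟨hc, hd⟩ := hasLeftVelocityAt_iff.1 h
  refine hasLeftVelocityAt_iff.2 ⟨continuousAt_const.mul hc, ?_⟩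
  simpa [mul_assoc] using hd

/-- A curve of bounded velocity is absolutely continuous. -/
lemma isACCurve_of_hasLeftVelocityAt {γ : ℝ → G} {w : ℝ → E} {a b K : ℝ}
    (h : ∀ t ∈ Icc a b, HasLeftVelocityAt (E := E) γ (w t) t) (hw : ∀ t ∈ Icc a b, ‖w t‖ ≤ K) :
    IsACCurve (E := E) γ a b := by
  have := topologicalGroup_of_lieGroup 𝓘(ℝ, E) ∞ (G := G)
  have hcont : ∀ t ∈ Icc a b, ContinuousAt γ t := fun t ht => (h t ht).continuousAt'
  refine ⟨fun t ht => (hcont t ht).continuousWithinAt, fun x c d hac hcd hdb hmaps => ?_⟩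
  have hsub : Icc c d ⊆ Icc a b := Icc_subset_Icc hac hdb
  obtain ⟨R, hR, C, -, -, -, hRb⟩ := exists_chart_radius (E := E) (G := G) one_pos
  suffices hl : LocallyLipschitzOn (Icc c d) (fun t => chartAt E x (γ t)) by
    obtain ⟨L, hL⟩ := hl.exists_lipschitzOnWith_of_compact isCompact_Icc
    rw [← uIcc_of_le hcd] at hL
    exact hL.absolutelyContinuousOnInterval
  intro t₀ ht₀
  have hK0 : 0 ≤ K := (norm_nonneg _).trans (hw t₀ (hsub ht₀))
  -- A velocity bound gives a Lipschitz bound in the chart at the identity after translating `γ t₀`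
  -- there. `F` is the smooth transition from that translated chart to the chart at `x`.
  let F : E → E := fun y => chartAt E x (γ t₀ * (idChart E G).symm y)
  have hF : ContDiffAt ℝ ∞ F (idPt E G) := by
    have h1 : ContMDiffAt 𝓘(ℝ, E) 𝓘(ℝ, E) ∞ (fun y => γ t₀ * (idChart E G).symm y) (idPt E G) :=
      contMDiffAt_const.mul (contMDiffAt_idChart_symm idPt_mem_target)
    have h2 : ContMDiffAt 𝓘(ℝ, E) 𝓘(ℝ, E) ∞ (chartAt E x)
        (γ t₀ * (idChart E G).symm (idPt E G)) := by
      refine (contMDiffOn_chart (I := 𝓘(ℝ, E)) (x := x)).contMDiffAt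
        ((chartAt E x).open_source.mem_nhds ?_)
      simpa using hmaps ht₀
    exact contMDiffAt_iff_contDiffAt.1 (h2.comp (idPt E G) h1)
  obtain ⟨L, s, hs, hL⟩ := (hF.of_le (m := 1) (by simp)).exists_lipschitzOnWith
  let k : ℝ → G := fun t => (γ t₀)⁻¹ * γ t
  have hk : ContinuousAt k t₀ := continuousAt_const.mul (hcont t₀ (hsub ht₀))
  have hk0 : k t₀ = 1 := by simp [k]
  have hk1 : k ⁻¹' chartBall E G R ∈ 𝓝 t₀ := hk (by
    rw [hk0]; exact chartBall_mem_nhds one_mem_idChart (by simpa using hR))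
  have hk2 : (fun t => idChart E G (k t)) ⁻¹' s ∈ 𝓝 t₀ := by
    have h1 : ContinuousAt (fun t => idChart E G (k t)) t₀ :=
      ContinuousAt.comp (g := idChart E G) (by rw [hk0]; exact continuousAt_idChart one_mem_idChart) hk
    exact h1 (by simpa only [hk0, idChart_one] using hs)
  obtain ⟨δ, hδ, hδs⟩ := Metric.mem_nhds_iff.1 (inter_mem hk1 hk2)
  refine ⟨L * (2 * K).toNNReal, Metric.ball t₀ δ ∩ Icc c d,
    inter_mem (mem_nhdsWithin_of_mem_nhds (Metric.ball_mem_nhds _ hδ)) self_mem_nhdsWithin, ?_⟩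
  have hlip : LipschitzOnWith (2 * K).toNNReal (fun t => idChart E G (k t))
      (Metric.ball t₀ δ ∩ Icc c d) := by
    refine ((convex_ball t₀ δ).inter (convex_Icc c d)).lipschitzOnWith_of_nnnorm_hasDerivWithin_le
      (f' := fun t => leftJac E (k t) (w t)) (fun t ht => ?_) (fun t ht => ?_)
    · exact (((h t (hsub ht.2)).mul_left _).hasDerivAt_idChart (hδs ht.1).1.1).hasDerivWithinAt
    · rw [← NNReal.coe_le_coe, coe_nnnorm, Real.coe_toNNReal _ (by positivity)]
      refine (ContinuousLinearMap.le_opNorm _ _).trans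
        (mul_le_mul ?_ (hw t (hsub ht.2)) (norm_nonneg _) (by norm_num))
      have h1 := (hRb (k t) (hδs ht.1).1).2.1
      have h2 := norm_le_norm_sub_add (leftJac E (k t)) (ContinuousLinearMap.id ℝ E)
      have h3 := ContinuousLinearMap.norm_id_le (𝕜 := ℝ) (E := E)
      linarith
  have h4 := hL.comp hlip (fun t ht => (hδs ht.1).2)
  have h5 : ∀ t ∈ Metric.ball t₀ δ ∩ Icc c d, F (idChart E G (k t)) = chartAt E x (γ t) :=
    fun t ht => by
      simp only [F, (idChart E G).left_inv (hδs ht.1).1.1]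
      simp only [k, mul_inv_cancel_left]
  intro t ht t' ht'
  have h6 := h4 ht ht'
  simpa only [Function.comp_apply, h5 t ht, h5 t' ht'] using h6

variable {V : Submodule ℝ (GroupLieAlgebra 𝓘(ℝ, E) G)} {p : Seminorm ℝ V} {K : ℝ}

lemma isHorizontal_of_hasLeftVelocityAt (hK : ∀ v : V, ‖toModel V v‖ ≤ K * p v) {γ : ℝ → G}
    {u : ℝ → V} {a b C : ℝ} (hK0 : 0 ≤ K)
    (h : ∀ t ∈ Icc a b, HasLeftVelocityAt (E := E) γ (toModel V (u t)) t)
    (hu : ∀ t ∈ Icc a b, p (u t) ≤ C) : IsHorizontal V γ u a b :=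
  ⟨isACCurve_of_hasLeftVelocityAt (K := K * C) h fun t ht =>
    (hK _).trans (mul_le_mul_of_nonneg_left (hu t ht) hK0),
    (ae_restrict_iff' measurableSet_Icc).2 (Eventually.of_forall h)⟩

/-- The distance of two points of a curve of unit speed is at most the length of the arc. -/
lemma ccDist_le_of_unit_speed (hK : ∀ v : V, ‖toModel V v‖ ≤ K * p v) (hK0 : 0 ≤ K) {γ : ℝ → G}
    {u : ℝ → V} {a b : ℝ}
    (h : ∀ t ∈ Icc a b, HasLeftVelocityAt (E := E) γ (toModel V (u t)) t)
    (hu : ∀ t ∈ Icc a b, p (u t) = 1) {s t : ℝ} (hs : s ∈ Icc a b) (ht : t ∈ Icc a b) :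
    ccDist p (γ s) (γ t) ≤ ENNReal.ofReal |s - t| := by
  let τ : ℝ → ℝ := fun r => s + r * (t - s)
  have hτ : ∀ r ∈ Icc (0 : ℝ) 1, τ r ∈ Icc a b := by
    intro r hr
    have h1 : τ r = (1 - r) • s + r • t := by simp only [τ, smul_eq_mul]; ring
    rw [h1]
    exact convex_Icc a b hs ht (by linarith [hr.2]) hr.1 (by ring)
  have hτd : ∀ r, HasDerivAt τ (t - s) r := fun r => by
    have h1 := ((hasDerivAt_id r).mul_const (t - s)).const_add s
    rwa [one_mul] at h1
  let v : ℝ → V := fun r => (t - s) • u (τ r)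
  have hv : ∀ r ∈ Icc (0 : ℝ) 1, p (v r) = |s - t| := fun r hr => by
    simp only [v]
    rw [map_smul_eq_mul, hu _ (hτ r hr), mul_one, Real.norm_eq_abs, abs_sub_comm]
  have hσ : IsHorizontal V (fun r => γ (τ r)) v 0 1 := by
    refine isHorizontal_of_hasLeftVelocityAt hK hK0 (fun r hr => ?_) (fun r hr => (hv r hr).le)
    have h1 := (h _ (hτ r hr)).comp (hτd r)
    simpa only [v, map_smul] using h1
  refine (iInf₂_le_of_le (fun r => γ (τ r)) v (iInf₂_le_of_le hσ (by simp [τ])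
    (iInf_le_of_le (by simp [τ]) le_rfl))).trans ?_
  rw [setLIntegral_congr_fun measurableSet_Icc
    (fun r hr => by simp only [hv r hr] : EqOn (fun r => ENNReal.ofReal (p (v r)))
      (fun _ => ENNReal.ofReal |s - t|) (Icc 0 1))]
  simp

lemma neg_mem_subdifferential {W : Type*} [AddCommGroup W] [Module ℝ W] {p : Seminorm ℝ W} {u : W}
    {η : Module.Dual ℝ W} (h : η ∈ subdifferential (energy p) u) :
    -η ∈ subdifferential (energy p) (-u) := by
  intro v
  have h1 := h (-v)
  have h2 : -v - u = -(v - -u) := by abel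
  rw [h2, map_neg] at h1
  simpa [energy] using h1

/-- Short normal curves of unit speed with a continuous control are geodesics. -/
theorem exists_isNormalCurve_isGeodesic [FiniteDimensional ℝ E] [T2Space G] {c : ℝ} (hc : 0 < c)
    (hp : HasStrongSubgradients p c) {γ : ℝ → G} {u : ℝ → V} {ε₀ : ℝ}
    (hε₀ : 0 < ε₀) (hγ0 : γ 0 = 1)
    (hγ : ∀ t ∈ Ioo (-ε₀) ε₀, HasLeftVelocityAt (E := E) γ (toModel V (u t)) t)
    (hu : ∀ t ∈ Ioo (-ε₀) ε₀, p (u t) = 1)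
    (huc : ContinuousOn (fun t => toModel V (u t)) (Ioo (-ε₀) ε₀)) (lam : E →L[ℝ] ℝ)
    (hlam : ∀ t ∈ Ioo (-ε₀) ε₀, covector V lam (γ t) ∈ subdifferential (energy p) (u t)) :
    ∃ ε > 0, ε < ε₀ ∧ ∀ ε' ≤ ε, IsNormalCurve p γ (-ε') ε' ∧ IsGeodesic p γ (-ε') ε' := by
  obtain ⟨K, hK0, hK⟩ := hp.exists_norm_le hc
  obtain ⟨ε₁, hε₁, hε₁₀, hfwd⟩ :=
    exists_forall_ofReal_le_length hc hp hε₀ hγ0 hγ hu lam hlam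
  have hneg : ∀ {t}, t ∈ Ioo (-ε₀) ε₀ → -t ∈ Ioo (-ε₀) ε₀ := fun {t} ht =>
    ⟨by linarith [ht.2], by linarith [ht.1]⟩
  -- The length bound treats end points with `s < t`. For `s > t` it is applied to the reversed
  -- curve, which is normal with covector `-lam` since the energy is even.
  obtain ⟨ε₂, hε₂, -, hbwd⟩ :=
    exists_forall_ofReal_le_length (γ := fun t => γ (-t)) (u := fun t => -u (-t)) hc hp hε₀
      (by simpa using hγ0)
      (fun t ht => by
        have h1 := (hγ (-t) (hneg ht)).comp (hasDerivAt_neg t)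
        simpa only [map_neg, neg_smul, one_smul] using h1)
      (fun t ht => by rw [map_neg_eq_map]; exact hu _ (hneg ht)) (-lam)
      (fun t ht => by
        have h1 := neg_mem_subdifferential (hlam _ (hneg ht))
        have h2 : covector V (-lam) (γ (-t)) = -covector V lam (γ (-t)) := by
          ext v; simp [covector_apply]
        rwa [h2])
  refine ⟨min ε₁ ε₂, lt_min hε₁ hε₂, (min_le_left _ _).trans_lt hε₁₀, fun ε hε => ?_⟩
  have hle₁ : ε ≤ ε₁ := hε.trans (min_le_left _ _)
  have hle₂ : ε ≤ ε₂ := hε.trans (min_le_right _ _)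
  have hsub : Icc (-ε) ε ⊆ Ioo (-ε₀) ε₀ := fun t ht =>
    ⟨by linarith [ht.1], by linarith [ht.2]⟩
  have hlow : ∀ s ∈ Icc (-ε) ε, ∀ t ∈ Icc (-ε) ε,
      ENNReal.ofReal |s - t| ≤ ccDist p (γ s) (γ t) := by
    intro s hs t ht
    refine le_iInf₂ fun σ v => le_iInf₂ fun hσ h0 => le_iInf fun h1 => ?_
    rcases lt_trichotomy s t with hst | rfl | hst
    · rw [abs_sub_comm, abs_of_pos (sub_pos.2 hst)]
      exact hfwd s t (by linarith [hs.1]) hst (by linarith [ht.2]) σ v hσ h0 h1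
    · simp
    · rw [abs_of_pos (sub_pos.2 hst)]
      have h2 := hbwd (-s) (-t) (by linarith [hs.2]) (by linarith) (by linarith [ht.1]) σ v hσ
        (by simpa using h0) (by simpa using h1)
      rwa [show -t - -s = s - t by ring] at h2
  have hγ' : ∀ t ∈ Icc (-ε) ε, HasLeftVelocityAt (E := E) γ (toModel V (u t)) t :=
    fun t ht => hγ t (hsub ht)
  have hu' : ∀ t ∈ Icc (-ε) ε, p (u t) = 1 := fun t ht => hu t (hsub ht)
  refine ⟨⟨u, isHorizontal_of_hasLeftVelocityAt hK hK0.le hγ' fun t ht => (hu' t ht).le, ?_, ?_,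
    lam.toLinearMap, ?_⟩, fun s hs t ht =>
      le_antisymm (ccDist_le_of_unit_speed hK hK0.le hγ' hu' hs ht) (hlow s hs t ht)⟩
  · have : TopologicalSpace.PseudoMetrizableSpace V :=
      Topology.IsInducing.pseudoMetrizableSpace (Y := E) (f := toModel V)
        Topology.IsInducing.subtypeVal
    have h1 : ContinuousOn u (Icc (-ε) ε) :=
      Topology.IsInducing.subtypeVal.continuousOn_iff.2 (huc.mono hsub)
    exact h1.aestronglyMeasurable measurableSet_Icc
  · have h1 : EqOn (fun t => p (u t) ^ 2) (fun _ => (1 : ℝ)) (Icc (-ε) ε) := fun t ht => by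
      simp [hu' t ht]
    rw [integrableOn_congr_fun h1 measurableSet_Icc]
    exact integrableOn_const (by simp) (by simp)
  · refine (ae_restrict_iff' measurableSet_Icc).2 (Eventually.of_forall fun t ht => ?_)
    exact hlam t (hsub ht)

end NormalGeodesic

/-! ### Existence and uniqueness for Lipschitz left-trivialized fields -/

section Flow

lemma exists_lipschitzOnWith_clm_apply {E F : Type*} [NormedAddCommGroup E] [NormedSpace ℝ E]
    [NormedAddCommGroup F] [NormedSpace ℝ F] {A : E → F →L[ℝ] F} {w : E → F} {x₀ : E}
    (hA : ∃ K, ∃ s ∈ 𝓝 x₀, LipschitzOnWith K A s) (hw : ∃ K, ∃ s ∈ 𝓝 x₀, LipschitzOnWith K w s) :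
    ∃ K, ∃ s ∈ 𝓝 x₀, LipschitzOnWith K (fun x => A x (w x)) s := by
  obtain ⟨K₁, s₁, hs₁, h₁⟩ := hA
  obtain ⟨K₂, s₂, hs₂, h₂⟩ := hw
  have hs : s₁ ∩ s₂ ∩ Metric.closedBall x₀ 1 ∈ 𝓝 x₀ :=
    inter_mem (inter_mem hs₁ hs₂) (Metric.closedBall_mem_nhds _ one_pos)
  have hbA : ∀ x ∈ s₁ ∩ s₂ ∩ Metric.closedBall x₀ 1, ‖A x‖ ≤ ‖A x₀‖ + K₁ := by
    rintro x ⟨⟨hx1, -⟩, hx⟩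
    have h3 := h₁.norm_sub_le hx1 (mem_of_mem_nhds hs₁)
    have h4 := mul_le_of_le_one_right K₁.coe_nonneg (mem_closedBall_iff_norm.1 hx)
    linarith [norm_le_norm_sub_add (A x) (A x₀)]
  have hbw : ∀ x ∈ s₁ ∩ s₂ ∩ Metric.closedBall x₀ 1, ‖w x‖ ≤ ‖w x₀‖ + K₂ := by
    rintro x ⟨⟨-, hx1⟩, hx⟩
    have h3 := h₂.norm_sub_le hx1 (mem_of_mem_nhds hs₂)
    have h4 := mul_le_of_le_one_right K₂.coe_nonneg (mem_closedBall_iff_norm.1 hx)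
    linarith [norm_le_norm_sub_add (w x) (w x₀)]
  let C : ℝ := K₁ * (‖w x₀‖ + K₂) + (‖A x₀‖ + K₁) * K₂
  refine ⟨C.toNNReal, _, hs, LipschitzOnWith.of_dist_le_mul fun x hx y hy => ?_⟩
  rw [Real.coe_toNNReal _ (by positivity), dist_eq_norm, dist_eq_norm]
  have h5 : A x (w x) - A y (w y) = (A x - A y) (w x) + A y (w x - w y) := by
    rw [map_sub, sub_apply]; abel
  rw [h5]
  refine (norm_add_le _ _).trans ?_
  have h6 : ‖(A x - A y) (w x)‖ ≤ K₁ * ‖x - y‖ * (‖w x₀‖ + K₂) :=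
    (ContinuousLinearMap.le_opNorm _ _).trans (mul_le_mul (h₁.norm_sub_le hx.1.1 hy.1.1) (hbw x hx)
      (norm_nonneg _) (by positivity))
  have h7 : ‖A y (w x - w y)‖ ≤ (‖A x₀‖ + K₁) * (K₂ * ‖x - y‖) :=
    (ContinuousLinearMap.le_opNorm _ _).trans (mul_le_mul (hbA y hy)
      (h₂.norm_sub_le hx.1.2 hy.1.2) (norm_nonneg _) (by positivity))
  refine (add_le_add h6 h7).trans (le_of_eq ?_)
  simp only [C]
  ring

variable {E : Type*} [NormedAddCommGroup E] [NormedSpace ℝ E]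
  {G : Type*} [TopologicalSpace G] [ChartedSpace E G] [Group G] [LieGroup 𝓘(ℝ, E) ∞ G]

/-- The coordinate expression of a left-trivialized vector field is locally Lipschitz if its
left trivialization is. -/
lemma exists_lipschitzOnWith_closedBall {w : G → E}
    (hw : ∃ K, ∃ s ∈ 𝓝 (idPt E G), LipschitzOnWith K (fun x => w ((idChart E G).symm x)) s) :
    ∃ K, ∃ R > 0, Metric.closedBall (idPt E G) R ⊆ (idChart E G).target ∧
      LipschitzOnWith K (fun x => leftJac E ((idChart E G).symm x) (w ((idChart E G).symm x)))
        (Metric.closedBall (idPt E G) R) := by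
  obtain ⟨K, s, hs, h⟩ := exists_lipschitzOnWith_clm_apply
    ((contDiffAt_leftJac (E := E) (G := G)).of_le (m := 1) (by simp)).exists_lipschitzOnWith hw
  obtain ⟨R, hR, hb⟩ := Metric.nhds_basis_closedBall.mem_iff.1
    (inter_mem hs (idChart_target_mem_nhds (E := E)))
  exact ⟨K, R, hR, fun x hx => (hb hx).2, h.mono fun x hx => (hb hx).1⟩

/-- Integral curves of a left-trivialized locally Lipschitz vector field exist. -/
theorem exists_integralCurve [CompleteSpace E] {w : G → E}
    (hw : ∃ K, ∃ s ∈ 𝓝 (idPt E G), LipschitzOnWith K (fun x => w ((idChart E G).symm x)) s) :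
    ∃ γ : ℝ → G, γ 0 = 1 ∧ ∃ ε > 0, ∀ t ∈ Ioo (-ε) ε, HasLeftVelocityAt (E := E) γ (w (γ t)) t := by
  obtain ⟨K, R, hR, hRt, hlip⟩ := exists_lipschitzOnWith_closedBall hw
  set f : E → E := fun x => leftJac E ((idChart E G).symm x) (w ((idChart E G).symm x))
  let a : NNReal := R.toNNReal
  have ha : (a : ℝ) = R := Real.coe_toNNReal _ hR.le
  -- `L` bounds the field on the ball of radius `R`, so a solution needs at least the time `R / L`
  -- to leave it.
  let L : NNReal := ‖f (idPt E G)‖₊ + K * a + 1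
  have hL : 0 < (L : ℝ) := by simp only [L]; positivity
  have hb : ∀ x ∈ Metric.closedBall (idPt E G) a, ‖f x‖ ≤ L := by
    intro x hx
    rw [ha] at hx
    have h1 := hlip.norm_sub_le hx (Metric.mem_closedBall_self hR.le)
    have h2 := mul_le_mul_of_nonneg_left (mem_closedBall_iff_norm.1 hx) K.coe_nonneg
    have h3 := norm_le_norm_sub_add (f x) (f (idPt E G))
    simp only [L, NNReal.coe_add, NNReal.coe_mul, coe_nnnorm, ha, NNReal.coe_one]
    linarith
  let ε := R / L
  have hε : 0 < ε := by positivity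
  have hpl : IsPicardLindelof (fun _ => f) (tmin := -ε) (tmax := ε)
      ⟨0, by constructor <;> linarith⟩ (idPt E G) a 0 L K := by
    refine IsPicardLindelof.of_time_independent hb (by rwa [ha]) ?_
    simp only [sub_zero, zero_sub, neg_neg, max_self, ha, NNReal.coe_zero, ε]
    exact (mul_div_cancel₀ _ hL.ne').le
  obtain ⟨x, hx0, hx⟩ := hpl.exists_eq_forall_mem_Icc_hasDerivWithinAt₀
  simp only at hx0 hx
  have hx' : ∀ t ∈ Ioo (-ε) ε, HasDerivAt x (f (x t)) t := fun t ht =>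
    (hx t (Ioo_subset_Icc_self ht)).hasDerivAt (Icc_mem_nhds ht.1 ht.2)
  have hnear : x ⁻¹' (idChart E G).target ∈ 𝓝 0 :=
    (hx' 0 ⟨by linarith, hε⟩).continuousAt (by rw [hx0]; exact idChart_target_mem_nhds)
  obtain ⟨δ, hδ, hδt⟩ := Metric.mem_nhds_iff.1 hnear
  rw [Real.ball_eq_Ioo, zero_sub, zero_add] at hδt
  refine ⟨fun t => (idChart E G).symm (x t), by simp [hx0], min ε δ, lt_min hε hδ, fun t ht => ?_⟩
  have htδ : t ∈ Ioo (-δ) δ :=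
    ⟨by linarith [ht.1, min_le_right ε δ], by linarith [ht.2, min_le_right ε δ]⟩
  have htε : t ∈ Ioo (-ε) ε :=
    ⟨by linarith [ht.1, min_le_left ε δ], by linarith [ht.2, min_le_left ε δ]⟩
  have hxt : x t ∈ (idChart E G).target := hδt htδ
  refine hasLeftVelocityAt_of_hasDerivAt_idChart ?_ ((idChart E G).map_target hxt) ?_
  · exact ContinuousAt.comp (g := (idChart E G).symm) ((idChart E G).continuousAt_symm hxt)
      (hx' t htε).continuousAt
  · refine (hx' t htε).congr_of_eventuallyEq ?_
    filter_upwards [Ioo_mem_nhds htδ.1 htδ.2] with r hr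
    exact (idChart E G).right_inv (hδt hr)

/-- Integral curves of a left-trivialized locally Lipschitz vector field are unique, backward in
time. -/
theorem exists_eqOn_of_integralCurve {w : G → E}
    (hw : ∃ K, ∃ s ∈ 𝓝 (idPt E G), LipschitzOnWith K (fun x => w ((idChart E G).symm x)) s)
    {γ₁ γ₂ : ℝ → G} (h₁0 : γ₁ 0 = 1) (h₂0 : γ₂ 0 = 1) {ε : ℝ} (hε : 0 < ε)
    (h₁ : ∀ t ∈ Icc (-ε) 0, HasLeftVelocityAt (E := E) γ₁ (w (γ₁ t)) t)
    (h₂ : ∀ t ∈ Icc (-ε) 0, HasLeftVelocityAt (E := E) γ₂ (w (γ₂ t)) t) :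
    ∃ δ > 0, EqOn γ₁ γ₂ (Icc (-δ) 0) := by
  obtain ⟨K, R, hR, hRt, hlip⟩ := exists_lipschitzOnWith_closedBall hw
  have key : ∀ γ : ℝ → G, γ 0 = 1 → (∀ t ∈ Icc (-ε) 0, HasLeftVelocityAt (E := E) γ (w (γ t)) t) →
      ∃ δ > 0, ∀ t ∈ Icc (-δ) 0, γ t ∈ chartBall E G R := by
    intro γ h0 h
    have h1 : γ ⁻¹' chartBall E G R ∈ 𝓝 0 :=
      (h 0 ⟨by linarith, le_rfl⟩).continuousAt' (by
        rw [h0]; exact chartBall_mem_nhds one_mem_idChart (by simpa using hR))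
    obtain ⟨δ, hδ, hs⟩ := Metric.nhds_basis_closedBall.mem_iff.1 h1
    refine ⟨δ, hδ, fun t ht => hs ?_⟩
    rw [Real.closedBall_eq_Icc]
    exact ⟨by linarith [ht.1], by linarith [ht.2]⟩
  obtain ⟨δ₁, hδ₁, hb₁⟩ := key γ₁ h₁0 h₁
  obtain ⟨δ₂, hδ₂, hb₂⟩ := key γ₂ h₂0 h₂
  let δ := min ε (min δ₁ δ₂)
  have hδε : δ ≤ ε := min_le_left _ _
  have hδ1 : δ ≤ δ₁ := (min_le_right _ _).trans (min_le_left _ _)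
  have hδ2 : δ ≤ δ₂ := (min_le_right _ _).trans (min_le_right _ _)
  have hd : ∀ γ : ℝ → G, (∀ t ∈ Icc (-ε) 0, HasLeftVelocityAt (E := E) γ (w (γ t)) t) →
      (∀ t ∈ Icc (-δ) 0, γ t ∈ chartBall E G R) → ∀ t ∈ Icc (-δ) 0,
      HasDerivAt (fun s => idChart E G (γ s))
        (leftJac E ((idChart E G).symm (idChart E G (γ t)))
          (w ((idChart E G).symm (idChart E G (γ t))))) t := by
    intro γ h hb t ht
    rw [(idChart E G).left_inv (hb t ht).1]
    exact (h t ⟨by linarith [ht.1], ht.2⟩).hasDerivAt_idChart (hb t ht).1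
  have hb₁' : ∀ t ∈ Icc (-δ) 0, γ₁ t ∈ chartBall E G R := fun t ht =>
    hb₁ t ⟨by linarith [ht.1], ht.2⟩
  have hb₂' : ∀ t ∈ Icc (-δ) 0, γ₂ t ∈ chartBall E G R := fun t ht =>
    hb₂ t ⟨by linarith [ht.1], ht.2⟩
  have hd₁ := hd γ₁ h₁ hb₁'
  have hd₂ := hd γ₂ h₂ hb₂'
  refine ⟨δ, lt_min hε (lt_min hδ₁ hδ₂), fun t ht => ?_⟩
  have hmem : ∀ g ∈ chartBall E G R, idChart E G g ∈ Metric.closedBall (idPt E G) R :=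
    fun g hg => by simpa [dist_eq_norm] using hg.2
  have heq := ODE_solution_unique_of_mem_Icc_left (a := -δ) (b := 0) (K := K)
    (v := fun _ x => leftJac E ((idChart E G).symm x) (w ((idChart E G).symm x)))
    (s := fun _ => Metric.closedBall (idPt E G) R) (f := fun s => idChart E G (γ₁ s))
    (g := fun s => idChart E G (γ₂ s)) (fun _ _ => hlip)
    (fun t ht => (hd₁ t ht).continuousAt.continuousWithinAt)
    (fun t ht => (hd₁ t (Ioc_subset_Icc_self ht)).hasDerivWithinAt)
    (fun t ht => hmem _ (hb₁' t (Ioc_subset_Icc_self ht)))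
    (fun t ht => (hd₂ t ht).continuousAt.continuousWithinAt)
    (fun t ht => (hd₂ t (Ioc_subset_Icc_self ht)).hasDerivWithinAt)
    (fun t ht => hmem _ (hb₂' t (Ioc_subset_Icc_self ht))) (by simp [h₁0, h₂0]) ht
  exact (idChart E G).injOn (hb₁' t ht).1 (hb₂' t ht).1 heq

end Flow

/-! ### Conservation of speed along normal curves -/

section UnitSpeed

/-- This is Euler's identity for the 2-homogeneous energy. Testing the subgradient inequality at `(1
+ x) u` for `x` of either sign leaves no other value for `η u`. -/
lemma apply_self_of_mem_subdifferential {W : Type*} [AddCommGroup W] [Module ℝ W]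
    {p : Seminorm ℝ W} {u : W} {η : Module.Dual ℝ W} (h : η ∈ subdifferential (energy p) u) :
    η u = p u ^ 2 := by
  set P := p u ^ 2 with hP
  have hP0 : 0 ≤ P := sq_nonneg _
  have h1 : ∀ x : ℝ, x * η u ≤ (x ^ 2 / 2 + x) * P := by
    intro x
    have h2 := h ((1 + x) • u)
    have h3 : (1 + x) • u - u = x • u := by rw [add_smul, one_smul, add_sub_cancel_left]
    rw [h3, map_smul, smul_eq_mul, energy, energy, map_smul_eq_mul, mul_pow, Real.norm_eq_abs,
      sq_abs, ← hP] at h2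
    linarith
  set d := η u - P with hd
  -- Dividing by `P + 1` rather than `P` also covers the case `p u = 0`.
  have h4 := h1 (d / (P + 1))
  have h5 : d / (P + 1) * d ≤ (d / (P + 1)) ^ 2 / 2 * P := by rw [hd] at h4 ⊢; linarith
  have h6 : d / (P + 1) * d = (d / (P + 1)) ^ 2 * (P + 1) := by field_simp
  rw [h6] at h5
  have h7 : (d / (P + 1)) ^ 2 ≤ 0 := by nlinarith [sq_nonneg (d / (P + 1))]
  have h8 : d / (P + 1) = 0 := pow_eq_zero_iff two_ne_zero |>.1 (le_antisymm h7 (sq_nonneg _))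
  have h9 : d = 0 := (div_eq_zero_iff.1 h8).resolve_right (by positivity)
  linarith

variable {E : Type*} [NormedAddCommGroup E] [NormedSpace ℝ E]
  {G : Type*} [TopologicalSpace G] [ChartedSpace E G] [Group G]
  {V : Submodule ℝ (GroupLieAlgebra 𝓘(ℝ, E) G)} {p : Seminorm ℝ V} {c : ℝ}

/-- The control is a Lipschitz function of the covector. -/
lemma HasStrongSubgradients.norm_sub_le (hp : HasStrongSubgradients p c) (hc : 0 < c)
    {lam : E →L[ℝ] ℝ} {g h : G} {u v : V} (hu : covector V lam g ∈ subdifferential (energy p) u)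
    (hv : covector V lam h ∈ subdifferential (energy p) v) :
    ‖toModel V u - toModel V v‖ ≤ ‖lam‖ / (2 * c) * ‖AdE E g - AdE E h‖ := by
  have h1 := hp u v _ hu
  have h2 := hp v u _ hv
  rw [map_sub, map_sub] at h1 h2
  rw [norm_sub_rev] at h1
  set d := ‖toModel V u - toModel V v‖ with hd
  -- Adding the two improved subgradient inequalities gives strong monotonicity of the
  -- subdifferential, with constant `2 c`.
  have h3 : 2 * c * d ^ 2 ≤ lam ((AdE E g - AdE E h) (toModel V u - toModel V v)) := by
    simp only [covector_apply] at h1 h2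
    simp only [sub_apply, map_sub]
    linarith
  have h4 : lam ((AdE E g - AdE E h) (toModel V u - toModel V v)) ≤
      ‖lam‖ * (‖AdE E g - AdE E h‖ * d) :=
    (le_abs_self _).trans ((lam.le_opNorm _).trans
      (mul_le_mul_of_nonneg_left (ContinuousLinearMap.le_opNorm _ _) (norm_nonneg _)))
  rcases (norm_nonneg (toModel V u - toModel V v)).eq_or_lt with h0 | h0
  · rw [hd, ← h0]; positivity
  · rw [div_mul_eq_mul_div, le_div_iff₀ (by positivity)]
    refine le_of_mul_le_mul_right ?_ h0
    calc d * (2 * c) * d = 2 * c * d ^ 2 := by ring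
      _ ≤ ‖lam‖ * (‖AdE E g - AdE E h‖ * d) := h3.trans h4
      _ = _ := by ring

variable [LieGroup 𝓘(ℝ, E) ∞ G]

/-- Normal curves have constant speed. -/
theorem speed_eq_of_normal (hp : HasStrongSubgradients p c) (hc : 0 < c) {γ : ℝ → G} {u : ℝ → V}
    {ε : ℝ} (hγ : ∀ t ∈ Ioo (-ε) ε, HasLeftVelocityAt (E := E) γ (toModel V (u t)) t)
    {lam : E →L[ℝ] ℝ}
    (hlam : ∀ t ∈ Ioo (-ε) ε, covector V lam (γ t) ∈ subdifferential (energy p) (u t)) {s t : ℝ}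
    (hs : s ∈ Ioo (-ε) ε) (ht : t ∈ Ioo (-ε) ε) : p (u s) = p (u t) := by
  -- The Hamiltonian: the Legendre transform of the energy at the moving covector, equal to `p (u
  -- t)² / 2`. Its derivative is formally `lam (Ad [u, u]) = 0`.
  let e : ℝ → ℝ := fun t => covector V lam (γ t) (u t) - energy p (u t)
  have he : ∀ t ∈ Ioo (-ε) ε, e t = p (u t) ^ 2 / 2 := fun t ht => by
    simp only [e, apply_self_of_mem_subdifferential (hlam t ht), energy]
    ring
  have hd : ∀ t ∈ Ioo (-ε) ε, HasDerivAt e 0 t := by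
    intro t ht
    have hA := (hγ t ht).hasDerivAt_AdE
    have hg : HasDerivAt (fun s => lam (AdE E (γ s) (toModel V (u t)))) 0 t := by
      have h1 := lam.hasFDerivAt.comp_hasDerivAt t (hA.clm_apply (hasDerivAt_const t (toModel V (u t))))
      simpa [Function.comp_def] using! h1
    have hg' := hg.isLittleO
    have hA2 : (fun s => ‖AdE E (γ s) - AdE E (γ t)‖ ^ 2) =o[𝓝 t] fun s => s - t := by
      have h1 : (fun s => ‖AdE E (γ s) - AdE E (γ t)‖) =O[𝓝 t] fun s => s - t :=
        hA.isBigO_sub.norm_left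
      have h2 : (fun s => ‖AdE E (γ s) - AdE E (γ t)‖) =o[𝓝 t] fun _ => (1 : ℝ) := by
        rw [Asymptotics.isLittleO_one_iff]
        have h3 : ContinuousAt (fun s => ‖AdE E (γ s) - AdE E (γ t)‖) t :=
          (hA.continuousAt.sub continuousAt_const).norm
        simpa using h3.tendsto
      simpa [sq] using h2.mul_isBigO h1
    rw [hasDerivAt_iff_isLittleO]
    simp only [smul_zero, sub_zero] at hg' ⊢
    have hsum := hg'.norm_left.add (hA2.const_mul_left (‖lam‖ * (‖lam‖ / (2 * c))))
    refine (Asymptotics.IsBigO.of_bound 1 ?_).trans_isLittleO hsum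
    filter_upwards [Ioo_mem_nhds ht.1 ht.2] with r hr
    -- The control need not be differentiable. The two subgradient inequalities place `e r - e t`
    -- between the increment `A` of the covector at the fixed vector `u t` and `A` plus a term
    -- quadratic in the increment of `Ad`. Both are `o(r - t)`.
    have h1 := hlam r hr (u t)
    have h2 := hlam t ht (u r)
    rw [map_sub] at h1 h2
    simp only [covector_apply] at h1 h2
    have h3 : lam ((AdE E (γ r) - AdE E (γ t)) (toModel V (u r) - toModel V (u t))) ≤
        ‖lam‖ * (‖lam‖ / (2 * c)) * ‖AdE E (γ r) - AdE E (γ t)‖ ^ 2 := by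
      refine (le_abs_self _).trans ((lam.le_opNorm _).trans ?_)
      rw [mul_assoc]
      refine mul_le_mul_of_nonneg_left ((ContinuousLinearMap.le_opNorm _ _).trans
        ((mul_le_mul_of_nonneg_left (hp.norm_sub_le hc (hlam r hr) (hlam t ht))
          (norm_nonneg _)).trans (le_of_eq ?_))) (norm_nonneg _)
      ring
    simp only [sub_apply, map_sub] at h3
    have h4 : 0 ≤ ‖lam‖ * (‖lam‖ / (2 * c)) * ‖AdE E (γ r) - AdE E (γ t)‖ ^ 2 := by positivity
    rw [one_mul, Real.norm_eq_abs, Real.norm_eq_abs, Real.norm_eq_abs]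
    refine le_trans ?_ (le_abs_self _)
    set A := lam (AdE E (γ r) (toModel V (u t))) - lam (AdE E (γ t) (toModel V (u t)))
      with hAdef
    have h5 := le_abs_self A
    have h6 := neg_abs_le A
    simp only [e, covector_apply]
    rw [abs_le]
    constructor <;> linarith
  have h := (isOpen_Ioo (a := -ε) (b := ε)).is_const_of_deriv_eq_zero isPreconnected_Ioo
    (fun t ht => (hd t ht).differentiableAt.differentiableWithinAt)
    (fun t ht => (hd t ht).deriv) hs ht
  rw [he s hs, he t ht] at h
  have h2 : p (u s) ^ 2 = p (u t) ^ 2 := by linarith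
  exact (sq_eq_sq₀ (apply_nonneg _ _) (apply_nonneg _ _)).1 h2

end UnitSpeed

/-! ### Construction of the branching geodesics -/

section Branching

variable {E : Type*} [NormedAddCommGroup E] [NormedSpace ℝ E]
  {G : Type*} [TopologicalSpace G] [ChartedSpace E G] [Group G] [LieGroup 𝓘(ℝ, E) ∞ G]

lemma HasLeftVelocityAt.unique {γ₁ γ₂ : ℝ → G} {Z₁ Z₂ : E} {t : ℝ}
    (h₁ : HasLeftVelocityAt (E := E) γ₁ Z₁ t) (h₂ : HasLeftVelocityAt (E := E) γ₂ Z₂ t)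
    (h : γ₁ =ᶠ[𝓝 t] γ₂) : Z₁ = Z₂ := by
  refine (hasLeftVelocityAt_iff.1 h₁).2.unique
    ((hasLeftVelocityAt_iff.1 h₂).2.congr_of_eventuallyEq ?_)
  filter_upwards [h] with s hs
  rw [hs, h.self_of_nhds]

lemma hasDerivAt_apply_AdE {γ : ℝ → G} {Z : E} {t : ℝ} (h : HasLeftVelocityAt (E := E) γ Z t)
    (lam : E →L[ℝ] ℝ) (x : E) :
    HasDerivAt (fun s => lam (AdE E (γ s) x)) (lam (AdE E (γ t) (adE E G Z x))) t := by
  have h1 := lam.hasFDerivAt.comp_hasDerivAt t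
    (h.hasDerivAt_AdE.clm_apply (hasDerivAt_const t x))
  simpa [Function.comp_def] using! h1

/-- Along the one-parameter subgroup of `y`, the adjoint maps fix what commutes with `y`. -/
lemma AdE_apply_eq_self {γ : ℝ → G} {y x : E} (h0 : γ 0 = 1)
    (h : ∀ t, HasLeftVelocityAt (E := E) γ y t) (hx : adE E G y x = 0) (t : ℝ) :
    AdE E (γ t) x = x := by
  have hd : ∀ s, HasDerivAt (fun s => AdE E (γ s) x) 0 s := fun s => by
    have h1 := (h s).hasDerivAt_AdE.clm_apply (hasDerivAt_const s x)
    simpa [hx] using h1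
  have h2 := is_const_of_deriv_eq_zero (fun s => (hd s).differentiableAt)
    (fun s => (hd s).deriv) t 0
  simpa [h0] using h2

variable {V : Submodule ℝ (GroupLieAlgebra 𝓘(ℝ, E) G)}

/-- For small times, a covector which vanishes on a subspace is small on it along the curve. -/
lemma eventually_abs_apply_AdE_le {γ : ℝ → G} {y : E} (h0 : γ 0 = 1)
    (h : HasLeftVelocityAt (E := E) γ y 0) (lam : E →L[ℝ] ℝ) :
    ∀ᶠ t in 𝓝 (0 : ℝ), ∀ x, lam x = 0 → |lam (AdE E (γ t) x)| ≤ 1 / 2 * ‖x‖ := by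
  have h1 : ContinuousAt (fun t => ‖lam‖ * ‖AdE E (γ t) - ContinuousLinearMap.id ℝ E‖) 0 :=
    continuousAt_const.mul (h.hasDerivAt_AdE.continuousAt.sub continuousAt_const).norm
  have h2 : ∀ᶠ t in 𝓝 (0 : ℝ), ‖lam‖ * ‖AdE E (γ t) - ContinuousLinearMap.id ℝ E‖ < 1 / 2 :=
    h1.eventually (gt_mem_nhds (by simp [h0]))
  filter_upwards [h2] with t ht x hx
  have h3 : lam (AdE E (γ t) x) = lam ((AdE E (γ t) - ContinuousLinearMap.id ℝ E) x) := by
    simp [hx]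
  rw [h3]
  refine (lam.le_opNorm _).trans ((mul_le_mul_of_nonneg_left
    (ContinuousLinearMap.le_opNorm _ _) (norm_nonneg _)).trans ?_)
  rw [← mul_assoc]
  exact mul_le_mul_of_nonneg_right ht.le (norm_nonneg _)

/-- The one-parameter subgroup of `Y` is a normal geodesic with covector `α`, up to time `0` it is
a normal curve with covector `lam`, and for positive times it is not. -/
theorem exists_norm_of_pos [FiniteDimensional ℝ E] {X Y : V} {lam : E →L[ℝ] ℝ}
    (hY : lam (toModel V Y) = 1) (hX : 0 < lam (adE E G (toModel V Y) (toModel V X)))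
    {γ : ℝ → G} (h0 : γ 0 = 1) (hγ : ∀ t, HasLeftVelocityAt (E := E) γ (toModel V Y) t) :
    ∃ (p : Seminorm ℝ V) (c : ℝ) (α : E →L[ℝ] ℝ), IsNorm p ∧ IsStronglyConvex (energy p) ∧
      0 < c ∧ HasStrongSubgradients p c ∧ p Y = 1 ∧ ∃ ε > 0,
      (∀ t ∈ Ioo (-ε) ε, covector V α (γ t) ∈ subdifferential (energy p) Y) ∧
      (∀ t ∈ Ioc (-ε) 0, covector V lam (γ t) ∈ subdifferential (energy p) Y) ∧
      ∀ t ∈ Ioo 0 ε, covector V lam (γ t) ∉ subdifferential (energy p) Y := by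
  set y := toModel V Y with hy
  -- The shift along `Y` puts `lam` exactly on the face `η Z = 1/2` of the corner and does not
  -- change the bracket with `Y`.
  let Z : V := X + (1 / 2 - lam (toModel V X)) • Y
  set z := toModel V Z with hz
  have hzx : z = toModel V X + (1 / 2 - lam (toModel V X)) • y := by
    simp only [hz, Z, map_add, map_smul, hy]
  have hlz : lam z = 1 / 2 := by simp [hzx, hY]
  have hadz : adE E G y z = adE E G y (toModel V X) := by simp [hzx]
  -- If `z` were `y / 2` it would commute with `y`. A functional equal to 1 on the difference then
  -- yields `α` and `β` dual to `Y` and `Z`.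
  have hz' : z - (1 / 2 : ℝ) • y ≠ 0 := by
    intro h
    have h1 : z = (1 / 2 : ℝ) • y := sub_eq_zero.1 h
    rw [← hadz, h1] at hX
    simp at hX
  obtain ⟨g, hg⟩ := SeparatingDual.exists_eq_one (R := ℝ) hz'
  let β : E →L[ℝ] ℝ := g - g y • lam
  -- Thus `lam = α + β / 2`, and `lam` as well as `α` vanishes on `ker α ∩ ker β`. For small times
  -- both remain small there after composition with `Ad`.
  let α : E →L[ℝ] ℝ := lam - (1 / 2 : ℝ) • β
  have hβy : β y = 0 := by simp [β, hY]
  have hβz : β z = 1 := by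
    simp only [β, sub_apply, smul_apply, smul_eq_mul, hlz]
    rw [map_sub, map_smul, smul_eq_mul] at hg
    linarith
  have hαy : α y = 1 := by simp [α, hβy, hY]
  have hαz : α z = 0 := by simp [α, hβz, hlz]
  obtain ⟨p, hn, hsc, ⟨c, hc, hp⟩, hpY, hmem, hcorner⟩ :=
    exists_norm_with_corner (toModel_injective V) (α := α.toLinearMap ∘ₗ toModel V)
      (β := β.toLinearMap ∘ₗ toModel V) (Y := Y) (Z := Z) hαy hαz hβy hβz
  refine ⟨p, c, α, hn, hsc, hc, hp, hpY, ?_⟩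
  have hfix : ∀ t, AdE E (γ t) y = y := fun t => AdE_apply_eq_self h0 hγ (adE_self y) t
  have hf : ∀ t, HasDerivAt (fun s => lam (AdE E (γ s) z)) (lam (AdE E (γ t) (adE E G y z))) t :=
    fun t => hasDerivAt_apply_AdE (hγ t) lam z
  have hf0 : lam (AdE E (γ 0) z) = 1 / 2 := by simp [h0, hlz]
  have e1 : ∀ᶠ t in 𝓝 (0 : ℝ), 0 < lam (AdE E (γ t) (adE E G y z)) :=
    (hasDerivAt_apply_AdE (hγ 0) lam (adE E G y z)).continuousAt.eventually
      (lt_mem_nhds (by simpa [h0, hadz] using hX))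
  have e2 : ∀ᶠ t in 𝓝 (0 : ℝ), -(1 / 2) < lam (AdE E (γ t) z) :=
    (hf 0).continuousAt.eventually (lt_mem_nhds (by simp only [hf0]; norm_num))
  have e3 : ∀ᶠ t in 𝓝 (0 : ℝ), |α (AdE E (γ t) z)| < 1 / 2 :=
    (hasDerivAt_apply_AdE (hγ 0) α z).continuousAt.abs.eventually
      (gt_mem_nhds (by simp [h0, hαz]))
  have e4 := eventually_abs_apply_AdE_le h0 (hγ 0) lam
  have e5 := eventually_abs_apply_AdE_le h0 (hγ 0) α
  obtain ⟨ε, hε, hball⟩ := Metric.eventually_nhds_iff_ball.1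
    (e1.and (e2.and (e3.and (e4.and e5))))
  rw [Real.ball_eq_Ioo, zero_sub, zero_add] at hball
  -- The derivative is `lam (Ad [y, z])`, positive near time 0 since `lam [y, z] > 0`. Hence `lam
  -- (Ad z)` crosses the threshold 1/2 exactly at `t = 0`.
  have hmono : StrictMonoOn (fun s => lam (AdE E (γ s) z)) (Ioo (-ε) ε) := by
    refine strictMonoOn_of_deriv_pos (convex_Ioo _ _)
      (fun t _ => (hf t).continuousAt.continuousWithinAt) fun t ht => ?_
    rw [interior_Ioo] at ht
    rw [(hf t).deriv]
    exact (hball t ht).1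
  have hmem0 : (0 : ℝ) ∈ Ioo (-ε) ε := ⟨by linarith, hε⟩
  refine ⟨ε, hε, fun t ht => ?_, fun t ht => ?_, fun t ht hsub => ?_⟩
  · obtain ⟨-, -, h3, -, h5⟩ := hball t ht
    refine hmem _ ?_ h3.le fun w hw _ => h5 _ hw
    rw [covector_apply, ← hy, hfix, hαy]
  · have ht' : t ∈ Ioo (-ε) ε := ⟨ht.1, ht.2.trans_lt hε⟩
    obtain ⟨-, h2, -, h4, -⟩ := hball t ht'
    refine hmem _ ?_ (abs_le.2 ⟨h2.le, ?_⟩) fun w hw hw' => h4 _ ?_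
    · rw [covector_apply, ← hy, hfix, hY]
    · have h6 := hmono.monotoneOn ht' hmem0 ht.2
      simp only [hf0] at h6
      exact h6
    · have h6 : α (toModel V w) = 0 := hw
      have h7 : β (toModel V w) = 0 := hw'
      simpa [α, h7] using h6
  · have h6 := hmono hmem0 ⟨by linarith [ht.1], ht.2⟩ ht.1
    simp only [hf0] at h6
    have h7 : lam (AdE E (γ t) z) ≤ 1 / 2 := hcorner _ hsub
    linarith

/-- Two elements of the polarization which do not commute yield a branching norm. -/
theorem exists_branching_of_pos [FiniteDimensional ℝ E] [T2Space G] {X Y : V} {lam : E →L[ℝ] ℝ}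
    (hY : lam (toModel V Y) = 1) (hX : 0 < lam (adE E G (toModel V Y) (toModel V X))) :
    ∃ p : Seminorm ℝ V, IsNorm p ∧ IsStronglyConvex (energy p) ∧ BranchingOfNormalGeodesics p := by
  have : CompleteSpace E := FiniteDimensional.complete ℝ E
  obtain ⟨γ₁, h₁0, h₁⟩ := exists_oneParameter (G := G) (toModel V Y : E)
  obtain ⟨p, c, α, hn, hsc, hc, hp, hpY, ε₀, hε₀, hα, hneg, hpos⟩ :=
    exists_norm_of_pos hY hX h₁0 h₁
  refine ⟨p, hn, hsc, ?_⟩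
  obtain ⟨ε₁, hε₁, -, hgeo₁⟩ := exists_isNormalCurve_isGeodesic hc hp (u := fun _ => Y) hε₀ h₁0
    (fun t _ => h₁ t) (fun _ _ => hpY) continuousOn_const α hα
  -- `U g` inverts the subdifferential at `lam ∘ Ad_g`. Strong convexity makes it unique and
  -- Lipschitz in `Ad_g`, so the normal inclusion for `lam` becomes the ODE with control `U (γ t)`.
  choose U hU using fun g : G =>
    exists_mem_subdifferential (toModel_injective V) hc hp.le_energy (covector V lam g)
  have hUY : ∀ g, covector V lam g ∈ subdifferential (energy p) Y → U g = Y := fun g hg => by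
    have h1 := hp.norm_sub_le hc (hU g) hg
    rw [sub_self, norm_zero, mul_zero] at h1
    exact toModel_injective V (sub_eq_zero.1 (norm_le_zero_iff.1 h1))
  have hlip : ∃ K, ∃ s ∈ 𝓝 (idPt E G),
      LipschitzOnWith K (fun x => toModel V (U ((idChart E G).symm x))) s := by
    obtain ⟨K, s, hs, h⟩ := ((contDiffAt_AdE (E := E) (G := G)).of_le (m := 1)
      (by simp)).exists_lipschitzOnWith
    let C := ‖lam‖ / (2 * c)
    have hC : 0 ≤ C := by positivity
    refine ⟨C.toNNReal * K, s, hs, LipschitzOnWith.of_dist_le_mul fun x hx y hy => ?_⟩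
    rw [NNReal.coe_mul, Real.coe_toNNReal _ hC, mul_assoc, dist_eq_norm]
    refine (hp.norm_sub_le hc (hU _) (hU _)).trans (mul_le_mul_of_nonneg_left ?_ hC)
    rw [← dist_eq_norm]
    exact h.dist_le_mul _ hx _ hy
  obtain ⟨γ₂, h₂0, ε₂, hε₂, h₂⟩ := exists_integralCurve (w := fun g => toModel V (U g)) hlip
  have hU1 : U 1 = Y := hUY 1 (h₁0 ▸ hneg 0 ⟨by linarith, le_rfl⟩)
  obtain ⟨ε₃, hε₃, hε₃₂, hgeo₂⟩ := exists_isNormalCurve_isGeodesic hc hp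
    (u := fun t => U (γ₂ t)) hε₂ h₂0 h₂
    (fun t ht => by
      have h3 := speed_eq_of_normal hp hc h₂ (lam := lam) (fun t _ => hU _) ht
        (t := 0) ⟨by linarith, hε₂⟩
      rw [h3, h₂0, hU1, hpY])
    (fun t ht => by
      refine ContinuousAt.continuousWithinAt ?_
      have h3 : ContinuousAt (fun s => ‖lam‖ / (2 * c) * ‖AdE E (γ₂ s) - AdE E (γ₂ t)‖) t :=
        continuousAt_const.mul
          ((h₂ t ht).hasDerivAt_AdE.continuousAt.sub continuousAt_const).norm
      refine tendsto_iff_norm_sub_tendsto_zero.2 (squeeze_zero (fun _ => norm_nonneg _)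
        (fun s => hp.norm_sub_le hc (hU (γ₂ s)) (hU (γ₂ t))) ?_)
      simpa using h3.tendsto)
    lam (fun t _ => hU _)
  let ε₄ := min ε₀ ε₂ / 2
  have hε₄ : 0 < ε₄ := half_pos (lt_min hε₀ hε₂)
  have hε₄₀ : ε₄ < ε₀ := (half_lt_self (lt_min hε₀ hε₂)).trans_le (min_le_left _ _)
  have hε₄₂ : ε₄ < ε₂ := (half_lt_self (lt_min hε₀ hε₂)).trans_le (min_le_right _ _)
  -- For small `t ≤ 0` the inclusion for `lam` holds with control `Y`, so `U (γ₁ t) = Y` and `γ₁`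
  -- solves the ODE of `γ₂` there.
  obtain ⟨δ, hδ, heq⟩ := exists_eqOn_of_integralCurve (w := fun g => toModel V (U g)) hlip h₁0 h₂0
    hε₄
    (fun t ht => by
      rw [hUY _ (hneg t ⟨by linarith [ht.1], ht.2⟩)]
      exact h₁ t)
    (fun t ht => h₂ t ⟨by linarith [ht.1], by linarith [ht.2]⟩)
  let ε := min ε₁ (min ε₃ ε₄)
  have hε : 0 < ε := lt_min hε₁ (lt_min hε₃ hε₄)
  have hle₁ : ε ≤ ε₁ := min_le_left _ _
  have hle₃ : ε ≤ ε₃ := (min_le_right _ _).trans (min_le_left _ _)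
  have hle₄ : ε ≤ ε₄ := (min_le_right _ _).trans (min_le_right _ _)
  refine ⟨-ε, ε, γ₁, γ₂, hgeo₁ ε hle₁, hgeo₂ ε hle₃,
    ⟨-min δ ε, 0, neg_le_neg (min_le_right _ _), neg_lt_zero.2 (lt_min hδ hε), hε.le,
      heq.mono (Icc_subset_Icc_left (neg_le_neg (min_le_left _ _)))⟩, ?_⟩
  -- If the curves agreed on the whole interval, equality of velocities at `ε / 2` would give `U (γ₂
  -- (ε / 2)) = Y`. The covector would then still be a subgradient at `Y` at a positive time.
  by_contra! hall
  have hnhds : γ₁ =ᶠ[𝓝 (ε / 2)] γ₂ := by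
    filter_upwards [Icc_mem_nhds (show -ε < ε / 2 by linarith) (half_lt_self hε)] with t ht
    exact hall t ht
  have hvel := (h₁ (ε / 2)).unique (h₂ (ε / 2) ⟨by linarith, by linarith⟩) hnhds
  refine hpos (ε / 2) ⟨by linarith, by linarith⟩ ?_
  rw [toModel_injective V hvel, hnhds.self_of_nhds]
  exact hU _

/-- A nonzero bracket forces `Y ≠ 0`, so one functional can be normalized at `Y` and nonzero on the
bracket. Replacing `X` by `-X` adjusts the sign. -/
theorem exists_branching_of_adE_ne_zero [FiniteDimensional ℝ E] [T2Space G] {X Y : V}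
    (h : adE E G (toModel V Y) (toModel V X) ≠ 0) :
    ∃ p : Seminorm ℝ V, IsNorm p ∧ IsStronglyConvex (energy p) ∧ BranchingOfNormalGeodesics p := by
  have hY : toModel V Y ≠ 0 := by
    rintro hY
    rw [hY, map_zero] at h
    exact h rfl
  obtain ⟨lam, h1, h2⟩ := SeparatingDual.exists_eq_one_ne_zero_of_ne_zero_pair (R := ℝ) hY h
  rcases h2.lt_or_gt with h3 | h3
  · exact exists_branching_of_pos (X := -X) h1 (by simpa using h3)
  · exact exists_branching_of_pos h1 h3

end Branching

end SubFinsler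

end

theorem theorem1p1
    {E : Type*} [NormedAddCommGroup E] [NormedSpace ℝ E] [FiniteDimensional ℝ E]
    {G : Type*} [TopologicalSpace G] [ChartedSpace E G] [Group G]
    [LieGroup 𝓘(ℝ, E) ∞ G] [T2Space G]
    (V : Submodule ℝ (GroupLieAlgebra 𝓘(ℝ, E) G))
    (hV : ∃ X ∈ V, ∃ Y ∈ V, ¬ Bornology.IsVonNBounded ℝ
      (Set.range fun t : ℝ => SubFinsler.Ad (SubFinsler.lieExp (G := G) (t • Y)) X)) :
    ∃ p : Seminorm ℝ V, SubFinsler.IsNorm p ∧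
      SubFinsler.IsStronglyConvex (SubFinsler.energy p) ∧
      SubFinsler.BranchingOfNormalGeodesics p := by
  obtain ⟨X, hX, Y, hY, hunb⟩ := hV
  -- If the bracket vanishes, every `Ad_{exp(tY)}` fixes `X` and the orbit is the bounded set `{X}`.
  by_cases h : SubFinsler.adE E G Y X = 0
  · refine absurd ((Bornology.isVonNBounded_singleton (𝕜 := ℝ) X).subset ?_) hunb
    rintro _ ⟨t, rfl⟩
    have hspec := (SubFinsler.exists_oneParameter (G := G) (t • Y)).choose_spec
    have h0 : SubFinsler.adE E G (t • Y : E) X = 0 :=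
      (DFunLike.congr_fun ((SubFinsler.adE E G).map_smul t Y) X).trans
        ((congrArg (t • ·) h).trans (smul_zero t))
    -- Time 1 on the one-parameter subgroup of `t • Y`, which is how `lieExp (t • Y)` is defined.
    exact SubFinsler.AdE_apply_eq_self hspec.1 hspec.2 h0 1
  · exact SubFinsler.exists_branching_of_adE_ne_zero (V := V) (X := ⟨X, hX⟩) (Y := ⟨Y, hY⟩) h
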